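/- **Setting.** Let $\mathbf{Man}$ be the category of finite-dimensional smooth manifolds (Hausdorff, second countable) and smooth maps. For $U\in\mathbf{Man}$ let $C^\infty_{\mathbb{C},U}$ be the sheaf of smooth complex-valued functions on $U$, and let $\mathbf{Sh}(U)$ be the category of sheaves of $C^\infty_{\mathbb{C},U}$-modules on $U$, with the relative tensor product $\otimes=\otimes_{C^\infty_{\mathbb{C},U}}$ and the complex conjugation functor $V\mapsto\overline{V}$. A smooth map $h:U\to U'$ has the pullback functor $h^*:\mathbf{Sh}(U')\to\mathbf{Sh}(U)$, $h^*V=h^{-1}V\otimes_{h^{-1}C^\infty_{\mathbb{C},U'}}C^\infty_{\mathbb{C},U}$, together with the canonical isomorphisms $h^*V\otimes h^*W\cong h^*(V\otimes W)$, $h^*C^\infty_{\mathbb{C},U'}\cong C^\infty_{\mathbb{C},U}$, $h^*\overline{V}\cong\overline{h^*V}$, $\mathrm{id}^*V\cong V$ and $g^*h^*V\cong(hg)^*V$. * ${}^*\mathbf{Obj}(U)$: the category of pairs $(V,*)$ of $V\in\mathbf{Sh}(U)$ and a morphism $*:V\to\overline{V}$ with $v^{**}=v$ on sections; the morphisms preserve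 $*$. It is symmetric monoidal with $(v\otimes w)^*=v^*\otimes w^*$ and with unit $C^\infty_{\mathbb{C},U}$ carrying complex conjugation. * $\mathbf{IPVec}^\infty_{\mathbb{C}}(U)$: the category of triples $(V,*,\langle\cdot,\cdot\rangle)$ of $(V,*)\in{}^*\mathbf{Obj}(U)$ and a symmetric morphism $\langle\cdot,\cdot\rangle:V\otimes V\to C^\infty_{\mathbb{C},U}$ with $\langle v,w\rangle^*=\langle v^*,w^*\rangle$; the morphisms are the ${}^*\mathbf{Obj}(U)$-morphisms that preserve the pairings. * ${}^*\mathbf{Alg}^\infty_{\mathbb{C}}(U)$: the category of order-reversing $*$-monoids in $\mathbf{Sh}(U)$, that is, $(A,*)\in{}^*\mathbf{Obj}(U)$ with an associative unital multiplication $\mu:A\otimes A\to A$ and unit $\eta:C^\infty_{\mathbb{C},U}\to A$ such that $(ab)^*=b^*a^*$ and $1^*=1$; the morphisms are the unital multiplicative $*$-preserving morphisms. Via the canonical isomorphisms, $U\mapsto\mathbf{IPVec}^\infty_{\mathbb{C}}(U)$ and $U\mapsto{}^*\mathbf{Alg}^\infty_{\mathbb{C}}(U)$, with the pullback functors $h^*$,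 are contravariant pseudofunctors on $\mathbf{Man}$. A *stack morphism* between them is a pseudonatural transformation: a functor for each $U$, and for each smooth $h:U\to U'$ a natural coherence isomorphism, compatible with identities and with composition of smooth maps. **Statement.** For each $U\in\mathbf{Man}$ the forgetful functor $G_U:{}^*\mathbf{Alg}^\infty_{\mathbb{C}}(U)\to{}^*\mathbf{Obj}(U)$ has a left adjoint $F_U$ (the free order-reversing $*$-monoid), whose underlying sheaf is $F_U(V,*)\cong\bigoplus_{n\ge 0}V^{\otimes n}$ (the $n$-th summand being included by the $n$-fold product of the adjunction unit), and for each smooth $h:U\to U'$ the canonical morphism $F_h:F_U h^*\Rightarrow h^*F_{U'}$, which is adjunct to the pullback along $h$ of the adjunction unit of $F_{U'}\dashv G_{U'}$, is an isomorphism. Moreover there is a stack morphism $$\mathfrak{CAR}:\mathbf{IPVec}^\infty_{\mathbb{C}}\longrightarrow{}^*\mathbf{Alg}^\infty_{\mathbb{C}}$$ with the following properties. 1. For each $U$ and each $(V,*,\langle\cdot,\cdot\rangle)\in\mathbf{IPVec}^\infty_{\mathbb{C}}(U)$, the algebra $\mathfrak{CAR}_U(V,*,\langle\cdot,\cdot\rangle)$,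 with a projection $\pi_V:F_U(V,*)\to\mathfrak{CAR}_U(V,*,\langle\cdot,\cdot\rangle)$, is the coequalizer in ${}^*\mathbf{Alg}^\infty_{\mathbb{C}}(U)$ of the pair $$s_1,s_2:\;F_U\big((V,*)\otimes(V,*)\big)\rightrightarrows F_U(V,*)$$ whose adjuncts under $F_U\dashv G_U$ are $\tilde s_1(v\otimes v')=v\,v'+v'\,v$ (the adjunction unit on both factors, followed by $\mu+\mu^{\mathrm{op}}$) and $\tilde s_2(v\otimes v')=\langle v,v'\rangle\,1$ (the pairing followed by $\eta$). 2. $\pi$ is natural: $\mathfrak{CAR}_U(\psi)\circ\pi_V=\pi_W\circ F_U(\psi)$ for each morphism $\psi:V\to W$ of $\mathbf{IPVec}^\infty_{\mathbb{C}}(U)$. 3. For each smooth $h:U\to U'$ and each $V\in\mathbf{IPVec}^\infty_{\mathbb{C}}(U')$, the coherence isomorphism $\mathfrak{CAR}_U(h^*V)\cong h^*\mathfrak{CAR}_{U'}(V)$ is the one induced by $F_h$: its composite with $\pi_{h^*V}$ is $h^*(\pi_V)\circ F_h$. -/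

import Mathlib

open CategoryTheory Opposite TopologicalSpace
open scoped Manifold ContDiff

noncomputable section

namespace SmoothCAR

/-- Smooth manifolds: second countable Hausdorff spaces with a smooth atlas modelled on a Euclidean
space. -/
structure Man where
  carrier : Type
  dim : ℕ
  [top : TopologicalSpace carrier]
  [charted : ChartedSpace (EuclideanSpace ℝ (Fin dim)) carrier]
  [smooth : IsManifold (𝓡 dim) ∞ carrier]
  [t2 : T2Space carrier]
  [secondCountable : SecondCountableTopology carrier]

attribute [instance] Man.top Man.charted Man.smooth Man.t2 Man.secondCountable

/-- The morphisms are all smooth maps. -/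
instance : Category Man where
  Hom U U' := C^∞⟮𝓡 U.dim, U.carrier; 𝓡 U'.dim, U'.carrier⟯
  id _ := ContMDiffMap.id
  comp f g := ContMDiffMap.comp g f

def Man.toMap {U U' : Man} (h : U ⟶ U') : C^∞⟮𝓡 U.dim, U.carrier; 𝓡 U'.dim, U'.carrier⟯ := h

instance : ContMDiffRing 𝓘(ℝ, ℂ) ∞ ℂ where
  contMDiff_mul := (contDiff_mul (𝕜 := ℝ) (𝔸 := ℂ)).contMDiff.comp
    (contMDiff_fst.prodMk_space contMDiff_snd)

abbrev Man.space (U : Man) : TopCat := TopCat.of U.carrier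

/-- The open subsets of `U`. -/
abbrev Man.Op (U : Man) := Opens U.space

/-- The ring of smooth complex-valued functions on the open subset `O`. -/
abbrev Fn (U : Man) (O : U.Op) : Type := C^∞⟮𝓡 U.dim, (O : Opens U.carrier); 𝓘(ℝ, ℂ), ℂ⟯

def fnRes {U : Man} {O O' : U.Op} (i : O' ≤ O) : Fn U O →+* Fn U O' :=
  ContMDiffMap.restrictRingHom (𝓡 U.dim) 𝓘(ℝ, ℂ) ℂ (U := O') (V := O) i

/-- Pointwise complex conjugation. -/
def fnConj {U : Man} (O : U.Op) : Fn U O →+* Fn U O where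
  toFun a := ⟨fun x => star (a x), 
     (Complex.conjCLE.contDiff.contMDiff (n := ∞)).comp a.contMDiff⟩
  map_one' := by ext; simp
  map_mul' a b := ContMDiffMap.ext fun x => star_mul' (a x) (b x)
  map_zero' := by ext; simp
  map_add' a b := ContMDiffMap.ext fun x => star_add (a x) (b x)

/-- The sheaf of complex-valued smooth functions, as a sheaf of rings -/
def fnSheaf (U : Man) : Sheaf (Opens.grothendieckTopology U.space) RingCat.{0} :=
  (sheafCompose _ (forget₂ CommRingCat RingCat)).obj
    (smoothSheafCommRing (𝓡 U.dim) 𝓘(ℝ, ℂ) U.carrier ℂ)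

/-- Sheaves of modules over the sheaf of smooth complex-valued functions on `U`. -/
def Sh (U : Man) := SheafOfModules.{0} (fnSheaf U)
instance (U : Man) : Category (Sh U) := inferInstanceAs (Category (SheafOfModules.{0} (fnSheaf U)))

/-- The sections of `V` over `O`. -/
def Sec {U : Man} (V : Sh U) (O : U.Op) : Type := V.val.obj (op O)

instance {U : Man} (V : Sh U) (O : U.Op) : AddCommGroup (Sec V O) :=
  inferInstanceAs (AddCommGroup (V.val.obj (op O)))
instance {U : Man} (V : Sh U) (O : U.Op) : Module (Fn U O) (Sec V O) :=
  inferInstanceAs (Module ((fnSheaf U).obj.obj (op O)) (V.val.obj (op O)))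

/-- Restriction of sections. -/
def res {U : Man} {V : Sh U} {O O' : U.Op} (i : O' ≤ O) : Sec V O →+ Sec V O' :=
  (V.val.presheaf.map (homOfLE i).op).hom

section
variable {U : Man} {V W X : Sh U} {O O' O'' : U.Op}

lemma res_smul (i : O' ≤ O) (a : Fn U O) (v : Sec V O) :
    res i (a • v) = fnRes i a • res i v :=
  V.val.map_smul (homOfLE i).op a v

@[simp] lemma res_self (v : Sec V O) : res (le_refl O) v = v :=
  ConcreteCategory.congr_hom (V.val.presheaf.map_id (op O)) v

@[simp] lemma res_res (i : O' ≤ O) (j : O'' ≤ O') (v : Sec V O) :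
    res j (res i v) = res (j.trans i) v :=
  (ConcreteCategory.congr_hom (V.val.presheaf.map_comp (homOfLE i).op (homOfLE j).op) v).symm

/-- The components of a morphism of sheaves of modules. -/
def app (f : V ⟶ W) (O : U.Op) : Sec V O →ₗ[Fn U O] Sec W O :=
  (SheafOfModules.Hom.val f |>.app (op O)).hom

lemma app_res (f : V ⟶ W) (i : O' ≤ O) (v : Sec V O) : app f O' (res i v) = res i (app f O v) :=
  PresheafOfModules.naturality_apply (SheafOfModules.Hom.val f) (homOfLE i).op v

@[simp] lemma app_id (v : Sec V O) : app (𝟙 V) O v = v := rfl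
@[simp] lemma app_comp (f : V ⟶ W) (g : W ⟶ X) (v : Sec V O) :
  app (f ≫ g) O v = app g O (app f O v) := rfl

lemma hom_ext {f g : V ⟶ W} (e : ∀ O v, app f O v = app g O v) : f = g := by
  apply SheafOfModules.hom_ext
  apply PresheafOfModules.hom_ext
  rintro ⟨O⟩
  exact ModuleCat.hom_ext (LinearMap.ext (e O))

def homMk (f : ∀ O, Sec V O →ₗ[Fn U O] Sec W O)
    (hf : ∀ {O O' : U.Op} (i : O' ≤ O) (v : Sec V O), f O' (res i v) = res i (f O v)) : V ⟶ W :=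
  SheafOfModules.Hom.mk
   { app := fun O => ModuleCat.ofHom (f O.unop)
     naturality := fun {O O'} i => by
       ext v
       exact hf (leOfHom i.unop) v }

@[simp] lemma app_homMk (f : ∀ O, Sec V O →ₗ[Fn U O] Sec W O) (hf) (O) (v : Sec V O) :
  app (homMk f hf) O v = f O v := rfl

end

/-- The preimage of an open subset. -/
def pre {U U' : Man} (h : U ⟶ U') (O : U'.Op) : U.Op :=
  ⟨Man.toMap h ⁻¹' O.1, O.2.preimage (Man.toMap h).contMDiff.continuous⟩

def Man.toSpaceHom {U U' : Man} (h : U ⟶ U') : U.space ⟶ U'.space :=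
  TopCat.ofHom ⟨Man.toMap h, (Man.toMap h).contMDiff.continuous⟩

/-- Pullback of smooth functions, `a ↦ a ∘ h`. -/
def fnPull {U U' : Man} (h : U ⟶ U') (O : U'.Op) : Fn U' O →+* Fn U (pre h O) :=
  ((ContMDiff.smoothSheafCommRingHom (R := ℂ) (I := 𝓘(ℝ, ℂ)) (𝓡 U'.dim) U'.carrier (Man.toMap h)
   (Man.toMap h).contMDiff).hom.app (op O)).hom

lemma opens_map_isContinuous {X Y : TopCat.{0}} (f : X ⟶ Y) : (Opens.map f).IsContinuous
    (Opens.grothendieckTopology Y) (Opens.grothendieckTopology X) := inferInstance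

instance {U U' : Man} (h : U ⟶ U') : (Opens.map (Man.toSpaceHom h)).IsContinuous
    (Opens.grothendieckTopology U'.space) (Opens.grothendieckTopology U.space) :=
  opens_map_isContinuous _

/-- Pullback of smooth functions, as a morphism to the direct image sheaf. -/
def fnSheafHom {U U' : Man} (h : U ⟶ U') :
    fnSheaf U' ⟶ ((Opens.map (Man.toSpaceHom h)).sheafPushforwardContinuous RingCat 
      (Opens.grothendieckTopology U'.space) (Opens.grothendieckTopology U.space)).obj (fnSheaf U) :=
  ⟨{ app := fun O => RingCat.ofHom (fnPull h O.unop)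
     naturality := fun _ _ _ => rfl }⟩

lemma opens_pushforward_isRightAdjoint {X Y : TopCat.{0}} (f : X ⟶ Y)
    (S : Sheaf (Opens.grothendieckTopology Y) RingCat.{0})
    (R : Sheaf (Opens.grothendieckTopology X) RingCat.{0})
    (φ : S ⟶ ((Opens.map f).sheafPushforwardContinuous RingCat.{0}
      (Opens.grothendieckTopology Y) (Opens.grothendieckTopology X)).obj R) :
    (SheafOfModules.pushforward.{0} φ).IsRightAdjoint := by
  have : HasWeakSheafify (Opens.grothendieckTopology X) AddCommGrpCat.{0} := inferInstance
  have : (Opens.grothendieckTopology X).WEqualsLocallyBijective AddCommGrpCat.{0} := inferInstance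
  have : (PresheafOfModules.pushforward.{0} φ.hom).IsRightAdjoint :=
    Functor.isRightAdjoint_of_leftAdjointObjIsDefined_eq_top
      (PresheafOfModules.pullbackObjIsDefined_eq_top.{0} (C := Opens Y) (D := Opens X) φ.hom)
  exact (SheafOfModules.PullbackConstruction.adjunction φ).isRightAdjoint

instance {U U' : Man} (h : U ⟶ U') :
    (SheafOfModules.pushforward.{0} (fnSheafHom h)).IsRightAdjoint :=
  opens_pushforward_isRightAdjoint (Man.toSpaceHom h) (fnSheaf U') (fnSheaf U) (fnSheafHom h)

/-- The direct image `h_* X`, with sections `X (h⁻¹ O)` over `O`. -/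
def push {U U' : Man} (h : U ⟶ U') : Sh U ⥤ Sh U' := SheafOfModules.pushforward (fnSheafHom h)
/-- The pullback `h^* V = h⁻¹ V ⊗ C^∞` of sheaves of modules, the left adjoint of `h_*`. -/
def pull {U U' : Man} (h : U ⟶ U') : Sh U' ⥤ Sh U := SheafOfModules.pullback (fnSheafHom h)
def pullAdj {U U' : Man} (h : U ⟶ U') : pull h ⊣ push h := SheafOfModules.pullbackPushforwardAdjunction (fnSheafHom h)

/-- The presheaf `O ↦ V(O) ⊗ W(O)`. -/
def preTensor {U : Man} (V W : Sh U) : PresheafOfModules.{0} ((smoothSheafCommRing (𝓡 U.dim) 𝓘(ℝ, ℂ) U.carrier ℂ).obj ⋙ forget₂ CommRingCat RingCat) := 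
    (MonoidalCategory.tensorObj (C := PresheafOfModules.{0} ((smoothSheafCommRing (𝓡 U.dim) 𝓘(ℝ, ℂ) U.carrier ℂ).obj ⋙ forget₂ CommRingCat RingCat)) V.val W.val)
/-- The tensor product of sheaves of modules, that is, the sheafification of `O ↦ V(O) ⊗ W(O)`. -/
def tensor {U : Man} (V W : Sh U) : Sh U :=
  (PresheafOfModules.sheafification (R₀ := (fnSheaf U).obj) (R := fnSheaf U) (𝟙 _)).obj
    (preTensor V W)
def conjHom (U : Man) : fnSheaf U ⟶ fnSheaf U :=
  ⟨{ app := fun O => RingCat.ofHom (fnConj O.unop)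
     naturality := fun _ _ _ => rfl }⟩

/-- The complex conjugate of a sheaf of modules: the same sections, on which a function `a` acts as
its complex conjugate did. -/
def conj (U : Man) : Sh U ⥤ Sh U := SheafOfModules.restrictScalars (conjHom U)

def meetFunctor {U : Man} (P : U.Op) : U.Op ⥤ U.Op where
  obj O := O ⊓ P
  map f := homOfLE (inf_le_inf_right _ (leOfHom f))
instance {U : Man} (P : U.Op) : (meetFunctor P).IsContinuous (Opens.grothendieckTopology U.space) (Opens.grothendieckTopology U.space)  := by
  apply Functor.isContinuous_of_coverPreserving
  · constructor
    intro F Z T x hx Y₁ Y₂ X f₁ f₂ g₁ g₂ hg₁ hg₂ e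
    have i₁ : X ≤ Y₁ ⊓ P := leOfHom f₁
    have i₂ : X ≤ Y₂ ⊓ P := leOfHom f₂
    have hX : X ≤ (X ⊓ P : U.Op) := le_inf le_rfl (i₁.trans inf_le_right)
    have := hx (homOfLE (i₁.trans inf_le_left)) (homOfLE (i₂.trans inf_le_left)) hg₁ hg₂ 
      (Subsingleton.elim _ _)
    have := congrArg (F.obj.map (homOfLE hX).op) this
    have e (Y : U.Op) (f : X ⟶ Y ⊓ P) (i : X ≤ Y) (y : F.obj.obj (op (Y ⊓ P))) :
        F.obj.map (homOfLE hX).op (F.obj.map ((meetFunctor P).map (homOfLE i)).op y) =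
          F.obj.map f.op y :=
      (ConcreteCategory.congr_hom (F.obj.map_comp _ _) y).symm
    exact ((e _ f₁ _ _).symm.trans this).trans (e _ f₂ _ _)
  · constructor
    intro O S hS x hx
    obtain ⟨V, i, hi, hxV⟩ := hS x hx.1
    exact ⟨_, (meetFunctor P).map i, ⟨_, _, 𝟙 _, hi, Subsingleton.elim _ _⟩, ⟨hxV, hx.2⟩⟩

section
variable {U : Man}

lemma fnRes_fnRes {O O' O'' : U.Op} (i : O' ≤ O) (j : O'' ≤ O') (a : Fn U O) :
    fnRes j (fnRes i a) = fnRes (j.trans i) a := rfl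

def shiftHom (P : U.Op) : fnSheaf U ⟶
    ((meetFunctor P).sheafPushforwardContinuous RingCat
      (Opens.grothendieckTopology U.space) (Opens.grothendieckTopology U.space)).obj (fnSheaf U) :=
  ⟨{ app := fun O => RingCat.ofHom (fnRes (O := O.unop) (O' := O.unop ⊓ P) inf_le_left)
     naturality := fun _ _ _ => rfl }⟩

/-- The sheaf `O ↦ X (O ⊓ P)`. -/
def shift (X : Sh U) (P : U.Op) : Sh U :=
  (SheafOfModules.pushforward (shiftHom P)).obj X

def shiftMk {V X : Sh U} (P : U.Op) (f : ∀ O, Sec V O → Sec X (O ⊓ P))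
    (ha : ∀ O v w, f O (v + w) = f O v + f O w)
    (hs : ∀ O (a : Fn U O) (v : Sec V O), f O (a • v) = fnRes (inf_le_left : O ⊓ P ≤ O) a • f O v)
    (hf : ∀ {O O' : U.Op} (i : O' ≤ O) (v : Sec V O),
      f O' (res i v) = res (inf_le_inf_right P i) (f O v)) : V ⟶ shift X P :=
  homMk (W := shift X P) (fun O => { toFun := f O, map_add' := ha O, map_smul' := hs O })
    hf

def appShift {V X : Sh U} {P : U.Op} (f : V ⟶ shift X P) {O : U.Op} :
    Sec V O →+ Sec X (O ⊓ P) := (app f O).toAddMonoidHom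

lemma appShift_smul {V X : Sh U} {P : U.Op} (f : V ⟶ shift X P) {O : U.Op} (a : Fn U O)
    (v : Sec V O) : appShift f (a • v) = fnRes (inf_le_left : O ⊓ P ≤ O) a • appShift f v :=
  (app f O).map_smul a v

lemma appShift_res {V X : Sh U} {P : U.Op} (f : V ⟶ shift X P) {O O' : U.Op} (i : O' ≤ O)
    (v : Sec V O) : appShift f (res i v) = res (inf_le_inf_right P i) (appShift f v) :=
  app_res f i v

def conjMk {V X : Sh U} (f : ∀ O, Sec V O → Sec X O)
    (ha : ∀ O v w, f O (v + w) = f O v + f O w)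
    (hs : ∀ O (a : Fn U O) (v : Sec V O), f O (a • v) = fnConj O a • f O v)
    (hf : ∀ {O O' : U.Op} (i : O' ≤ O) (v : Sec V O), f O' (res i v) = res i (f O v)) :
    V ⟶ (conj U).obj X :=
  homMk (W := (conj U).obj X)
    (fun O => { toFun := f O, map_add' := ha O, map_smul' := hs O }) hf

def appConj {V X : Sh U} (f : V ⟶ (conj U).obj X) {O : U.Op} :
    Sec V O →+ Sec X O := (app f O).toAddMonoidHom

lemma appConj_smul {V X : Sh U} (f : V ⟶ (conj U).obj X) {O : U.Op} (a : Fn U O)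
    (v : Sec V O) : appConj f (a • v) = fnConj O a • appConj f v :=
  (app f O).map_smul a v

lemma appConj_res {V X : Sh U} (f : V ⟶ (conj U).obj X) {O O' : U.Op} (i : O' ≤ O)
    (v : Sec V O) : appConj f (res i v) = res i (appConj f v) :=
  app_res f i v

/-- Bilinear maps of sheaves of modules. -/
structure Bilin (V W X : Sh U) where
  toFun : ∀ O, Sec V O →ₗ[Fn U O] Sec W O →ₗ[Fn U O] Sec X O
  map_res : ∀ {O O' : U.Op} (i : O' ≤ O) (v : Sec V O) (w : Sec W O),
    toFun O' (res i v) (res i w) = res i (toFun O v w)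

def Bilin.mk' {V W X : Sh U} (f : ∀ O, Sec V O → Sec W O → Sec X O)
    (add_left : ∀ O v v' w, f O (v + v') w = f O v w + f O v' w)
    (smul_left : ∀ O (a : Fn U O) v w, f O (a • v) w = a • f O v w)
    (add_right : ∀ O v w w', f O v (w + w') = f O v w + f O v w')
    (smul_right : ∀ O (a : Fn U O) v w, f O v (a • w) = a • f O v w)
    (map_res : ∀ {O O' : U.Op} (i : O' ≤ O) (v : Sec V O) (w : Sec W O),
      f O' (res i v) (res i w) = res i (f O v w)) : Bilin V W X where
  toFun O := LinearMap.mk₂ (Fn U O) (f O) (add_left O) (smul_left O) (add_right O) (smul_right O)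
  map_res := map_res

def unitTensor (V W : Sh U) : preTensor V W ⟶ (PresheafOfModules.restrictScalars (𝟙 (fnSheaf U).obj)).obj (tensor V W).val :=
  (PresheafOfModules.sheafificationAdjunction (R₀ := (fnSheaf U).obj) (R := fnSheaf U)
    (𝟙 _)).unit.app (preTensor V W)

def preTmul (V W : Sh U) (O : U.Op) : TensorProduct (Fn U O) (Sec V O) (Sec W O) →ₗ[Fn U O]
    Sec (tensor V W) O := 
  ((unitTensor V W).app (op O)).hom
/-- The section `v ⊗ w` of `V ⊗ W`. -/
def tmul {V W : Sh U} {O : U.Op} (v : Sec V O) (w : Sec W O) : Sec (tensor V W) O :=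
  preTmul V W O (v ⊗ₜ w)


lemma tmul_add {V W : Sh U} {O : U.Op} (v : Sec V O) (w w' : Sec W O) :
    tmul v (w + w') = tmul v w + tmul v w' := by
  simp [tmul, TensorProduct.tmul_add]
lemma add_tmul {V W : Sh U} {O : U.Op} (v v' : Sec V O) (w : Sec W O) :
    tmul (v + v') w = tmul v w + tmul v' w := by
  simp [tmul, TensorProduct.add_tmul]
lemma tmul_smul {V W : Sh U} {O : U.Op} (a : Fn U O) (v : Sec V O) (w : Sec W O) :
    tmul v (a • w) = a • tmul v w := by
  simp [tmul]
lemma smul_tmul {V W : Sh U} {O : U.Op} (a : Fn U O) (v : Sec V O) (w : Sec W O) :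
    tmul (a • v) w = a • tmul v w := by
  exact (preTmul V W O).map_smul a (v ⊗ₜ w)
lemma tmul_res {V W : Sh U} {O O' : U.Op} (i : O' ≤ O) (v : Sec V O) (w : Sec W O) :
    tmul (res i v) (res i w) = res i (tmul v w) :=
  PresheafOfModules.naturality_apply (unitTensor V W) (homOfLE i).op (v ⊗ₜ w)

def tmulBilin (V W : Sh U) : Bilin V W (tensor V W) :=
  Bilin.mk' (fun _ v w => tmul v w) (fun _ => add_tmul) (fun _ => smul_tmul) (fun _ => tmul_add)
    (fun _ => tmul_smul) tmul_res

def Bilin.comp {V W X Y : Sh U} (B : Bilin V W X) (f : X ⟶ Y) : Bilin V W Y :=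
  Bilin.mk' (fun O v w => app f O (B.toFun O v w)) (by simp) (by simp) (by simp) (by simp)
    (fun i v w => by rw [B.map_res, app_res])

def preTensorLift {V W X : Sh U} (B : Bilin V W X) :
    preTensor V W ⟶ (PresheafOfModules.restrictScalars (𝟙 (fnSheaf U).obj)).obj X.val where
  app O := show ModuleCat.of (Fn U O.unop) (TensorProduct (Fn U O.unop) (Sec V O.unop) (Sec W O.unop)) ⟶
      ModuleCat.of (Fn U O.unop) (Sec X O.unop) from
    ModuleCat.ofHom (TensorProduct.lift (B.toFun O.unop))
  naturality {O O'} i := by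
    apply ModuleCat.MonoidalCategory.tensor_ext
    intro v w
    exact (B.map_res (leOfHom i.unop) v w)

/-- The morphism out of the tensor product that corresponds to a bilinear map. -/
def tensorLift {V W X : Sh U} (B : Bilin V W X) : tensor V W ⟶ X :=
  ((PresheafOfModules.sheafificationAdjunction (R₀ := (fnSheaf U).obj) (R := fnSheaf U)
    (𝟙 _)).homEquiv (preTensor V W) X).symm (preTensorLift B)

@[simp] lemma app_tensorLift {V W X : Sh U} (B : Bilin V W X) {O : U.Op} (v : Sec V O)
    (w : Sec W O) : app (tensorLift B) O (tmul v w) = B.toFun O v w := by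
  have := ((PresheafOfModules.sheafificationAdjunction (R₀ := (fnSheaf U).obj) (R := fnSheaf U)
    (𝟙 _)).homEquiv (preTensor V W) X).apply_symm_apply (preTensorLift B)
  exact congrArg (fun k : preTensor V W ⟶ (PresheafOfModules.restrictScalars
    (𝟙 (fnSheaf U).obj)).obj X.val => (k.app (op O)).hom (v ⊗ₜ w)) this

lemma tensor_ext {V W X : Sh U} {f g : tensor V W ⟶ X}
    (e : ∀ O (v : Sec V O) (w : Sec W O), app f O (tmul v w) = app g O (tmul v w)) : f = g := by
  apply ((PresheafOfModules.sheafificationAdjunction (R₀ := (fnSheaf U).obj) (R := fnSheaf U)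
    (𝟙 _)).homEquiv (preTensor V W) X).injective
  apply PresheafOfModules.hom_ext
  intro O
  apply ModuleCat.MonoidalCategory.tensor_ext
  intro v w
  exact e O.unop v w

end

section
variable {U U' : Man} (h : U ⟶ U')

lemma pre_mono {O O' : U'.Op} (i : O' ≤ O) : pre h O' ≤ pre h O := fun _ hx => i hx

lemma fnPull_res {O O' : U'.Op} (i : O' ≤ O) (a : Fn U' O) :
    fnPull h O' (fnRes i a) = fnRes (pre_mono h i) (fnPull h O a) := rfl

def pushMk {V : Sh U'} {X : Sh U} (f : ∀ O, Sec V O → Sec X (pre h O))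
    (ha : ∀ O v w, f O (v + w) = f O v + f O w)
    (hs : ∀ O (a : Fn U' O) (v : Sec V O), f O (a • v) = fnPull h O a • f O v)
    (hf : ∀ {O O' : U'.Op} (i : O' ≤ O) (v : Sec V O),
      f O' (res i v) = res (pre_mono h i) (f O v)) : V ⟶ (push h).obj X :=
  homMk (W := (push h).obj X)
    (fun O => { toFun := f O, map_add' := ha O, map_smul' := hs O }) hf

def pushShiftMk {V : Sh U'} {X : Sh U} (P : U.Op) (f : ∀ O, Sec V O → Sec X (pre h O ⊓ P))
    (ha : ∀ O v w, f O (v + w) = f O v + f O w)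
    (hs : ∀ O (a : Fn U' O) (v : Sec V O),
      f O (a • v) = fnRes (inf_le_left : pre h O ⊓ P ≤ pre h O) (fnPull h O a) • f O v)
    (hf : ∀ {O O' : U'.Op} (i : O' ≤ O) (v : Sec V O),
      f O' (res i v) = res (inf_le_inf_right P (pre_mono h i)) (f O v)) :
    V ⟶ (push h).obj (shift X P) :=
  pushMk (X := shift X P) h f ha hs hf

def appPush {V : Sh U'} {X : Sh U} (f : V ⟶ (push h).obj X) {O : U'.Op} :
    Sec V O →+ Sec X (pre h O) := (app f O).toAddMonoidHom

lemma appPush_smul {V : Sh U'} {X : Sh U} (f : V ⟶ (push h).obj X) {O : U'.Op} (a : Fn U' O)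
    (v : Sec V O) : appPush h f (a • v) = fnPull h O a • appPush h f v :=
  (app f O).map_smul a v

lemma appPush_res {V : Sh U'} {X : Sh U} (f : V ⟶ (push h).obj X) {O O' : U'.Op} (i : O' ≤ O)
    (v : Sec V O) : appPush h f (res i v) = res (pre_mono h i) (appPush h f v) :=
  app_res f i v

variable {V W : Sh U'} {X Y : Sh U} 

/-- The pulled back section `h^* v` of `h^* V`. -/
def eta {O : U'.Op} : Sec V O →+ Sec ((pull h).obj V) (pre h O) :=
  appPush h ((pullAdj h).unit.app V)

lemma eta_smul {O : U'.Op} (a : Fn U' O) (v : Sec V O) :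
    eta h (a • v) = fnPull h O a • eta h v := appPush_smul h _ a v

lemma eta_res {O O' : U'.Op} (i : O' ≤ O) (v : Sec V O) :
    eta h (res i v) = res (pre_mono h i) (eta h v) := appPush_res h _ i v

/-- The adjunct `h^* V ⟶ X` of `V ⟶ h_* X`. -/
def pullLift (f : V ⟶ (push h).obj X) : (pull h).obj V ⟶ X :=
  ((pullAdj h).homEquiv V X).symm f

@[simp] lemma app_pullLift (f : V ⟶ (push h).obj X) {O : U'.Op} (v : Sec V O) :
    app (pullLift h f) (pre h O) (eta h v) = appPush h f v := by
  have := ((pullAdj h).homEquiv V X).apply_symm_apply f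
  rw [Adjunction.homEquiv_unit] at this
  exact congrArg (fun k : V ⟶ (push h).obj X => app k O v) this

lemma pull_ext {f g : (pull h).obj V ⟶ X}
    (e : ∀ O (v : Sec V O), app f (pre h O) (eta h v) = app g (pre h O) (eta h v)) : f = g := by
  apply ((pullAdj h).homEquiv V X).injective
  rw [Adjunction.homEquiv_unit, Adjunction.homEquiv_unit]
  exact hom_ext e

@[simp] lemma app_pull_map (f : V ⟶ W) {O : U'.Op} (v : Sec V O) :
    app ((pull h).map f) (pre h O) (eta h v) = eta h (app f O v) := by
  have := (pullAdj h).unit.naturality f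
  exact (congrArg (fun k : V ⟶ (push h).obj ((pull h).obj W) => app k O v) this).symm

end

section
variable {U : Man}

lemma sec_ext {X : Sh U} {O : U.Op} (s t : Sec X O)
    (e : ∀ x ∈ O, ∃ (O' : U.Op) (i : O' ≤ O), x ∈ O' ∧ res i s = res i t) : s = t := by
  choose! N hN hx hst using fun x : O => e x.1 x.2
  exact TopCat.Sheaf.eq_of_locally_eq' (X := U.space) ⟨X.val.presheaf, X.isSheaf⟩ N O
    (fun x => homOfLE (hN x)) (fun x hxO => Opens.mem_iSup.2 ⟨⟨x, hxO⟩, hx _⟩) s t hst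

/-- Subsheaves of submodules. -/
structure Sub (X : Sh U) where
  carrier : ∀ O, Submodule (Fn U O) (Sec X O)
  res_mem : ∀ {O O' : U.Op} (i : O' ≤ O) {s : Sec X O}, s ∈ carrier O → res i s ∈ carrier O'
  local_mem : ∀ {O : U.Op} (s : Sec X O), (∀ x ∈ O, ∃ (O' : U.Op) (i : O' ≤ O),
    x ∈ O' ∧ res i s ∈ carrier O') → s ∈ carrier O

def Sub.abPresheaf {X : Sh U} (S : Sub X) : (Opens U.space)ᵒᵖ ⥤ AddCommGrpCat.{0} where
  obj O := AddCommGrpCat.of (S.carrier O.unop)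
  map {O O'} i := AddCommGrpCat.ofHom
    { toFun := fun s => ⟨res (leOfHom i.unop) s.1, S.res_mem _ s.2⟩
      map_zero' := Subtype.ext (map_zero (res (leOfHom i.unop)))
      map_add' := fun s t => Subtype.ext (map_add (res (leOfHom i.unop)) s.1 t.1) }
  map_id O := AddCommGrpCat.hom_ext (AddMonoidHom.ext fun s : S.carrier O.unop =>
    (Subtype.ext (res_self s.1) : (⟨res le_rfl s.1, S.res_mem _ s.2⟩ : S.carrier O.unop) = s))
  map_comp {O O' O''} i j := AddCommGrpCat.hom_ext (AddMonoidHom.ext fun s : S.carrier O.unop =>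
    (Subtype.ext (res_res (leOfHom i.unop) (leOfHom j.unop) s.1).symm :
      (⟨res _ s.1, S.res_mem _ s.2⟩ : S.carrier O''.unop) =
        ⟨res _ (res _ s.1), S.res_mem _ (S.res_mem _ s.2)⟩))

def Sub.presheaf {X : Sh U} (S : Sub X) : PresheafOfModules.{0} (fnSheaf U).obj :=
  letI : ∀ O, Module ((fnSheaf U).obj.obj O) (S.abPresheaf.obj O) := fun O =>
    inferInstanceAs (Module (Fn U O.unop) (S.carrier O.unop))
  PresheafOfModules.ofPresheaf S.abPresheaf
    (fun {O O'} i a s => Subtype.ext (res_smul (leOfHom i.unop) (show Fn U O.unop from a)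
      (show S.carrier O.unop from s).1))

def Sub.toSh {X : Sh U} (S : Sub X) : Sh U where
  val := S.presheaf
  isSheaf := by
    apply (TopCat.Presheaf.isSheaf_iff_isSheafUniqueGluing (X := U.space) _).2
    intro ι N sf hsf
    let G : TopCat.Sheaf AddCommGrpCat.{0} U.space := ⟨X.val.presheaf, X.isSheaf⟩
    obtain ⟨s, hs, hu⟩ := G.existsUnique_gluing N
      (fun i => (show S.carrier (N i) from sf i).1) (fun i j => congrArg Subtype.val (hsf i j))
    have hmem : (show Sec X (iSup N) from s) ∈ S.carrier (iSup N) := by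
      apply S.local_mem
      intro x hx
      obtain ⟨i, hi⟩ := Opens.mem_iSup.1 hx
      refine ⟨N i, le_iSup N i, hi, ?_⟩
      have e : res (le_iSup N i) (show Sec X (iSup N) from s) = (show S.carrier (N i) from sf i).1 :=
        hs i
      rw [e]
      exact (show S.carrier (N i) from sf i).2
    refine ⟨(⟨s, hmem⟩ : S.carrier (iSup N)), fun i => Subtype.ext (hs i), ?_⟩
    intro t ht
    exact Subtype.ext (hu _ fun i => congrArg Subtype.val (ht i))

def Sub.incl {X : Sh U} (S : Sub X) : S.toSh ⟶ X :=
  homMk (V := S.toSh) (fun O => (S.carrier O).subtype) (fun _ _ => rfl)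

def Sub.mk' {X : Sh U} (S : Sub X) {O : U.Op} (s : Sec X O) (hs : s ∈ S.carrier O) :
    Sec S.toSh O := (⟨s, hs⟩ : S.carrier O)

lemma Sub.mem_of_retract {X : Sh U} (S : Sub X) (r : X ⟶ S.toSh) (hr : r ≫ S.incl = 𝟙 X)
    {O : U.Op} (s : Sec X O) : s ∈ S.carrier O := by
  have e : (app r O s : S.carrier O).1 = s := congrArg (fun k : X ⟶ X => app k O s) hr
  rw [← e]
  exact (app r O s : S.carrier O).2

end

section
variable {U U' : Man} (h : U ⟶ U')

lemma pull_mem {V : Sh U'} (S : Sub ((pull h).obj V))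
    (hS : ∀ O (v : Sec V O), eta h v ∈ S.carrier (pre h O)) {O : U.Op}
    (s : Sec ((pull h).obj V) O) : s ∈ S.carrier O := by
  let r : V ⟶ (push h).obj S.toSh := pushMk h (fun O v => S.mk' (eta h v) (hS O v))
    (fun O v w => Subtype.ext (map_add (eta h) v w))
    (fun O a v => Subtype.ext (eta_smul h a v)) (fun i v => Subtype.ext (eta_res h i v))
  refine S.mem_of_retract (pullLift h r) (pull_ext h fun O v => ?_) s
  rw [app_comp, app_pullLift]
  rfl

end

section
variable {U U' : Man} (h : U ⟶ U')

/-- Induction over the sections of `h^* V`. -/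
lemma pull_induction {V : Sh U'} (p : ∀ O : U.Op, Sec ((pull h).obj V) O → Prop)
    (eta : ∀ O (v : Sec V O), p _ (eta h v)) (zero : ∀ O, p O 0)
    (add : ∀ O s t, p O s → p O t → p O (s + t)) (smul : ∀ O (a : Fn U O) s, p O s → p O (a • s))
    (restr : ∀ {O O' : U.Op} (i : O' ≤ O) (s), p O s → p O' (res i s))
    (glue : ∀ {O : U.Op} (s), (∀ x ∈ O, ∃ (O' : U.Op) (i : O' ≤ O),
      x ∈ O' ∧ p O' (res i s)) → p O s) {O : U.Op} (s : Sec ((pull h).obj V) O) : p O s :=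
  pull_mem h
    { carrier := fun O =>
        { carrier := {s | p O s}
          add_mem' := add O _ _
          zero_mem' := zero O
          smul_mem' := fun a s => smul O a s }
      res_mem := fun {_ _} i {s} hs => restr i s hs
      local_mem := glue } eta s

/-- An equality of bilinear expressions holds on `h^* V` as soon as it holds on pulled back
sections. -/
lemma pull_loc_ext {V : Sh U'} {X : Sh U} {P : U.Op} {f g : (pull h).obj V ⟶ shift X P}
    (e : ∀ O (v : Sec V O), appShift f (eta h v) = appShift g (eta h v)) {O : U.Op}
    (s : Sec ((pull h).obj V) O) : appShift f s = appShift g s :=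
  congrArg (fun k : (pull h).obj V ⟶ shift X P => app k O s) (pull_ext h e)

variable {V W : Sh U'} {X : Sh U}

def pval (B : Bilin V W ((push h).obj X)) {O : U'.Op} (v : Sec V O) (w : Sec W O) :
    Sec X (pre h O) := B.toFun O v w

section
variable (B : Bilin V W ((push h).obj X)) {O O' : U'.Op}
lemma pval_add_left (v v' : Sec V O) (w : Sec W O) :
    pval h B (v + v') w = pval h B v w + pval h B v' w :=
  LinearMap.map_add₂ (B.toFun O) v v' w
lemma pval_add_right (v : Sec V O) (w w' : Sec W O) :
    pval h B v (w + w') = pval h B v w + pval h B v w' := map_add (B.toFun O v) w w'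
lemma pval_smul_left (a : Fn U' O) (v : Sec V O) (w : Sec W O) :
    pval h B (a • v) w = fnPull h O a • pval h B v w := LinearMap.map_smul₂ (B.toFun O) a v w
lemma pval_smul_right (a : Fn U' O) (v : Sec V O) (w : Sec W O) :
    pval h B v (a • w) = fnPull h O a • pval h B v w := map_smul (B.toFun O v) a w
lemma pval_res (i : O' ≤ O) (v : Sec V O) (w : Sec W O) :
    pval h B (res i v) (res i w) = res (pre_mono h i) (pval h B v w) := B.map_res i v w
end

def extend₁ (B : Bilin V W ((push h).obj X)) {Q : U'.Op} (v : Sec V Q) :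
    (pull h).obj W ⟶ shift X (pre h Q) :=
  pullLift h (pushShiftMk h (pre h Q)
    (fun O w => pval h B (O := O ⊓ Q) (res inf_le_right v) (res inf_le_left w))
    (fun O w w' => by rw [map_add, pval_add_right]; rfl)
    (fun O a w => by rw [res_smul, pval_smul_right]; rfl)
    (fun i w => by
      have := pval_res h B (inf_le_inf_right Q i) (res inf_le_right v) (res inf_le_left w)
      rw [res_res, res_res] at this
      rw [res_res]
      exact this))

lemma extend₁_eta (B : Bilin V W ((push h).obj X)) {O Q : U'.Op} (v : Sec V Q) (w : Sec W O) :
    appShift (extend₁ h B v) (eta h w) = 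
      pval h B (O := O ⊓ Q) (res inf_le_right v) (res inf_le_left w) :=
  app_pullLift h _ w

section
variable (B : Bilin V W ((push h).obj X)) {O O' : U'.Op} {P P' : U.Op}
lemma extend₁_add (v v' : Sec V O) (t : Sec ((pull h).obj W) P) :
    appShift (extend₁ h B (v + v')) t =
      appShift (extend₁ h B v) t + appShift (extend₁ h B v') t := by
  refine pull_loc_ext h (f := extend₁ h B (v + v')) (g := shiftMk _ (fun P t => 
    appShift (extend₁ h B v) t + appShift (extend₁ h B v') t) ?_ ?_ ?_) ?_ t
  · intro P s t
    rw [map_add, map_add]; abel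
  · intro P a t
    rw [appShift_smul, appShift_smul, smul_add]
  · intro P P' i t
    rw [appShift_res, appShift_res, map_add]
  · intro Q w
    rw [extend₁_eta, map_add, pval_add_left, ← extend₁_eta, ← extend₁_eta]
    rfl

lemma extend₁_smul (a : Fn U' O) (v : Sec V O) (t : Sec ((pull h).obj W) P) :
    appShift (extend₁ h B (a • v)) t =
      fnRes (inf_le_right : P ⊓ pre h O ≤ _) (fnPull h O a) • appShift (extend₁ h B v) t := by
  refine pull_loc_ext h (f := extend₁ h B (a • v)) (g := shiftMk _ (fun P t => 
    fnRes (inf_le_right : P ⊓ pre h O ≤ _) (fnPull h O a) • appShift (extend₁ h B v) t)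
      ?_ ?_ ?_) ?_ t
  · intro P s t
    rw [map_add, smul_add]
  · intro P b t
    rw [appShift_smul, smul_comm]
  · intro P P' i t
    rw [appShift_res, res_smul]; rfl
  · intro Q w
    rw [extend₁_eta, res_smul, pval_smul_left, fnPull_res, ← extend₁_eta]
    rfl

lemma extend₁_res (i : O' ≤ O) (v : Sec V O) (t : Sec ((pull h).obj W) P) :
    appShift (extend₁ h B (res i v)) t =
      res (inf_le_inf_left P (pre_mono h i)) (appShift (extend₁ h B v) t) := by
  refine pull_loc_ext h (f := extend₁ h B (res i v)) (g := shiftMk _ (fun P t => 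
    res (inf_le_inf_left P (pre_mono h i)) (appShift (extend₁ h B v) t))
      ?_ ?_ ?_) ?_ t
  · intro P s t
    rw [map_add, map_add]
  · intro P b t
    rw [appShift_smul, res_smul]; rfl
  · intro P P' j t
    rw [appShift_res, res_res, res_res]
  · intro Q w
    have := pval_res h B (inf_le_inf_left Q i) (res inf_le_right v) (res inf_le_left w)
    rw [res_res, res_res] at this
    rw [extend₁_eta, res_res]
    refine this.trans ?_
    rw [← extend₁_eta]
    rfl

def extend₂ (t : Sec ((pull h).obj W) P) : (pull h).obj V ⟶ shift X P :=
  pullLift h (pushShiftMk h P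
    (fun O v => res (le_of_eq (inf_comm _ _)) (appShift (extend₁ h B v) t))
    (fun O v v' => by rw [extend₁_add, map_add])
    (fun O a v => by rw [extend₁_smul, res_smul]; rfl)
    (fun i v => by rw [extend₁_res, res_res, res_res]))

lemma extend₂_eta (v : Sec V O) (t : Sec ((pull h).obj W) P) :
    appShift (extend₂ h B t) (eta h v) =
      res (le_of_eq (inf_comm _ _)) (appShift (extend₁ h B v) t) :=
  app_pullLift h _ v

lemma extend₂_add (t t' : Sec ((pull h).obj W) P') (s : Sec ((pull h).obj V) P) :
    appShift (extend₂ h B (t + t')) s =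
      appShift (extend₂ h B t) s + appShift (extend₂ h B t') s := by
  refine pull_loc_ext h (f := extend₂ h B (t + t')) (g := shiftMk _ (fun P s => 
    appShift (extend₂ h B t) s + appShift (extend₂ h B t') s) ?_ ?_ ?_) ?_ s
  · intro P s s'
    rw [map_add, map_add]; abel
  · intro P a s
    rw [appShift_smul, appShift_smul, smul_add]
  · intro P P' i t
    rw [appShift_res, appShift_res, map_add]
  · intro Q v
    rw [extend₂_eta, map_add, map_add, ← extend₂_eta, ← extend₂_eta]
    rfl

lemma extend₂_smul (a : Fn U P') (t : Sec ((pull h).obj W) P') (s : Sec ((pull h).obj V) P) :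
    appShift (extend₂ h B (a • t)) s =
      fnRes (inf_le_right : P ⊓ P' ≤ _) a • appShift (extend₂ h B t) s := by
  refine pull_loc_ext h (f := extend₂ h B (a • t)) (g := shiftMk _ (fun P s => 
    fnRes (inf_le_right : P ⊓ P' ≤ _) a • appShift (extend₂ h B t) s) ?_ ?_ ?_) ?_ s
  · intro P s s'
    rw [map_add, smul_add]
  · intro P b s
    rw [appShift_smul, smul_comm]
  · intro P P' i t
    rw [appShift_res, res_smul]; rfl
  · intro Q v
    rw [extend₂_eta, appShift_smul, res_smul]
    refine Eq.trans ?_ (congrArg (fnRes (inf_le_right : pre h Q ⊓ P' ≤ P') a • ·) (extend₂_eta h B v t).symm)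
    rfl

lemma extend₂_res {P'' : U.Op} (i : P'' ≤ P') (t : Sec ((pull h).obj W) P')
    (s : Sec ((pull h).obj V) P) :
    appShift (extend₂ h B (res i t)) s =
      res (inf_le_inf_left P i) (appShift (extend₂ h B t) s) := by
  refine pull_loc_ext h (f := extend₂ h B (res i t)) (g := shiftMk _ (fun P s => 
    res (inf_le_inf_left P i) (appShift (extend₂ h B t) s)) ?_ ?_ ?_) ?_ s
  · intro P s s'
    rw [map_add, map_add]
  · intro P b s
    rw [appShift_smul, res_smul]; rfl
  · intro P P' i t
    rw [appShift_res, res_res, res_res]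
  · intro Q v
    rw [extend₂_eta, appShift_res, res_res]
    refine Eq.trans ?_ (congrArg (res _) (extend₂_eta h B v t).symm)
    rw [res_res]

/-- The unique bilinear extension of `B : V × W → h_* X` to `h^* V × h^* W → X`. -/
def extend : Bilin ((pull h).obj V) ((pull h).obj W) X :=
  Bilin.mk' (fun O s t => res (le_inf le_rfl le_rfl) (appShift (extend₂ h B t) s))
    (fun O s s' t => by rw [map_add, map_add])
    (fun O a s t => by rw [appShift_smul, res_smul]; rfl)
    (fun O s t t' => by rw [extend₂_add, map_add])
    (fun O a s t => by rw [extend₂_smul, res_smul]; rfl)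
    (fun i s t => by rw [extend₂_res, appShift_res, res_res, res_res, res_res])

lemma extend_eta (v : Sec V O) (w : Sec W O) :
    (extend h B).toFun _ (eta h v) (eta h w) = B.toFun O v w := by
  have e : (extend h B).toFun _ (eta h v) (eta h w) =
    res (le_inf le_rfl le_rfl) (appShift (extend₂ h B (eta h w)) (eta h v)) := rfl
  rw [e, extend₂_eta, res_res, extend₁_eta]
  refine (pval_res (O := O ⊓ O) h B (le_inf le_rfl le_rfl) _ _).symm.trans ?_
  rw [res_res, res_res, res_self, res_self]
  rfl
end

end

section
variable {U U' : Man} (h : U ⟶ U')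

lemma pull_induction₁ {V : Sh U'} (q : ∀ O : U.Op, Sec ((pull h).obj V) O → Prop)
    (zero : ∀ O, q O 0)
    (add : ∀ O s t, q O s → q O t → q O (s + t)) (smul : ∀ O (a : Fn U O) s, q O s → q O (a • s))
    (glue : ∀ {O : U.Op} (s), (∀ x ∈ O, ∃ (O' : U.Op) (i : O' ≤ O),
      x ∈ O' ∧ q O' (res i s)) → q O s)
    (eta : ∀ O (v : Sec V O) (O' : U.Op) (i : O' ≤ pre h O), q O' (res i (eta h v)))
    {O : U.Op} (s : Sec ((pull h).obj V) O) : q O s := by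
  suffices ∀ O' (i : O' ≤ O), q O' (res i s) by simpa using this O le_rfl
  refine pull_induction h (fun O s => ∀ O' (i : O' ≤ O), q O' (res i s)) ?_ ?_ ?_ ?_ ?_ ?_ s
  · intro O v O' i
    exact eta O v O' i
  · intro O O' i
    rw [map_zero]
    exact zero _
  · intro O s t hs ht O' i
    rw [map_add]
    exact add _ _ _ (hs _ _) (ht _ _)
  · intro O a s hs O' i
    rw [res_smul]
    exact smul _ _ _ (hs _ _)
  · intro O O' i s hs O'' j
    rw [res_res]
    exact hs _ _
  · intro O s hs O' i
    refine glue _ fun x hx => ?_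
    obtain ⟨N, j, hN, hs⟩ := hs x (i hx)
    refine ⟨N ⊓ O', inf_le_right, ⟨hN, hx⟩, ?_⟩
    have := hs (N ⊓ O') inf_le_left
    rw [res_res] at this ⊢
    exact this

lemma bilin_pull_ext {V W : Sh U'} {X : Sh U}
    {B B' : Bilin ((pull h).obj V) ((pull h).obj W) X}
    (e : ∀ O (v : Sec V O) (w : Sec W O),
      B.toFun _ (eta h v) (eta h w) = B'.toFun _ (eta h v) (eta h w)) : 
    ∀ O s t, B.toFun O s t = B'.toFun O s t := by
  intro O s
  refine pull_induction₁ h (fun O s => ∀ t, B.toFun O s t = B'.toFun O s t) ?_ ?_ ?_ ?_ ?_ s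
  · intro O t; simp
  · intro O s s' hs hs' t; simp [hs, hs']
  · intro O a s hs t; simp [hs]
  · intro O s hs t
    refine sec_ext _ _ fun x hx => ?_
    obtain ⟨O', i, hx, hs⟩ := hs x hx
    refine ⟨O', i, hx, ?_⟩
    rw [← B.map_res, ← B'.map_res, hs]
  · intro O v P i t
    refine pull_induction₁ h (fun P t => ∀ (i : P ≤ pre h O),
      B.toFun P (res i (eta h v)) t = B'.toFun P (res i (eta h v)) t) ?_ ?_ ?_ ?_ ?_ t i
    · intro O i; simp
    · intro O t t' ht ht' i; simp [ht i, ht' i]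
    · intro O a t ht i; simp [ht i]
    · intro O t ht i
      refine sec_ext _ _ fun x hx => ?_
      obtain ⟨O', j, hx, ht⟩ := ht x hx
      refine ⟨O', j, hx, ?_⟩
      have := ht (j.trans i)
      rw [← B.map_res, ← B'.map_res, res_res, this]
    · intro O' w P j i
      have := congrArg (res (show P ≤ pre h (O ⊓ O') from le_inf i j))
        (e (O ⊓ O') (res inf_le_left v) (res inf_le_right w))
      rw [← B.map_res, ← B'.map_res, eta_res, eta_res, res_res, res_res] at this
      exact this

end

/-- The structure sheaf of smooth complex-valued functions as a sheaf of modules over itself. -/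
def unitSh (U : Man) : Sh U := SheafOfModules.unit (fnSheaf U)

section
variable {U U' : Man}

/-- A smooth function as a section of the structure sheaf. -/
def fn {O : U.Op} (a : Fn U O) : Sec (unitSh U) O := a

lemma fn_eq_smul {O : U.Op} (a : Fn U O) : fn a = a • fn (1 : Fn U O) := (mul_one a).symm

lemma res_fn {O O' : U.Op} (i : O' ≤ O) (a : Fn U O) : res i (fn a) = fn (fnRes i a) := rfl

lemma unit_ext {X : Sh U} {f g : unitSh U ⟶ X} (e : ∀ O, app f O (fn 1) = app g O (fn 1)) :
    f = g := by
  refine hom_ext fun O v => ?_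
  rw [show v = (show Fn U O from v) • fn (1 : Fn U O) from fn_eq_smul (show Fn U O from v),
    map_smul, map_smul, e]

def unitLift {X : Sh U} (e : ∀ O, Sec X O) (he : ∀ {O O' : U.Op} (i : O' ≤ O),
    res i (e O) = e O') : unitSh U ⟶ X :=
  homMk (fun O => (LinearMap.toSpanSingleton (Fn U O) (Sec X O) (e O) : Fn U O →ₗ[Fn U O] Sec X O))
    (fun i v => by
      refine Eq.trans ?_ (res_smul i v (e _)).symm
      rw [he]; rfl)

lemma app_unitLift {X : Sh U} (e : ∀ O, Sec X O) (he : ∀ {O O' : U.Op} (i : O' ≤ O),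
    res i (e O) = e O') (O : U.Op) (a : Fn U O) : app (unitLift e he) O (fn a) = a • e O := rfl

variable (h : U ⟶ U')

/-- The coherence morphism from the structure sheaf to its pullback. -/
def pullUnit : unitSh U ⟶ (pull h).obj (unitSh U') :=
  unitLift (fun O => res (show O ≤ pre h ⊤ from fun _ _ => trivial) (eta h (fn 1)))
    (fun i => by rw [res_res])

lemma pullUnit_one (O : U'.Op) : app (pullUnit h) (pre h O) (fn 1) = eta h (fn 1) := by
  have e : res (show O ≤ ⊤ from le_top) (fn (1 : Fn U' ⊤)) = fn 1 := rfl
  rw [← e, eta_res]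
  exact one_smul (Fn U (pre h O)) 
    (res (show pre h O ≤ pre h ⊤ from fun _ _ => trivial) (eta h (fn 1)))

/-- The coherence morphism from the pullback of the structure sheaf to the structure sheaf. -/
def pullUnitInv : (pull h).obj (unitSh U') ⟶ unitSh U :=
  pullLift h (pushMk h (fun O a => fn (fnPull h O a)) (fun O => map_add (fnPull h O))
    (fun O => map_mul (fnPull h O)) (fun _ _ => rfl))

@[simp] lemma pullUnitInv_eta {O : U'.Op} (a : Fn U' O) :
    app (pullUnitInv h) (pre h O) (eta h (fn a)) = fn (fnPull h O a) := app_pullLift h _ _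

/-- The coherence morphism `h^* V ⊗ h^* W ⟶ h^* (V ⊗ W)`, which sends `h^* v ⊗ h^* w` to
`h^* (v ⊗ w)`. -/
def pullTensor (V W : Sh U') :
    tensor ((pull h).obj V) ((pull h).obj W) ⟶ (pull h).obj (tensor V W) :=
  tensorLift (extend h ((tmulBilin V W).comp ((pullAdj h).unit.app (tensor V W))))

@[simp] lemma pullTensor_eta {V W : Sh U'} {O : U'.Op} (v : Sec V O) (w : Sec W O) :
    app (pullTensor h V W) (pre h O) (tmul (eta h v) (eta h w)) = eta h (tmul v w) := by
  rw [pullTensor, app_tensorLift]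
  exact extend_eta h _ v w

/-- The coherence morphism from the pullback of the complex conjugate to the complex conjugate of
the pullback. -/
def pullConj (V : Sh U') : (pull h).obj ((conj U').obj V) ⟶ (conj U).obj ((pull h).obj V) :=
  pullLift h (pushMk (X := (conj U).obj ((pull h).obj V)) h (fun O v => eta h (show Sec V O from v))
    (fun O v w => map_add (eta h (V := V)) v w)
    (fun O a v => eta_smul h (V := V) (fnConj O a) v) (fun i v => eta_res h (V := V) i v))

lemma pullConj_eta {V : Sh U'} {O : U'.Op} (v : Sec V O) :
    appConj (f := pullConj h V) (eta h (V := (conj U').obj V) v) = eta h v :=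
  app_pullLift h _ _

end

/-- A `*`-object: a sheaf of modules with an antilinear involution. -/
structure StarObj (U : Man) where
  obj : Sh U
  star : obj ⟶ (conj U).obj obj
  star_star : ∀ {O : U.Op} (v : Sec obj O), appConj star (appConj star v) = v

section
variable {U : Man}

/-- The involution on sections. -/
def StarObj.st (V : StarObj U) {O : U.Op} : Sec V.obj O →+ Sec V.obj O := appConj V.star

namespace StarObj

@[simp] lemma st_st (V : StarObj U) {O : U.Op} (v : Sec V.obj O) : V.st (V.st v) = v :=
  V.star_star v
lemma st_smul (V : StarObj U) {O : U.Op} (a : Fn U O) (v : Sec V.obj O) :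
    V.st (a • v) = fnConj O a • V.st v := appConj_smul _ a v
lemma st_res (V : StarObj U) {O O' : U.Op} (i : O' ≤ O) (v : Sec V.obj O) :
    V.st (res i v) = res i (V.st v) := appConj_res _ i v

/-- Morphisms that preserve the involution. -/
@[ext]
structure Hom (V W : StarObj U) where
  hom : V.obj ⟶ W.obj
  map_star : ∀ {O : U.Op} (v : Sec V.obj O), app hom O (V.st v) = W.st (app hom O v)

instance : Category (StarObj U) where
  Hom := Hom
  id V := ⟨𝟙 V.obj, fun _ => rfl⟩
  comp f g := ⟨f.hom ≫ g.hom, fun v => by simp [f.map_star, g.map_star]⟩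

def mkHom {V W : StarObj U} (f : V.obj ⟶ W.obj)
    (hf : ∀ {O : U.Op} (v : Sec V.obj O), app f O (V.st v) = W.st (app f O v)) : V ⟶ W := ⟨f, hf⟩

def hom {V W : StarObj U} (f : V ⟶ W) : V.obj ⟶ W.obj := Hom.hom f

lemma map_st {V W : StarObj U} (f : V ⟶ W) {O : U.Op} (v : Sec V.obj O) :
    app (hom f) O (V.st v) = W.st (app (hom f) O v) := Hom.map_star f v

@[simp] lemma hom_mkHom {V W : StarObj U} (f : V.obj ⟶ W.obj) (hf) :
    hom (mkHom (V := V) (W := W) f hf) = f := rfl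
@[simp] lemma hom_id (V : StarObj U) : hom (𝟙 V) = 𝟙 V.obj := rfl
@[simp] lemma hom_comp {V W X : StarObj U} (f : V ⟶ W) (g : W ⟶ X) :
    hom (f ≫ g) = hom f ≫ hom g := rfl
lemma ext {V W : StarObj U} {f g : V ⟶ W} (e : hom f = hom g) : f = g := Hom.ext e

end StarObj

/-- The structure sheaf with complex conjugation. -/
abbrev unitStar (U : Man) : StarObj U where
  obj := unitSh U
  star := conjMk (V := unitSh U) (X := unitSh U) (fun O a => fn (fnConj O a))
    (fun O => map_add (fnConj O)) (fun O => map_mul (fnConj O)) (fun _ _ => rfl)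
  star_star {O} a := ContMDiffMap.ext fun x => star_star ((show Fn U O from a) x)

lemma unitStar_st {O : U.Op} (a : Fn U O) : (unitStar U).st (fn a) = fn (fnConj O a) := rfl

/-- The identity of a sheaf of modules, as a morphism to its double complex conjugate. -/
def conjConj (X : Sh U) : X ⟶ (conj U).obj ((conj U).obj X) :=
  homMk (W := (conj U).obj ((conj U).obj X)) (fun O =>
    { toFun := fun v => (show Sec X O from v)
      map_add' := fun _ _ => rfl
      map_smul' := fun a v => congrArg (· • v) (show a = fnConj O (fnConj O a) from
        ContMDiffMap.ext fun x => (star_star (a x)).symm) }) (fun _ _ => rfl)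

@[simp] lemma appConj_comp {V W X : Sh U} (f : V ⟶ W) (g : W ⟶ (conj U).obj X) {O : U.Op}
    (v : Sec V O) : appConj (f ≫ g) v = appConj g (app f O v) := rfl

@[simp] lemma appConj_comp_map {V W X : Sh U} (f : V ⟶ (conj U).obj W) (g : W ⟶ X) {O : U.Op}
    (v : Sec V O) : appConj (f ≫ (conj U).map g) v = app g O (appConj f v) := rfl

def appConjConj {V W : Sh U} (f : V ⟶ (conj U).obj ((conj U).obj W)) {O : U.Op}
    (v : Sec V O) : Sec W O := app f O v

lemma appConjConj_comp {V W X : Sh U} (f : V ⟶ (conj U).obj W) (g : W ⟶ (conj U).obj X)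
    {O : U.Op} (v : Sec V O) :
    appConjConj (f ≫ (conj U).map g) v = appConj g (appConj f v) := rfl

lemma appConjConj_conjConj {X : Sh U} {O : U.Op} (v : Sec X O) :
    appConjConj (conjConj X) v = v := rfl

def tensorConjLift {V W X : Sh U} (f : ∀ O, Sec V O → Sec W O → Sec X O)
    (add_left : ∀ O v v' w, f O (v + v') w = f O v w + f O v' w)
    (smul_left : ∀ O (a : Fn U O) v w, f O (a • v) w = fnConj O a • f O v w)
    (add_right : ∀ O v w w', f O v (w + w') = f O v w + f O v w')
    (smul_right : ∀ O (a : Fn U O) v w, f O v (a • w) = fnConj O a • f O v w)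
    (map_res : ∀ {O O' : U.Op} (i : O' ≤ O) (v : Sec V O) (w : Sec W O),
      f O' (res i v) (res i w) = res i (f O v w)) : tensor V W ⟶ (conj U).obj X :=
  tensorLift (X := (conj U).obj X)
    (Bilin.mk' (X := (conj U).obj X) f add_left smul_left add_right smul_right map_res)

lemma appConj_tensorConjLift {V W X : Sh U} (f : ∀ O, Sec V O → Sec W O → Sec X O)
    (h₁) (h₂) (h₃) (h₄) (h₅) {O : U.Op} (v : Sec V O) (w : Sec W O) :
    appConj (tensorConjLift f h₁ h₂ h₃ h₄ h₅) (tmul v w) = f O v w := app_tensorLift _ v w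

lemma tensor_conj_ext {V W X : Sh U} {f g : tensor V W ⟶ (conj U).obj X}
    (e : ∀ O (v : Sec V O) (w : Sec W O), appConj f (tmul v w) = appConj g (tmul v w)) :
    ∀ {O : U.Op} (t : Sec (tensor V W) O), appConj f t = appConj g t := by
  intro O t
  rw [show f = g from tensor_ext e]

lemma tensor_conjConj_ext {V W X : Sh U} {f g : tensor V W ⟶ (conj U).obj ((conj U).obj X)}
    (e : ∀ O (v : Sec V O) (w : Sec W O), appConjConj f (tmul v w) = appConjConj g (tmul v w)) :
    ∀ {O : U.Op} (t : Sec (tensor V W) O), appConjConj f t = appConjConj g t := by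
  intro O t
  rw [show f = g from tensor_ext e]

/-- The involution `v ⊗ w ↦ v^* ⊗ w^*`. -/
def tensorStarHom (V W : StarObj U) :
    tensor V.obj W.obj ⟶ (conj U).obj (tensor V.obj W.obj) :=
  tensorConjLift (fun O v w => tmul (V.st v) (W.st w))
    (fun O v v' w => by rw [map_add, add_tmul])
    (fun O a v w => by rw [StarObj.st_smul, smul_tmul])
    (fun O v w w' => by rw [map_add, tmul_add])
    (fun O a v w => by rw [StarObj.st_smul, tmul_smul])
    (fun i v w => by rw [StarObj.st_res, StarObj.st_res, tmul_res])

lemma tensorStarHom_tmul (V W : StarObj U) {O : U.Op} (v : Sec V.obj O) (w : Sec W.obj O) :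
    appConj (tensorStarHom V W) (tmul v w) = tmul (V.st v) (W.st w) :=
  appConj_tensorConjLift _ _ _ _ _ _ v w

/-- The tensor product of `*`-objects, with `(v ⊗ w)^* = v^* ⊗ w^*`. -/
abbrev tensorStar (V W : StarObj U) : StarObj U where
  obj := tensor V.obj W.obj
  star := tensorStarHom V W
  star_star {O} v := by
    refine (appConjConj_comp _ _ v).symm.trans
      (Eq.trans (tensor_conjConj_ext (fun O v w => ?_) v) (appConjConj_conjConj v))
    rw [appConjConj_comp, appConjConj_conjConj, tensorStarHom_tmul, tensorStarHom_tmul,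
      StarObj.st_st, StarObj.st_st]

@[simp] lemma tensorStar_st (V W : StarObj U) {O : U.Op} (v : Sec V.obj O) (w : Sec W.obj O) :
    (tensorStar V W).st (O := O) (tmul v w) = tmul (V.st v) (W.st w) := tensorStarHom_tmul V W v w

/-- The tensor product of morphisms. -/
def tensorMap {V V' W W' : Sh U} (f : V ⟶ V') (g : W ⟶ W') : tensor V W ⟶ tensor V' W' :=
  tensorLift (Bilin.mk' (fun O v w => tmul (app f O v) (app g O w))
    (fun O v v' w => by rw [map_add]; exact add_tmul _ _ _)
    (fun O a v w => by rw [map_smul]; exact smul_tmul _ _ _)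
    (fun O v w w' => by rw [map_add]; exact tmul_add _ _ _)
    (fun O a v w => by rw [map_smul]; exact tmul_smul _ _ _)
    (fun i v w => by rw [app_res, app_res]; exact tmul_res i _ _))

@[simp] lemma app_tensorMap {V V' W W' : Sh U} (f : V ⟶ V') (g : W ⟶ W') {O : U.Op} (v : Sec V O)
    (w : Sec W O) : app (tensorMap f g) O (tmul v w) = tmul (app f O v) (app g O w) :=
  app_tensorLift _ v w

lemma tensorMap_id (V W : Sh U) : tensorMap (𝟙 V) (𝟙 W) = 𝟙 (tensor V W) :=
  tensor_ext fun _ v w => app_tensorMap _ _ v w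

lemma tensorMap_comp {V V' V'' W W' W'' : Sh U} (f : V ⟶ V') (f' : V' ⟶ V'')
    (g : W ⟶ W') (g' : W' ⟶ W'') :
    tensorMap (f ≫ f') (g ≫ g') = tensorMap f g ≫ tensorMap f' g' :=
  tensor_ext fun _ v w => by simp

lemma tensorStarHom_map {V V' W W' : StarObj U} (f : V ⟶ V') (g : W ⟶ W') {O : U.Op}
    (t : Sec (tensor V.obj W.obj) O) :
    app (tensorMap (StarObj.hom f) (StarObj.hom g)) O (appConj (tensorStarHom V W) t) =
      appConj (tensorStarHom V' W') (app (tensorMap (StarObj.hom f) (StarObj.hom g)) O t) := by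
  refine (appConj_comp_map (tensorStarHom V W) (tensorMap (StarObj.hom f) (StarObj.hom g))
    t).symm.trans (Eq.trans (tensor_conj_ext (fun O v w => ?_) t)
      (appConj_comp (tensorMap (StarObj.hom f) (StarObj.hom g)) (tensorStarHom V' W') t))
  rw [appConj_comp_map, appConj_comp, tensorStarHom_tmul, app_tensorMap, app_tensorMap,
    tensorStarHom_tmul, StarObj.map_st, StarObj.map_st]

/-- The tensor product of morphisms of `*`-objects. -/
def tensorStarMap {V V' W W' : StarObj U} (f : V ⟶ V') (g : W ⟶ W') :
    tensorStar V W ⟶ tensorStar V' W' :=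
  StarObj.mkHom (V := tensorStar V W) (W := tensorStar V' W')
    (tensorMap (StarObj.hom f) (StarObj.hom g)) (tensorStarHom_map f g)

/-- An object of `IPVec`: a `*`-object `V` with a symmetric `*`-morphism `V ⊗ V ⟶ C^∞`. -/
structure IPVec (U : Man) where
  V : StarObj U
  pairing : tensorStar V V ⟶ unitStar U
  symm : ∀ {O : U.Op} (v w : Sec V.obj O),
    app (StarObj.hom pairing) O (tmul v w) = app (StarObj.hom pairing) O (tmul w v)

namespace IPVec

/-- Morphisms of `*`-objects that preserve the pairing. -/
@[ext]
structure Hom (V W : IPVec U) where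
  hom : V.V ⟶ W.V
  comm : tensorStarMap hom hom ≫ W.pairing = V.pairing

lemma tensorStarMap_id (V W : StarObj U) : tensorStarMap (𝟙 V) (𝟙 W) = 𝟙 (tensorStar V W) :=
  StarObj.ext (tensorMap_id _ _)

lemma tensorStarMap_comp {V V' V'' W W' W'' : StarObj U} (f : V ⟶ V') (f' : V' ⟶ V'')
    (g : W ⟶ W') (g' : W' ⟶ W'') :
    tensorStarMap (f ≫ f') (g ≫ g') = tensorStarMap f g ≫ tensorStarMap f' g' :=
  StarObj.ext (tensorMap_comp _ _ _ _)

instance : Category (IPVec U) where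
  Hom := Hom
  id V := ⟨𝟙 V.V, by rw [tensorStarMap_id, Category.id_comp]⟩
  comp f g := ⟨f.hom ≫ g.hom, by rw [tensorStarMap_comp, Category.assoc, g.comm, f.comm]⟩

def mkHom {V W : IPVec U} (f : V.V ⟶ W.V)
    (hf : tensorStarMap f f ≫ W.pairing = V.pairing) : V ⟶ W := ⟨f, hf⟩

lemma ext {V W : IPVec U} {f g : V ⟶ W} (e : Hom.hom f = Hom.hom g) : f = g := Hom.ext e

/-- The functor that forgets the pairing. -/
def forget (U : Man) : IPVec U ⥤ StarObj U where
  obj V := V.V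
  map f := Hom.hom f

end IPVec

/-- An associative and unital algebra `A` in the monoidal category of sheaves of modules, with an
antilinear involution that reverses products. -/
structure StarAlg (U : Man) where
  A : StarObj U
  mul : tensor A.obj A.obj ⟶ A.obj
  one : unitSh U ⟶ A.obj
  mul_assoc : ∀ {O : U.Op} (a b c : Sec A.obj O),
    app mul O (tmul (app mul O (tmul a b)) c) = app mul O (tmul a (app mul O (tmul b c)))
  one_mul : ∀ {O : U.Op} (a : Sec A.obj O), app mul O (tmul (app one O (fn 1)) a) = a
  mul_one : ∀ {O : U.Op} (a : Sec A.obj O), app mul O (tmul a (app one O (fn 1))) = a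
  star_mul : ∀ {O : U.Op} (a b : Sec A.obj O),
    A.st (app mul O (tmul a b)) = app mul O (tmul (A.st b) (A.st a))
  star_one : ∀ {O : U.Op}, A.st (app one O (fn 1)) = app one O (fn 1)

namespace StarAlg

/-- Morphisms of `*`-objects that preserve the multiplication and the unit. -/
@[ext]
structure Hom (A B : StarAlg U) where
  hom : A.A ⟶ B.A
  map_mul : A.mul ≫ StarObj.hom hom = tensorMap (StarObj.hom hom) (StarObj.hom hom) ≫ B.mul
  map_one : A.one ≫ StarObj.hom hom = B.one

instance : Category (StarAlg U) where
  Hom := Hom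
  id A := ⟨𝟙 A.A, by rw [StarObj.hom_id, tensorMap_id, Category.id_comp, Category.comp_id],
    by rw [StarObj.hom_id, Category.comp_id]⟩
  comp f g := ⟨f.hom ≫ g.hom, by
    rw [StarObj.hom_comp, tensorMap_comp, Category.assoc, ← g.map_mul, ← Category.assoc, f.map_mul,
      Category.assoc], by rw [StarObj.hom_comp, ← Category.assoc, f.map_one, g.map_one]⟩

def mkHom {A B : StarAlg U} (f : A.A ⟶ B.A)
    (hm : A.mul ≫ StarObj.hom f = tensorMap (StarObj.hom f) (StarObj.hom f) ≫ B.mul)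
    (ho : A.one ≫ StarObj.hom f = B.one) : A ⟶ B := ⟨f, hm, ho⟩

lemma ext {A B : StarAlg U} {f g : A ⟶ B} (e : Hom.hom f = Hom.hom g) : f = g := Hom.ext e

/-- The functor that forgets the multiplication and the unit. -/
def forget (U : Man) : StarAlg U ⥤ StarObj U where
  obj A := A.A
  map f := Hom.hom f

end StarAlg
end

section
variable {U : Man}

/-- The symmetric braiding. -/
def swap (V W : Sh U) : tensor V W ⟶ tensor W V :=
  tensorLift (Bilin.mk' (fun _ v w => tmul w v)
    (fun _ v v' w => tmul_add w v v') (fun _ a v w => tmul_smul a w v)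
    (fun _ v w w' => add_tmul w w' v) (fun _ a v w => smul_tmul a w v)
    (fun i v w => tmul_res i w v))

@[simp] lemma app_swap {V W : Sh U} {O : U.Op} (v : Sec V O) (w : Sec W O) :
    app (swap V W) O (tmul v w) = tmul w v := app_tensorLift _ v w

variable {U' : Man} (h : U ⟶ U')

lemma tensor_pull_ext {V W : Sh U'} {X : Sh U}
    {f g : tensor ((pull h).obj V) ((pull h).obj W) ⟶ X}
    (e : ∀ O (v : Sec V O) (w : Sec W O),
      app f (pre h O) (tmul (eta h v) (eta h w)) = app g (pre h O) (tmul (eta h v) (eta h w))) :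
    f = g :=
  tensor_ext fun O s t => bilin_pull_ext h (B := (tmulBilin _ _).comp f)
    (B' := (tmulBilin _ _).comp g) e O s t

lemma tensor_pull_conj_ext {V W : Sh U'} {X : Sh U}
    {f g : tensor ((pull h).obj V) ((pull h).obj W) ⟶ (conj U).obj X}
    (e : ∀ O (v : Sec V O) (w : Sec W O),
      appConj f (tmul (eta h v) (eta h w)) = appConj g (tmul (eta h v) (eta h w))) {O : U.Op}
    (t : Sec (tensor ((pull h).obj V) ((pull h).obj W)) O) : appConj f t = appConj g t := by
  rw [show f = g from tensor_pull_ext h e]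

lemma pull_conj_ext {V : Sh U'} {X : Sh U} {f g : (pull h).obj V ⟶ (conj U).obj X}
    (e : ∀ O (v : Sec V O), appConj f (eta h v) = appConj g (eta h v)) {O : U.Op}
    (t : Sec ((pull h).obj V) O) : appConj f t = appConj g t := by
  rw [show f = g from pull_ext h e]

lemma pull_conjConj_ext {V : Sh U'} {X : Sh U}
    {f g : (pull h).obj V ⟶ (conj U).obj ((conj U).obj X)}
    (e : ∀ O (v : Sec V O), appConjConj f (eta h v) = appConjConj g (eta h v)) {O : U.Op}
    (t : Sec ((pull h).obj V) O) : appConjConj f t = appConjConj g t := by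
  rw [show f = g from pull_ext h e]

/-- The involution of `h^* V`, which sends `h^* v` to `h^* (v^*)`. -/
def pullStarHom (V : StarObj U') : (pull h).obj V.obj ⟶ (conj U).obj ((pull h).obj V.obj) :=
  (pull h).map V.star ≫ pullConj h V.obj

lemma pullStarHom_eta (V : StarObj U') {O : U'.Op} (v : Sec V.obj O) :
    appConj (pullStarHom h V) (eta h v) = eta h (V.st v) := by
  rw [pullStarHom, appConj_comp, app_pull_map]
  exact pullConj_eta h _

namespace StarObj

abbrev pullObj (V : StarObj U') : StarObj U where
  obj := (pull h).obj V.obj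
  star := pullStarHom h V
  star_star {O} v := by
    refine (appConjConj_comp _ _ v).symm.trans
      (Eq.trans (pull_conjConj_ext h (fun O v => ?_) v) (appConjConj_conjConj v))
    rw [appConjConj_comp, appConjConj_conjConj, pullStarHom_eta, pullStarHom_eta, st_st]

lemma pullStarHom_map {V W : StarObj U'} (f : V ⟶ W) {O : U.Op}
    (t : Sec ((pull h).obj V.obj) O) :
    app ((pull h).map (hom f)) O (appConj (pullStarHom h V) t) =
      appConj (pullStarHom h W) (app ((pull h).map (hom f)) O t) := by
  refine (appConj_comp_map (pullStarHom h V) ((pull h).map (hom f)) t).symm.trans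
    (Eq.trans (pull_conj_ext h (fun O v => ?_) t)
      (appConj_comp ((pull h).map (hom f)) (pullStarHom h W) t))
  rw [appConj_comp_map, appConj_comp, pullStarHom_eta, app_pull_map, app_pull_map,
    pullStarHom_eta, map_st]

/-- The pullback of `*`-objects along a smooth map. -/
abbrev pull : StarObj U' ⥤ StarObj U where
  obj := pullObj h
  map f := mkHom (V := pullObj h _) (W := pullObj h _) ((SmoothCAR.pull h).map (hom f))
    (pullStarHom_map h f)
  map_id V := ext ((SmoothCAR.pull h).map_id V.obj)
  map_comp f g := ext ((SmoothCAR.pull h).map_comp (hom f) (hom g))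

lemma pullTensor_star (V W : StarObj U') {O : U.Op}
    (t : Sec (tensor ((SmoothCAR.pull h).obj V.obj) ((SmoothCAR.pull h).obj W.obj)) O) :
    app (pullTensor h V.obj W.obj) O (appConj (tensorStarHom (pullObj h V) (pullObj h W)) t) =
      appConj (pullStarHom h (tensorStar V W)) (app (pullTensor h V.obj W.obj) O t) := by
  refine (appConj_comp_map (tensorStarHom (pullObj h V) (pullObj h W))
    (pullTensor h V.obj W.obj) t).symm.trans
    (Eq.trans (tensor_pull_conj_ext h (fun O v w => ?_) t)
      (appConj_comp (pullTensor h V.obj W.obj) (pullStarHom h (tensorStar V W)) t))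
  rw [appConj_comp_map, appConj_comp, pullTensor_eta]
  refine (congrArg _ (tensorStarHom_tmul (pullObj h V) (pullObj h W) _ _)).trans ?_
  refine Eq.trans ?_ (pullStarHom_eta h (tensorStar V W) _).symm
  rw [tensorStar_st, ← pullTensor_eta, ← pullStarHom_eta, ← pullStarHom_eta]
  rfl

/-- The coherence morphism `h^* V ⊗ h^* W ⟶ h^* (V ⊗ W)` of `*`-objects. -/
def pullTensorStar (V W : StarObj U') :
    tensorStar ((pull h).obj V) ((pull h).obj W) ⟶ (pull h).obj (tensorStar V W) :=
  mkHom (V := tensorStar ((pull h).obj V) ((pull h).obj W)) (W := (pull h).obj (tensorStar V W))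
    (pullTensor h V.obj W.obj) (pullTensor_star h V W)

lemma pullUnitInv_star {O : U.Op} (t : Sec ((SmoothCAR.pull h).obj (unitSh U')) O) :
    app (pullUnitInv h) O (appConj (pullStarHom h (unitStar U')) t) =
      appConj (unitStar U).star (app (pullUnitInv h) O t) := by
  refine (appConj_comp_map (pullStarHom h (unitStar U')) (pullUnitInv h) t).symm.trans
    (Eq.trans (pull_conj_ext h (fun O a => ?_) t)
      (appConj_comp (pullUnitInv h) (unitStar U).star t))
  rw [appConj_comp_map, appConj_comp]
  refine (congrArg _ (pullStarHom_eta h (unitStar U') a)).trans ?_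
  refine (pullUnitInv_eta h (fnConj O a)).trans ?_
  exact (congrArg (appConj (unitStar U).star) (pullUnitInv_eta h a)).symm

/-- The coherence morphism from the pullback of the structure sheaf to the structure sheaf, as a
morphism of `*`-objects. -/
def pullUnitStarInv : (pull h).obj (unitStar U') ⟶ unitStar U :=
  mkHom (V := (pull h).obj (unitStar U')) (W := unitStar U) (pullUnitInv h) (pullUnitInv_star h)

end StarObj

namespace IPVec

/-- The pullback of the pairing. -/
def pullPairing (V : IPVec U') :
    tensorStar ((StarObj.pull h).obj V.V) ((StarObj.pull h).obj V.V) ⟶ unitStar U :=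
  StarObj.pullTensorStar h V.V V.V ≫ (StarObj.pull h).map V.pairing ≫ StarObj.pullUnitStarInv h

lemma hom_pullPairing (V : IPVec U') : StarObj.hom (pullPairing h V) =
    pullTensor h V.V.obj V.V.obj ≫ (pull h).map (StarObj.hom V.pairing) ≫ pullUnitInv h := rfl

lemma pullPairing_eta (V : IPVec U') {O : U'.Op} (v w : Sec V.V.obj O) :
    app (pullTensor h V.V.obj V.V.obj ≫ (pull h).map (StarObj.hom V.pairing) ≫ pullUnitInv h)
      (pre h O) (tmul (eta h v) (eta h w)) =
      fn (fnPull h O (app (StarObj.hom V.pairing) O (tmul v w))) := by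
  rw [app_comp, app_comp, pullTensor_eta, app_pull_map]
  exact pullUnitInv_eta h _

abbrev pullObj (V : IPVec U') : IPVec U where
  V := (StarObj.pull h).obj V.V
  pairing := pullPairing h V
  symm {O} v w := by
    have : pullTensor h V.V.obj V.V.obj ≫ (pull h).map (StarObj.hom V.pairing) ≫ pullUnitInv h =
        swap _ _ ≫ pullTensor h V.V.obj V.V.obj ≫
          (pull h).map (StarObj.hom V.pairing) ≫ pullUnitInv h := by
      refine tensor_pull_ext h fun O v w => ?_
      rw [pullPairing_eta, app_comp, app_swap, pullPairing_eta, V.symm]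
    refine (congrArg (fun k => app k O (tmul v w)) this).trans ?_
    rw [app_comp, app_swap]
    rfl

lemma tensorMap_pull {V V' W W' : Sh U'} (f : V ⟶ V') (g : W ⟶ W') :
    tensorMap ((pull h).map f) ((pull h).map g) ≫ pullTensor h V' W' =
      pullTensor h V W ≫ (pull h).map (tensorMap f g) := by
  refine tensor_pull_ext h fun O v w => ?_
  rw [app_comp, app_comp, app_tensorMap, app_pull_map, app_pull_map, pullTensor_eta,
    pullTensor_eta, app_pull_map, app_tensorMap]

/-- The pullback along a smooth map. -/
abbrev pull : IPVec U' ⥤ IPVec U where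
  obj := pullObj h
  map {V W} f := mkHom (V := pullObj h V) (W := pullObj h W) ((StarObj.pull h).map (Hom.hom f)) <| by
    refine StarObj.ext ?_
    have e := congrArg StarObj.hom (Hom.comm f)
    have : (SmoothCAR.pull h).map (tensorMap (StarObj.hom (Hom.hom f)) (StarObj.hom (Hom.hom f))) ≫
      (SmoothCAR.pull h).map (StarObj.hom W.pairing) =
        (SmoothCAR.pull h).map (StarObj.hom V.pairing) :=
      ((SmoothCAR.pull h).map_comp _ _).symm.trans (congrArg (SmoothCAR.pull h).map e)
    change tensorMap ((SmoothCAR.pull h).map _) ((SmoothCAR.pull h).map _) ≫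
      pullTensor h _ _ ≫ (SmoothCAR.pull h).map _ ≫ pullUnitInv h =
        pullTensor h _ _ ≫ (SmoothCAR.pull h).map _ ≫ pullUnitInv h
    rw [← Category.assoc, tensorMap_pull, ← this]
    simp only [Category.assoc]
  map_id V := ext ((StarObj.pull h).map_id V.V)
  map_comp f g := ext ((StarObj.pull h).map_comp (Hom.hom f) (Hom.hom g))

end IPVec

end

section
variable {U U' : Man} (h : U ⟶ U')

namespace StarAlg

/-- The multiplication of the pullback of a `*`-algebra. -/
def pullMul (A : StarAlg U') :
    tensor ((SmoothCAR.pull h).obj A.A.obj) ((SmoothCAR.pull h).obj A.A.obj) ⟶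
      (SmoothCAR.pull h).obj A.A.obj :=
  pullTensor h A.A.obj A.A.obj ≫ (SmoothCAR.pull h).map A.mul

/-- The unit of the pullback of a `*`-algebra. -/
def pullOne (A : StarAlg U') : unitSh U ⟶ (SmoothCAR.pull h).obj A.A.obj :=
  pullUnit h ≫ (SmoothCAR.pull h).map A.one

lemma pullMul_eta (A : StarAlg U') {O : U'.Op} (a b : Sec A.A.obj O) :
    app (pullMul h A) (pre h O) (tmul (eta h a) (eta h b)) = eta h (app A.mul O (tmul a b)) := by
  rw [pullMul, app_comp, pullTensor_eta, app_pull_map]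

lemma pullOne_eta (A : StarAlg U') (O : U'.Op) :
    app (pullOne h A) (pre h O) (fn 1) = eta h (app A.one O (fn 1)) := by
  rw [pullOne, app_comp, pullUnit_one, app_pull_map]

lemma pullOne_res (A : StarAlg U') (O : U'.Op) {P : U.Op} (i : P ≤ pre h O) :
    app (pullOne h A) P (fn 1) = res i (eta h (app A.one O (fn 1))) := by
  rw [← pullOne_eta, ← app_res]
  rfl

lemma pullMul_res (A : StarAlg U') {O Q : U'.Op} (a : Sec A.A.obj O) (b : Sec A.A.obj Q) {P : U.Op}
    (i : P ≤ pre h O) (j : P ≤ pre h Q) :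
    app (pullMul h A) P (tmul (res i (eta h a)) (res j (eta h b))) =
      res (show P ≤ pre h (O ⊓ Q) from le_inf i j)
        (eta h (app A.mul (O ⊓ Q) (tmul (res inf_le_left a) (res inf_le_right b)))) := by
  rw [← pullMul_eta, ← app_res, ← tmul_res, eta_res, eta_res, res_res, res_res]

lemma pullMul_one_mul (A : StarAlg U') {O : U.Op} (a : Sec ((SmoothCAR.pull h).obj A.A.obj) O) :
    app (pullMul h A) O (tmul (app (pullOne h A) O (fn 1)) a) = a := by
  refine pull_induction₁ h (fun O a =>
    app (pullMul h A) O (tmul (app (pullOne h A) O (fn 1)) a) = a) ?_ ?_ ?_ ?_ ?_ a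
  · intro O
    have := tmul_smul (0 : Fn U O) (app (pullOne h A) O (fn 1))
      (0 : Sec ((SmoothCAR.pull h).obj A.A.obj) O)
    rw [zero_smul, zero_smul] at this
    rw [this, map_zero]
  · intro O s t hs ht
    rw [tmul_add, map_add, hs, ht]
  · intro O a s hs
    rw [tmul_smul, map_smul, hs]
  · intro O s hs
    refine sec_ext _ _ fun x hx => ?_
    obtain ⟨O', i, hx, hs⟩ := hs x hx
    refine ⟨O', i, hx, ?_⟩
    rw [← app_res, ← tmul_res, ← app_res, res_fn, map_one, hs]
  · intro O v P i
    rw [pullOne_res h A O i, tmul_res, app_res, pullMul_eta, A.one_mul]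

lemma pullMul_mul_one (A : StarAlg U') {O : U.Op} (a : Sec ((SmoothCAR.pull h).obj A.A.obj) O) :
    app (pullMul h A) O (tmul a (app (pullOne h A) O (fn 1))) = a := by
  refine pull_induction₁ h (fun O a =>
    app (pullMul h A) O (tmul a (app (pullOne h A) O (fn 1))) = a) ?_ ?_ ?_ ?_ ?_ a
  · intro O
    have := smul_tmul (0 : Fn U O) (0 : Sec ((SmoothCAR.pull h).obj A.A.obj) O)
      (app (pullOne h A) O (fn 1))
    rw [zero_smul, zero_smul] at this
    rw [this, map_zero]
  · intro O s t hs ht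
    rw [add_tmul, map_add, hs, ht]
  · intro O a s hs
    rw [smul_tmul, map_smul, hs]
  · intro O s hs
    refine sec_ext _ _ fun x hx => ?_
    obtain ⟨O', i, hx, hs⟩ := hs x hx
    refine ⟨O', i, hx, ?_⟩
    rw [← app_res, ← tmul_res, ← app_res, res_fn, map_one, hs]
  · intro O v P i
    rw [pullOne_res h A O i, tmul_res, app_res, pullMul_eta, A.mul_one]

lemma zero_tmul {V W : Sh U} {O : U.Op} (w : Sec W O) : tmul (0 : Sec V O) w = 0 := by
  simpa using smul_tmul (0 : Fn U O) (0 : Sec V O) w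

lemma tmul_zero {V W : Sh U} {O : U.Op} (v : Sec V O) : tmul v (0 : Sec W O) = 0 := by
  simpa using tmul_smul (0 : Fn U O) v (0 : Sec W O)

/-- Products of two sections. -/
def pm (A : StarAlg U') {O : U.Op} (a b : Sec ((SmoothCAR.pull h).obj A.A.obj) O) :
    Sec ((SmoothCAR.pull h).obj A.A.obj) O := app (pullMul h A) O (tmul a b)

section
variable (A : StarAlg U') {O O' : U.Op} (a a' b b' : Sec ((SmoothCAR.pull h).obj A.A.obj) O)
@[simp] lemma pm_zero : pm h A a 0 = 0 := by rw [pm, tmul_zero, map_zero]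
@[simp] lemma zero_pm : pm h A 0 a = 0 := by rw [pm, zero_tmul, map_zero]
@[simp] lemma pm_add : pm h A a (b + b') = pm h A a b + pm h A a b' := by
  rw [pm, tmul_add, map_add]; rfl
@[simp] lemma add_pm : pm h A (a + a') b = pm h A a b + pm h A a' b := by
  rw [pm, add_tmul, map_add]; rfl
@[simp] lemma pm_smul (r : Fn U O) : pm h A a (r • b) = r • pm h A a b := by
  rw [pm, tmul_smul, map_smul]; rfl
@[simp] lemma smul_pm (r : Fn U O) : pm h A (r • a) b = r • pm h A a b := by
  rw [pm, smul_tmul, map_smul]; rfl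
lemma pm_res (i : O' ≤ O) : pm h A (res i a) (res i b) = res i (pm h A a b) := by
  rw [pm, tmul_res, app_res]; rfl
end

lemma pm_assoc (A : StarAlg U') {O : U.Op} (a b c : Sec ((SmoothCAR.pull h).obj A.A.obj) O) :
    pm h A (pm h A a b) c = pm h A a (pm h A b c) := by
  revert b c
  refine pull_induction₁ h (fun O a => ∀ b c,
    pm h A (pm h A a b) c = pm h A a (pm h A b c)) ?_ ?_ ?_ ?_ ?_ a
  · intro O b c; simp
  · intro O s t hs ht b c; simp [hs, ht]
  · intro O r s hs b c; simp [hs]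
  · intro O s hs b c
    refine sec_ext _ _ fun x hx => ?_
    obtain ⟨O', i, hx, hs⟩ := hs x hx
    refine ⟨O', i, hx, ?_⟩
    simp only [← pm_res, hs]
  intro O₁ a P i₁ b
  refine pull_induction₁ h (fun P b => ∀ (i₁ : P ≤ pre h O₁) c,
    pm h A (pm h A (res i₁ (eta h a)) b) c = pm h A (res i₁ (eta h a)) (pm h A b c))
      ?_ ?_ ?_ ?_ ?_ b i₁
  · intro O i₁ c; simp
  · intro O s t hs ht i₁ c; simp [hs, ht]
  · intro O r s hs i₁ c; simp [hs]
  · intro O s hs i₁ c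
    refine sec_ext _ _ fun x hx => ?_
    obtain ⟨O', i, hx, hs⟩ := hs x hx
    refine ⟨O', i, hx, ?_⟩
    simp only [← pm_res, res_res, hs]
  intro O₂ b P i₂ i₁ c
  refine pull_induction₁ h (fun P c => ∀ (i₁ : P ≤ pre h O₁) (i₂ : P ≤ pre h O₂),
    pm h A (pm h A (res i₁ (eta h a)) (res i₂ (eta h b))) c =
      pm h A (res i₁ (eta h a)) (pm h A (res i₂ (eta h b)) c))
      ?_ ?_ ?_ ?_ ?_ c i₁ i₂
  · intro O i₁ i₂; simp
  · intro O s t hs ht i₁ i₂; simp [hs, ht]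
  · intro O r s hs i₁ i₂; simp [hs]
  · intro O s hs i₁ i₂
    refine sec_ext _ _ fun x hx => ?_
    obtain ⟨O', i, hx, hs⟩ := hs x hx
    refine ⟨O', i, hx, ?_⟩
    simp only [← pm_res, res_res, hs]
  intro O₃ c P i₃ i₁ i₂
  have e₁ : O₁ ⊓ O₂ ⊓ O₃ ≤ O₁ := inf_le_left.trans inf_le_left
  have e₂ : O₁ ⊓ O₂ ⊓ O₃ ≤ O₂ := inf_le_left.trans inf_le_right
  have e₃ : O₁ ⊓ O₂ ⊓ O₃ ≤ O₃ := inf_le_right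
  have i : P ≤ pre h (O₁ ⊓ O₂ ⊓ O₃) := le_inf (le_inf i₁ i₂) i₃
  have := congrArg (fun s => res i (eta h s)) (A.mul_assoc (res e₁ a) (res e₂ b) (res e₃ c))
  simp only [← pullMul_eta] at this
  simp only [← pullMul_eta, ← app_res, ← tmul_res, eta_res, res_res] at this
  exact this

lemma pullMul_star (A : StarAlg U') {O : U.Op} (a b : Sec ((SmoothCAR.pull h).obj A.A.obj) O) :
    appConj (pullStarHom h A.A) (app (pullMul h A) O (tmul a b)) =
      app (pullMul h A) O (tmul (appConj (pullStarHom h A.A) b) (appConj (pullStarHom h A.A) a)) := by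
  have := tensor_pull_conj_ext h (f := pullMul h A ≫ pullStarHom h A.A)
    (g := swap _ _ ≫ tensorStarHom (StarObj.pullObj h A.A) (StarObj.pullObj h A.A) ≫
      (conj U).map (pullMul h A)) (fun O v w => ?_) (tmul a b)
  · rw [appConj_comp, appConj_comp, app_swap, appConj_comp_map] at this
    refine this.trans ?_
    rw [tensorStarHom_tmul]
    rfl
  · rw [appConj_comp, appConj_comp, app_swap, appConj_comp_map, pullMul_eta, pullStarHom_eta,
      tensorStarHom_tmul, A.star_mul, ← pullMul_eta, ← pullStarHom_eta, ← pullStarHom_eta]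
    rfl

lemma pullOne_star (A : StarAlg U') {O : U.Op} :
    appConj (pullStarHom h A.A) (app (pullOne h A) O (fn 1)) = app (pullOne h A) O (fn 1) := by
  rw [pullOne_res h A ⊤ (show O ≤ pre h ⊤ from fun _ _ => trivial), appConj_res, pullStarHom_eta,
    A.star_one]

abbrev pullObj (A : StarAlg U') : StarAlg U where
  A := (StarObj.pull h).obj A.A
  mul := pullMul h A
  one := pullOne h A
  mul_assoc := pm_assoc h A
  one_mul := pullMul_one_mul h A
  mul_one := pullMul_mul_one h A
  star_mul := pullMul_star h A
  star_one := pullOne_star h A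

/-- The pullback of `*`-algebras along a smooth map. -/
abbrev pull : StarAlg U' ⥤ StarAlg U where
  obj := pullObj h
  map {A B} f := mkHom (A := pullObj h A) (B := pullObj h B) ((StarObj.pull h).map (Hom.hom f))
    (by
      change (pullTensor h _ _ ≫ (SmoothCAR.pull h).map _) ≫ (SmoothCAR.pull h).map _ =
        tensorMap ((SmoothCAR.pull h).map _) ((SmoothCAR.pull h).map _) ≫
          pullTensor h _ _ ≫ (SmoothCAR.pull h).map _
      rw [← Category.assoc (tensorMap _ _), IPVec.tensorMap_pull, Category.assoc, Category.assoc,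
        ← Functor.map_comp, ← Functor.map_comp, Hom.map_mul f])
    (by
      change (pullUnit h ≫ (SmoothCAR.pull h).map _) ≫ (SmoothCAR.pull h).map _ =
        pullUnit h ≫ (SmoothCAR.pull h).map _
      rw [Category.assoc, ← Functor.map_comp, Hom.map_one f])
  map_id V := ext ((StarObj.pull h).map_id V.A)
  map_comp f g := ext ((StarObj.pull h).map_comp (Hom.hom f) (Hom.hom g))

end StarAlg

end

/-- Data of a pseudofunctor on the opposite of the category of manifolds. -/
structure Prestack where
  C : Man → Type 1
  [cat : ∀ U, Category.{0} (C U)]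
  pull : ∀ {U U' : Man}, (U ⟶ U') → C U' ⥤ C U
  pullId : ∀ U, pull (𝟙 U) ≅ 𝟭 (C U)
  pullComp : ∀ {U U' U'' : Man} (g : U ⟶ U') (h : U' ⟶ U''), pull (g ≫ h) ≅ pull h ⋙ pull g
  assoc : ∀ {U U' U'' U''' : Man} (f : U ⟶ U') (g : U' ⟶ U'') (h : U'' ⟶ U''') (V : C U'''),
    (pullComp (f ≫ g) h).hom.app V ≫ (pullComp f g).hom.app ((pull h).obj V) =
      (pullComp f (g ≫ h)).hom.app V ≫ (pull f).map ((pullComp g h).hom.app V)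
  id_left : ∀ {U U' : Man} (h : U ⟶ U') (V : C U'),
    (pullComp (𝟙 U) h).hom.app V ≫ (pullId U).hom.app ((pull h).obj V) = 𝟙 ((pull h).obj V)
  id_right : ∀ {U U' : Man} (h : U ⟶ U') (V : C U'),
    (pullComp h (𝟙 U')).hom.app V ≫ (pull h).map ((pullId U').hom.app V) = 𝟙 ((pull h).obj V)

attribute [instance] Prestack.cat

lemma comp_inv_aux {D : Type*} [Category* D] {a b c d : D} (x : a ⟶ b) (m : b ⟶ c) (i : d ≅ c)
    (j : a ≅ d) (e : j.hom ≫ i.hom = x ≫ m) : x ≫ m ≫ 𝟙 c ≫ i.inv ≫ j.inv = 𝟙 a := by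
  rw [Category.id_comp, ← Category.assoc, ← e]
  simp

lemma comp_id_aux {D : Type*} [Category* D] {a b : D} (x : a ⟶ b) (m : b ⟶ a)
    (e : x ≫ m = 𝟙 a) : x ≫ m ≫ 𝟙 a = 𝟙 a := by
  rw [Category.comp_id, e]

/-- The pseudofunctor with these data. -/
def Prestack.toPseudofunctor (S : Prestack) :
    Pseudofunctor (LocallyDiscrete Manᵒᵖ) Cat.{0, 1} :=
  LocallyDiscrete.mkPseudofunctor
    (fun U => Cat.of (S.C U.unop))
    (fun h => (S.pull h.unop).toCatHom)
    (fun U => Cat.Hom.isoMk (S.pullId U.unop))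
    (fun h g => Cat.Hom.isoMk (S.pullComp g.unop h.unop))
    (fun h g f => Cat.Hom₂.ext (NatTrans.ext (funext fun V =>
      comp_inv_aux (D := S.C _) _ _ ((S.pullComp f.unop g.unop).app ((S.pull h.unop).obj V))
        ((S.pullComp (f.unop ≫ g.unop) h.unop).app V) (S.assoc f.unop g.unop h.unop V))))
    (fun h => Cat.Hom₂.ext (NatTrans.ext (funext fun V =>
      comp_id_aux (D := S.C _) _ _ (S.id_right h.unop V))))
    (fun h => Cat.Hom₂.ext (NatTrans.ext (funext fun V =>
      comp_id_aux (D := S.C _) _ _ (S.id_left h.unop V))))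

section
variable {U U' U'' U''' : Man} (g : U ⟶ U') (h : U' ⟶ U'')

lemma pull_pull_ext {V : Sh U''} {X : Sh U} {f f' : (pull g).obj ((pull h).obj V) ⟶ X}
    (e : ∀ O (v : Sec V O), app f (pre g (pre h O)) (eta g (eta h v)) =
      app f' (pre g (pre h O)) (eta g (eta h v))) : f = f' := by
  apply ((pullAdj g).homEquiv ((pull h).obj V) X).injective
  rw [Adjunction.homEquiv_unit, Adjunction.homEquiv_unit]
  exact pull_ext h e

/-- `h^* v ↦ v` for `h` the identity. -/
def pullIdHom (V : Sh U) : (pull (𝟙 U)).obj V ⟶ V :=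
  pullLift (𝟙 U) (pushMk (𝟙 U) (fun _ v => v) (fun _ _ _ => rfl) (fun _ _ _ => rfl)
    (fun _ _ => rfl))

lemma pullIdHom_eta {V : Sh U} {O : U.Op} (v : Sec V O) :
    app (pullIdHom V) O (eta (𝟙 U) v) = v := app_pullLift _ _ v

def pullIdInv (V : Sh U) : V ⟶ (pull (𝟙 U)).obj V :=
  homMk (fun O => { toFun := fun v => (eta (𝟙 U) v : Sec ((pull (𝟙 U)).obj V) O)
                    map_add' := map_add (eta (𝟙 U))
                    map_smul' := eta_smul (𝟙 U) }) (fun i v => eta_res (𝟙 U) i v)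

lemma app_pullIdInv {V : Sh U} {O : U.Op} (v : Sec V O) :
    app (pullIdInv V) O v = eta (𝟙 U) v := rfl

def shPullId (V : Sh U) : (pull (𝟙 U)).obj V ≅ V where
  hom := pullIdHom V
  inv := pullIdInv V
  hom_inv_id := pull_ext (𝟙 U) fun O v => by
    rw [app_comp]
    exact (congrArg _ (pullIdHom_eta v)).trans (app_pullIdInv v)
  inv_hom_id := hom_ext fun O v => pullIdHom_eta v

/-- `(g ≫ h)^* v ↦ g^* (h^* v)`. -/
def pullCompHom (V : Sh U'') : (pull (g ≫ h)).obj V ⟶ (pull g).obj ((pull h).obj V) :=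
  pullLift (g ≫ h) (pushMk (g ≫ h) (fun _ v => eta g (eta h v))
    (fun _ v w => by rw [map_add, map_add]; rfl)
    (fun _ a v => by rw [eta_smul, eta_smul]; rfl) (fun i v => by rw [eta_res, eta_res]; rfl))

lemma pullCompHom_eta {V : Sh U''} {O : U''.Op} (v : Sec V O) :
    app (pullCompHom g h V) (pre (g ≫ h) O) (eta (g ≫ h) v) = eta g (eta h v) :=
  app_pullLift _ _ v

def pullCompInv₁ (V : Sh U'') : (pull h).obj V ⟶ (push g).obj ((pull (g ≫ h)).obj V) :=
  pullLift h (pushMk (X := (push g).obj ((pull (g ≫ h)).obj V)) h (fun _ v => eta (g ≫ h) v)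
    (fun _ v w => map_add (eta (g ≫ h)) v w)
    (fun _ a v => eta_smul (g ≫ h) a v) (fun i v => eta_res (g ≫ h) i v))

def pullCompInv (V : Sh U'') : (pull g).obj ((pull h).obj V) ⟶ (pull (g ≫ h)).obj V :=
  pullLift g (pullCompInv₁ g h V)

lemma pullCompInv_eta {V : Sh U''} {O : U''.Op} (v : Sec V O) :
    app (pullCompInv g h V) (pre g (pre h O)) (eta g (eta h v)) = eta (g ≫ h) v :=
  (app_pullLift g (pullCompInv₁ g h V) (eta h v)).trans (app_pullLift h _ v)

def shPullComp (V : Sh U'') : (pull (g ≫ h)).obj V ≅ (pull g).obj ((pull h).obj V) where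
  hom := pullCompHom g h V
  inv := pullCompInv g h V
  hom_inv_id := pull_ext (g ≫ h) fun O v => by
    rw [app_comp, pullCompHom_eta]
    exact pullCompInv_eta g h v
  inv_hom_id := pull_pull_ext g h fun O v => by
    rw [app_comp, pullCompInv_eta]
    exact pullCompHom_eta g h v

lemma pullId_naturality {V W : Sh U} (f : V ⟶ W) :
    (pull (𝟙 U)).map f ≫ pullIdHom W = pullIdHom V ≫ f :=
  pull_ext (𝟙 U) fun O v => by
    rw [app_comp, app_comp, app_pull_map]
    exact (pullIdHom_eta _).trans (congrArg (app f O) (pullIdHom_eta v).symm)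

lemma pullComp_naturality {V W : Sh U''} (f : V ⟶ W) :
    (pull (g ≫ h)).map f ≫ pullCompHom g h W =
      pullCompHom g h V ≫ (pull g).map ((pull h).map f) :=
  pull_ext (g ≫ h) fun O v => by
    rw [app_comp, app_comp, app_pull_map, pullCompHom_eta, pullCompHom_eta]
    refine Eq.trans ?_ (app_pull_map g (O := pre h O) _ _).symm
    rw [app_pull_map]

lemma pullComp_assoc (k : U'' ⟶ U''') (V : Sh U''') :
    pullCompHom (g ≫ h) k V ≫ pullCompHom g h ((pull k).obj V) =
      pullCompHom g (h ≫ k) V ≫ (pull g).map (pullCompHom h k V) :=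
  pull_ext (g ≫ h ≫ k) fun O v => by
    have e₁ : app (pullCompHom (g ≫ h) k V) (pre (g ≫ h ≫ k) O) (eta (g ≫ h ≫ k) v) =
      eta (g ≫ h) (eta k v) := pullCompHom_eta (g ≫ h) k v
    have e₂ : app (pullCompHom g (h ≫ k) V) (pre (g ≫ h ≫ k) O) (eta (g ≫ h ≫ k) v) =
      eta g (eta (h ≫ k) v) := pullCompHom_eta g (h ≫ k) v
    refine (congrArg (app (pullCompHom g h ((pull k).obj V)) (pre (g ≫ h ≫ k) O)) e₁).trans
      ((pullCompHom_eta g h (eta k v)).trans (Eq.trans ?_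
        (congrArg (app ((pull g).map (pullCompHom h k V)) (pre (g ≫ h ≫ k) O)) e₂).symm))
    refine Eq.trans ?_ (app_pull_map g (O := pre (h ≫ k) O) _ _).symm
    rw [pullCompHom_eta h k]
    rfl

lemma pullComp_id_left (V : Sh U') :
    pullCompHom (𝟙 U) g V ≫ pullIdHom ((pull g).obj V) = 𝟙 ((pull g).obj V) :=
  pull_ext g fun O v => by
    have e₁ : app (pullCompHom (𝟙 U) g V) (pre g O) (eta g v) = eta (𝟙 U) (eta g v) :=
      pullCompHom_eta (𝟙 U) g v
    exact (congrArg (app (pullIdHom ((pull g).obj V)) (pre g O)) e₁).trans (pullIdHom_eta _)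

lemma pullComp_id_right (V : Sh U') :
    pullCompHom g (𝟙 U') V ≫ (pull g).map (pullIdHom V) = 𝟙 ((pull g).obj V) :=
  pull_ext g fun O v => by
    have e₁ : app (pullCompHom g (𝟙 U') V) (pre g O) (eta g v) = eta g (eta (𝟙 U') v) :=
      pullCompHom_eta g (𝟙 U') v
    refine (congrArg (app ((pull g).map (pullIdHom V)) (pre g O)) e₁).trans ?_
    refine (app_pull_map g (O := pre (𝟙 U') O) _ _).trans ?_
    exact congrArg (eta g) (pullIdHom_eta v)

namespace StarObj

def isoMk {V W : StarObj U} (e : V.obj ≅ W.obj)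
    (he : ∀ {O : U.Op} (v : Sec V.obj O), app e.hom O (V.st v) = W.st (app e.hom O v)) :
    V ≅ W where
  hom := mkHom (V := V) (W := W) e.hom he
  inv := mkHom (V := W) (W := V) e.inv fun {O} v => by
    have h₁ : ∀ v : Sec W.obj O, app e.hom O (app e.inv O v) = v := fun v =>
      congrArg (fun k => app k O v) e.inv_hom_id
    have h₂ : ∀ v : Sec V.obj O, app e.inv O (app e.hom O v) = v := fun v =>
      congrArg (fun k => app k O v) e.hom_inv_id
    conv_lhs => rw [← h₁ v, ← he, h₂]
  hom_inv_id := ext e.hom_inv_id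
  inv_hom_id := ext e.inv_hom_id

lemma pullIdHom_star (V : StarObj U) {O : U.Op} (t : Sec ((SmoothCAR.pull (𝟙 U)).obj V.obj) O) :
    app (pullIdHom V.obj) O (((pull (𝟙 U)).obj V).st t) = V.st (app (pullIdHom V.obj) O t) := by
  refine (appConj_comp_map (pullStarHom (𝟙 U) V) (pullIdHom V.obj) t).symm.trans
    (Eq.trans (pull_conj_ext (𝟙 U) (fun O v => ?_) t)
      (appConj_comp (pullIdHom V.obj) V.star t))
  rw [appConj_comp_map, appConj_comp, pullStarHom_eta]
  exact (pullIdHom_eta _).trans (congrArg V.st (pullIdHom_eta v).symm)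

lemma pullCompHom_star (V : StarObj U'') {O : U.Op}
    (t : Sec ((SmoothCAR.pull (g ≫ h)).obj V.obj) O) :
    app (pullCompHom g h V.obj) O (((pull (g ≫ h)).obj V).st t) =
      ((pull g).obj ((pull h).obj V)).st (app (pullCompHom g h V.obj) O t) := by
  refine (appConj_comp_map (pullStarHom (g ≫ h) V) (pullCompHom g h V.obj) t).symm.trans
    (Eq.trans (pull_conj_ext (g ≫ h) (fun O v => ?_) t)
      (appConj_comp (pullCompHom g h V.obj) (pullStarHom g (pullObj h V)) t))
  rw [appConj_comp_map, appConj_comp, pullStarHom_eta, pullCompHom_eta, pullCompHom_eta]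
  refine Eq.trans ?_ (pullStarHom_eta g (O := pre h O) (pullObj h V) _).symm
  exact congrArg (eta g) (pullStarHom_eta h V v).symm

def pullIdIso (V : StarObj U) : (pull (𝟙 U)).obj V ≅ V :=
  isoMk (shPullId V.obj) (pullIdHom_star V)

def pullCompIso (V : StarObj U'') :
    (pull (g ≫ h)).obj V ≅ (pull g).obj ((pull h).obj V) :=
  isoMk (shPullComp g h V.obj) (pullCompHom_star g h V)

/-- The prestack of `*`-objects. -/
def prestack : Prestack where
  C := StarObj
  pull := pull
  pullId _ := NatIso.ofComponents pullIdIso (fun f => ext (pullId_naturality (hom f)))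
  pullComp g h := NatIso.ofComponents (pullCompIso g h)
    (fun f => ext (pullComp_naturality g h (hom f)))
  assoc f g h V := ext (pullComp_assoc f g h V.obj)
  id_left h V := ext (pullComp_id_left h V.obj)
  id_right h V := ext (pullComp_id_right h V.obj)

end StarObj

namespace IPVec

def isoMk {V W : IPVec U} (e : V.V ≅ W.V)
    (he : tensorStarMap e.hom e.hom ≫ W.pairing = V.pairing) : V ≅ W where
  hom := mkHom (V := V) (W := W) e.hom he
  inv := mkHom (V := W) (W := V) e.inv <| by
    rw [← he, ← Category.assoc, ← tensorStarMap_comp, e.inv_hom_id, tensorStarMap_id,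
      Category.id_comp]
  hom_inv_id := ext e.hom_inv_id
  inv_hom_id := ext e.inv_hom_id

def pullIdIso (V : IPVec U) : (pull (𝟙 U)).obj V ≅ V :=
  isoMk (StarObj.pullIdIso V.V) <| StarObj.ext <| by
    change tensorMap (pullIdHom _) (pullIdHom _) ≫ StarObj.hom V.pairing = pullTensor (𝟙 U) _ _ ≫
      (SmoothCAR.pull (𝟙 U)).map (StarObj.hom V.pairing) ≫ pullUnitInv (𝟙 U)
    refine tensor_pull_ext (𝟙 U) fun O v w => ?_
    rw [pullPairing_eta, app_comp, app_tensorMap]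
    refine congrArg (app (StarObj.hom V.pairing) O)
      (congrArg₂ tmul (pullIdHom_eta v) (pullIdHom_eta w))

def pullCompIso (V : IPVec U'') :
    (pull (g ≫ h)).obj V ≅ (pull g).obj ((pull h).obj V) :=
  isoMk (StarObj.pullCompIso g h V.V) <| StarObj.ext <| by
    change tensorMap (pullCompHom g h _) (pullCompHom g h _) ≫ pullTensor g _ _ ≫
        (SmoothCAR.pull g).map (StarObj.hom (pullPairing h V)) ≫ pullUnitInv g =
      pullTensor (g ≫ h) _ _ ≫
        (SmoothCAR.pull (g ≫ h)).map (StarObj.hom V.pairing) ≫ pullUnitInv (g ≫ h)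
    refine tensor_pull_ext (g ≫ h) fun O v w => ?_
    rw [pullPairing_eta, app_comp, app_tensorMap, pullCompHom_eta, pullCompHom_eta]
    refine (pullPairing_eta g (pullObj h V) (eta h v) (eta h w)).trans ?_
    exact congrArg (fun a : Fn U' (pre h O) => fn (fnPull g (pre h O) a)) (pullPairing_eta h V v w)

/-- The prestack of `*`-objects with a symmetric pairing. -/
def prestack : Prestack where
  C := IPVec
  pull := pull
  pullId _ := NatIso.ofComponents pullIdIso
    (fun f => ext (StarObj.ext (pullId_naturality (StarObj.hom (Hom.hom f)))))
  pullComp g h := NatIso.ofComponents (pullCompIso g h)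
    (fun f => ext (StarObj.ext (pullComp_naturality g h (StarObj.hom (Hom.hom f)))))
  assoc f g h V := ext (StarObj.ext (pullComp_assoc f g h V.V.obj))
  id_left h V := ext (StarObj.ext (pullComp_id_left h V.V.obj))
  id_right h V := ext (StarObj.ext (pullComp_id_right h V.V.obj))

end IPVec

namespace StarAlg

def isoMk {A B : StarAlg U} (e : A.A ≅ B.A)
    (hm : A.mul ≫ StarObj.hom e.hom = tensorMap (StarObj.hom e.hom) (StarObj.hom e.hom) ≫ B.mul)
    (ho : A.one ≫ StarObj.hom e.hom = B.one) : A ≅ B where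
  hom := mkHom (A := A) (B := B) e.hom hm ho
  inv := mkHom (A := B) (B := A) e.inv
    (by
      have h₁ : StarObj.hom e.hom ≫ StarObj.hom e.inv = 𝟙 _ := congrArg StarObj.hom e.hom_inv_id
      have h₂ : StarObj.hom e.inv ≫ StarObj.hom e.hom = 𝟙 _ := congrArg StarObj.hom e.inv_hom_id
      calc B.mul ≫ StarObj.hom e.inv
          = tensorMap (StarObj.hom e.inv) (StarObj.hom e.inv) ≫
              (tensorMap (StarObj.hom e.hom) (StarObj.hom e.hom) ≫ B.mul) ≫ StarObj.hom e.inv := by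
            rw [← Category.assoc, ← Category.assoc, ← tensorMap_comp, h₂, tensorMap_id,
              Category.id_comp]
        _ = tensorMap (StarObj.hom e.inv) (StarObj.hom e.inv) ≫ A.mul := by
            rw [← hm, Category.assoc, h₁, Category.comp_id])
    (by
      have h₁ : StarObj.hom e.hom ≫ StarObj.hom e.inv = 𝟙 _ := congrArg StarObj.hom e.hom_inv_id
      rw [← ho, Category.assoc, h₁, Category.comp_id])
  hom_inv_id := ext e.hom_inv_id
  inv_hom_id := ext e.inv_hom_id

def pullIdIso (A : StarAlg U) : (pull (𝟙 U)).obj A ≅ A :=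
  isoMk (StarObj.pullIdIso A.A)
    (by
      change pullMul (𝟙 U) A ≫ pullIdHom A.A.obj =
        tensorMap (pullIdHom A.A.obj) (pullIdHom A.A.obj) ≫ A.mul
      refine tensor_pull_ext (𝟙 U) fun O v w => ?_
      rw [app_comp, pullMul_eta, app_comp, app_tensorMap]
      exact (pullIdHom_eta _).trans (congrArg (app A.mul O)
        (congrArg₂ tmul (pullIdHom_eta v) (pullIdHom_eta w)).symm))
    (by
      change pullOne (𝟙 U) A ≫ pullIdHom A.A.obj = A.one
      refine unit_ext fun O => ?_
      rw [app_comp]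
      exact (congrArg _ (pullOne_eta (𝟙 U) A O)).trans (pullIdHom_eta _))

def pullCompIso (A : StarAlg U'') :
    (pull (g ≫ h)).obj A ≅ (pull g).obj ((pull h).obj A) :=
  isoMk (StarObj.pullCompIso g h A.A)
    (by
      change pullMul (g ≫ h) A ≫ pullCompHom g h A.A.obj =
        tensorMap (pullCompHom g h A.A.obj) (pullCompHom g h A.A.obj) ≫ pullMul g (pullObj h A)
      refine tensor_pull_ext (g ≫ h) fun O v w => ?_
      rw [app_comp, pullMul_eta, app_comp, app_tensorMap, pullCompHom_eta, pullCompHom_eta,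
        pullCompHom_eta]
      refine Eq.trans ?_ (pullMul_eta g (pullObj h A) (eta h v) (eta h w)).symm
      exact congrArg (eta g) (pullMul_eta h A v w).symm)
    (by
      change pullOne (g ≫ h) A ≫ pullCompHom g h A.A.obj = pullOne g (pullObj h A)
      refine unit_ext fun O => ?_
      have i : O ≤ pre (g ≫ h) ⊤ := fun _ _ => trivial
      rw [app_comp, pullOne_res (g ≫ h) A ⊤ i, app_res, pullCompHom_eta,
        pullOne_res g (pullObj h A) (pre h ⊤) i]
      exact congrArg (fun s => res i (eta g s)) (pullOne_eta h A ⊤).symm)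

/-- The prestack of `*`-algebras. -/
def prestack : Prestack where
  C := StarAlg
  pull := pull
  pullId _ := NatIso.ofComponents pullIdIso
    (fun f => ext (StarObj.ext (pullId_naturality (StarObj.hom (Hom.hom f)))))
  pullComp g h := NatIso.ofComponents (pullCompIso g h)
    (fun f => ext (StarObj.ext (pullComp_naturality g h (StarObj.hom (Hom.hom f)))))
  assoc f g h V := ext (StarObj.ext (pullComp_assoc f g h V.A.obj))
  id_left h V := ext (StarObj.ext (pullComp_id_left h V.A.obj))
  id_right h V := ext (StarObj.ext (pullComp_id_right h V.A.obj))

end StarAlg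
end

instance (U : Man) : Preadditive (Sh U) :=
  inferInstanceAs (Preadditive (SheafOfModules.{0} (fnSheaf U)))

section
variable {U : Man}

lemma app_add {V W : Sh U} (f g : V ⟶ W) (O : U.Op) (v : Sec V O) :
    app (f + g) O v = app f O v + app g O v := rfl

namespace StarAlg

lemma anticomm_star (A : StarAlg U) {O : U.Op} (t : Sec (tensor A.A.obj A.A.obj) O) :
    app (A.mul + swap _ _ ≫ A.mul) O ((tensorStar A.A A.A).st t) =
      A.A.st (app (A.mul + swap _ _ ≫ A.mul) O t) := by
  refine (appConj_comp_map (tensorStarHom A.A A.A) (A.mul + swap _ _ ≫ A.mul) t).symm.trans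
    (Eq.trans (tensor_conj_ext (fun O a b => ?_) t)
      (appConj_comp (A.mul + swap _ _ ≫ A.mul) A.A.star t))
  have e : appConj A.A.star (app (A.mul + swap _ _ ≫ A.mul) O (tmul a b)) =
      A.A.st (app A.mul O (tmul a b)) + A.A.st (app A.mul O (tmul b a)) := by
    rw [app_add, app_comp, app_swap]
    exact map_add A.A.st _ _
  rw [appConj_comp_map, appConj_comp, e, tensorStarHom_tmul, app_add, app_comp, app_swap,
    A.star_mul, A.star_mul, add_comm]

/-- The sum `a ⊗ b ↦ a b + b a` of the multiplication and the opposite multiplication. -/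
def anticomm (A : StarAlg U) : tensorStar A.A A.A ⟶ A.A :=
  StarObj.mkHom (V := tensorStar A.A A.A) (W := A.A) (A.mul + swap _ _ ≫ A.mul) (anticomm_star A)

/-- The unit of an algebra, as a morphism of `*`-objects. -/
def oneStar (A : StarAlg U) : unitStar U ⟶ A.A :=
  StarObj.mkHom (V := unitStar U) (W := A.A) A.one (fun {O} a => by
    have e₁ : a = (show Fn U O from a) • fn (1 : Fn U O) := fn_eq_smul (show Fn U O from a)
    have e₂ : (unitStar U).st (fn (1 : Fn U O)) = fn 1 := congrArg fn (map_one (fnConj O))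
    rw [e₁, StarObj.st_smul, map_smul, map_smul, StarObj.st_smul, e₂, A.star_one])

end StarAlg

/-- The tensor powers `V ⊗ (V ⊗ (⋯ ⊗ C^∞))`. -/
def tpow (V : Sh U) : ℕ → Sh U
  | 0 => unitSh U
  | n + 1 => tensor V (tpow V n)

/-- The map `v₁ ⊗ ⋯ ⊗ vₙ ↦ f v₁ ⋯ f vₙ`. -/
def tpowMap {V : Sh U} (A : StarAlg U) (f : V ⟶ A.A.obj) : ∀ n, tpow V n ⟶ A.A.obj
  | 0 => A.one
  | n + 1 => tensorMap f (tpowMap A f n) ≫ A.mul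

variable {F : StarObj U ⥤ StarAlg U} (adj : F ⊣ StarAlg.forget U)

/-- The morphism `F(V ⊗ V) ⟶ F(V)` of `*`-algebras with `v ⊗ v' ↦ v v' + v' v`. -/
def relAnticomm (V : IPVec U) : F.obj (tensorStar V.V V.V) ⟶ F.obj V.V :=
  (adj.homEquiv (tensorStar V.V V.V) (F.obj V.V)).symm
    (tensorStarMap (adj.unit.app V.V) (adj.unit.app V.V) ≫ (F.obj V.V).anticomm)

/-- The morphism `F(V ⊗ V) ⟶ F(V)` of `*`-algebras with `v ⊗ v' ↦ ⟨v, v'⟩ 1`. -/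
def relPairing (V : IPVec U) : F.obj (tensorStar V.V V.V) ⟶ F.obj V.V :=
  (adj.homEquiv (tensorStar V.V V.V) (F.obj V.V)).symm (V.pairing ≫ (F.obj V.V).oneStar)

/-- The comparison `F(h^* V) ⟶ h^* F(V)`, the adjunct of the pullback of the unit `V ⟶ F(V)`. -/
def freeComparison {U' : Man} {F' : StarObj U' ⥤ StarAlg U'} (adj' : F' ⊣ StarAlg.forget U')
    (h : U ⟶ U') (V : StarObj U') :
    F.obj ((StarObj.pull h).obj V) ⟶ (StarAlg.pull h).obj (F'.obj V) :=
  (adj.homEquiv ((StarObj.pull h).obj V) ((StarAlg.pull h).obj (F'.obj V))).symm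
    ((StarObj.pull h).map (adj'.unit.app V))

end

/-- Morphisms of prestacks: pseudonatural transformations. -/
abbrev Prestack.Hom (S T : Prestack) :=
  Pseudofunctor.StrongTrans S.toPseudofunctor T.toPseudofunctor

namespace Prestack.Hom
variable {S T : Prestack} (Φ : S.Hom T)

/-- The component functors. -/
def functor (U : Man) : S.C U ⥤ T.C U := (Φ.app ⟨op U⟩).toFunctor

/-- The coherence isomorphisms. -/
def coherence {U U' : Man} (h : U ⟶ U') : S.pull h ⋙ Φ.functor U ≅ Φ.functor U' ⋙ T.pull h :=
  Cat.Hom.toNatIso (Φ.naturality (Quiver.Hom.toLoc h.op))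

end Prestack.Hom

end SmoothCAR

end

open CategoryTheory.Limits SmoothCAR

/-!
The constructions are made on presheaves and sheafified. A presheaf of rings with a central action of
the smooth functions and a product-reversing involution (`PreStarAlg`) has an associated sheaf of
`*`-algebras, and morphisms from it to a sheaf of `*`-algebras are natural families of
`*`-homomorphisms on the presheaf (`PreStarAlg.exists_algHom`, `PreStarAlg.hom_ext_unit`).

For the presheaf of tensor algebras `O ↦ T(V(O))` this gives the free order-reversing `*`-monoid
(`freeAdj`). Its underlying sheaf is the direct sum of the tensor powers (`freeIsColimit`): the tensor
algebra acts on `⨁ₙ V^{⊗n}(O)` by `t ↦ v ⊗ t`, and the orbit map of `1` sends `v₁ ⋯ vₙ` to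
`v₁ ⊗ ⋯ ⊗ vₙ`, so that a family of morphisms on the tensor powers defines a morphism on the free
`*`-monoid.

For the presheaf of quotients of `T(V(O))` by `v w + w v = ⟨v, w⟩` it gives the algebra `carAlg V`,
through which the Clifford maps `V ⟶ B` factor uniquely (`exists_carLift`, `carLift_unique`). A
morphism out of the free `*`-monoid coequalizes the two relations exactly if its restriction to the
generators is a Clifford map (`rel_comp_eq_iff`), and this is the coequalizer property
(`carIsColimit`).

Compatibility with the pullback along `h` is formal: the direct image `h_* B` of a sheaf of
`*`-algebras is again one (`StarAlg.pushAlg`), and `h_*` is right adjoint to `h^*` on `*`-algebras.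
Therefore `h^* F(V)` and `F(h^* V)` have the same morphisms to every `B`, namely the morphisms
`V ⟶ h_* B`, and `h^* CAR(V)` and `CAR(h^* V)` both represent the Clifford maps `V ⟶ h_* B`
(`StarAlg.isIso_of_generators`). All morphisms in question are determined by their values on pulled
back generators; the coherence conditions and the naturality of the projection are verified there.
-/

noncomputable section

namespace SmoothCAR

/-! ### Sheafification of presheaves of `*`-algebras -/

/-- A presheaf of complex `*`-algebras over the smooth functions: a presheaf of rings with a central
ring homomorphism from the smooth functions and an involution that reverses products. -/
structure PreStarAlg (U : Man) where
  carrier : U.Op → Type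
  [ring : ∀ O, Ring (carrier O)]
  restr : ∀ {O O' : U.Op}, O' ≤ O → carrier O →+* carrier O'
  restr_self : ∀ {O : U.Op} (p : carrier O), restr le_rfl p = p
  restr_restr : ∀ {O O' O'' : U.Op} (i : O' ≤ O) (j : O'' ≤ O') (p : carrier O),
    restr j (restr i p) = restr (j.trans i) p
  scal : ∀ O, Fn U O →+* carrier O
  scal_res : ∀ {O O' : U.Op} (i : O' ≤ O) (a : Fn U O), restr i (scal O a) = scal O' (fnRes i a)
  scal_comm : ∀ {O : U.Op} (a : Fn U O) (p : carrier O), scal O a * p = p * scal O a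
  st : ∀ {O}, carrier O →+ carrier O
  st_st : ∀ {O} (p : carrier O), st (st p) = p
  st_mul : ∀ {O} (p q : carrier O), st (p * q) = st q * st p
  st_scal : ∀ {O} (a : Fn U O), st (scal O a) = scal O (fnConj O a)
  st_res : ∀ {O O' : U.Op} (i : O' ≤ O) (p : carrier O), st (restr i p) = restr i (st p)

attribute [instance] PreStarAlg.ring

namespace PreStarAlg
variable {U : Man} (P : PreStarAlg U)

/-- The underlying presheaf of rings. -/
def presheaf : (Opens U.space)ᵒᵖ ⥤ RingCat.{0} where
  obj O := RingCat.of (P.carrier O.unop)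
  map i := RingCat.ofHom (P.restr (leOfHom i.unop))
  map_id _ := RingCat.hom_ext (RingHom.ext fun p => P.restr_self p)
  map_comp i j := RingCat.hom_ext (RingHom.ext fun p =>
    (P.restr_restr (leOfHom i.unop) (leOfHom j.unop) p).symm)

/-- Stated for a general space, so that instance search need not look through the definition of
the space underlying a manifold. -/
lemma hasSheafify_ring (X : TopCat.{0}) :
    HasSheafify (Opens.grothendieckTopology X) RingCat.{0} := inferInstance

instance : HasSheafify (Opens.grothendieckTopology U.space) RingCat.{0} := hasSheafify_ring _

/-- The associated sheaf of rings. -/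
def sheaf : Sheaf (Opens.grothendieckTopology U.space) RingCat.{0} :=
  (presheafToSheaf _ _).obj P.presheaf

/-- The canonical map to the associated sheaf of rings. -/
def toSheaf : P.presheaf ⟶ P.sheaf.obj := toSheafify _ P.presheaf

/-- The sections of the associated sheaf of rings. -/
abbrev S (O : U.Op) : Type := P.sheaf.obj.obj (op O)

/-- Restriction of sections of the associated sheaf of rings. -/
def sRes {O O' : U.Op} (i : O' ≤ O) : P.S O →+* P.S O' := (P.sheaf.obj.map (homOfLE i).op).hom

/-- The canonical map to the associated sheaf of rings, on sections over `O`. -/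
def toS (O : U.Op) : P.carrier O →+* P.S O := (P.toSheaf.app (op O)).hom

lemma toS_res {O O' : U.Op} (i : O' ≤ O) (p : P.carrier O) :
    P.toS O' (P.restr i p) = P.sRes i (P.toS O p) :=
  ConcreteCategory.congr_hom (P.toSheaf.naturality (homOfLE i).op) p

/-- The forgetful functor from rings to sets preserves sheafification, so the canonical map to the
associated sheaf of rings is a local isomorphism of presheaves of sets. -/
lemma W_forget (X : TopCat.{0}) (P : (Opens X)ᵒᵖ ⥤ RingCat.{0}) :
    (Opens.grothendieckTopology X).W
      (Functor.whiskerRight (toSheafify (Opens.grothendieckTopology X) P) (forget RingCat.{0})) :=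
  (Opens.grothendieckTopology X).W_of_preservesSheafification _ _
    ((Opens.grothendieckTopology X).W_toSheafify P)

lemma W_toSheaf : (Opens.grothendieckTopology U.space).W
    (Functor.whiskerRight P.toSheaf (forget RingCat.{0})) := W_forget U.space P.presheaf

/-- Every section of the associated sheaf comes locally from the presheaf. -/
lemma toS_locally_surjective {O : U.Op} (s : P.S O) {x : U.space} (hx : x ∈ O) :
    ∃ (O' : U.Op) (i : O' ≤ O), x ∈ O' ∧ ∃ p, P.toS O' p = P.sRes i s := by
  have h := P.W_toSheaf.isLocallySurjective
  obtain ⟨O', i, ⟨p, hp⟩, hx'⟩ := h.imageSieve_mem s x hx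
  exact ⟨O', leOfHom i, hx', p, hp⟩

/-- Natural families of maps from the presheaf to a sheaf extend to the associated sheaf. -/
lemma exists_lift_S {X : Sh U} (f : ∀ O, P.carrier O → Sec X O)
    (hf : ∀ {O O' : U.Op} (i : O' ≤ O) (p : P.carrier O), f O' (P.restr i p) = res i (f O p)) :
    ∃ g : ∀ O, P.S O → Sec X O, (∀ {O O' : U.Op} (i : O' ≤ O) (s : P.S O),
      g O' (P.sRes i s) = res i (g O s)) ∧ ∀ O p, g O (P.toS O p) = f O p := by
  have hX : Presheaf.IsSheaf (Opens.grothendieckTopology U.space)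
      (X.val.presheaf ⋙ forget AddCommGrpCat.{0}) :=
    (TopCat.Presheaf.isSheaf_iff_isSheaf_comp (forget AddCommGrpCat.{0}) X.val.presheaf).1 X.isSheaf
  let φ : P.presheaf ⋙ forget RingCat.{0} ⟶ X.val.presheaf ⋙ forget AddCommGrpCat.{0} :=
    { app := fun O => ↾(f O.unop)
      naturality := fun O O' i => by
        ext p
        exact hf (leOfHom i.unop) p }
  obtain ⟨γ, hγ⟩ := (P.W_toSheaf _ hX).2 φ
  refine ⟨fun O s => γ.app (op O) s, fun i s => ?_, fun O p => ?_⟩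
  · exact ConcreteCategory.congr_hom (γ.naturality (homOfLE i).op) s
  · exact congrArg (fun k : P.presheaf ⋙ forget RingCat.{0} ⟶
      X.val.presheaf ⋙ forget AddCommGrpCat.{0} => k.app (op O) p) hγ

/-- The underlying presheaf of abelian groups of the associated sheaf. -/
def abPresheaf : (Opens U.space)ᵒᵖ ⥤ AddCommGrpCat.{0} :=
  P.sheaf.obj ⋙ forget₂ RingCat.{0} AddCommGrpCat.{0}

lemma isSheaf_abPresheaf : Presheaf.IsSheaf (Opens.grothendieckTopology U.space) P.abPresheaf :=
  (TopCat.Presheaf.isSheaf_iff_isSheaf_comp (forget AddCommGrpCat.{0}) P.abPresheaf).2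
    ((TopCat.Presheaf.isSheaf_iff_isSheaf_comp (forget RingCat.{0}) P.sheaf.obj).1 P.sheaf.property)

/-- Smooth functions act through the structure homomorphism `scal`. -/
instance moduleS (O : U.Op) : Module (Fn U O) (P.S O) :=
  Module.compHom (P.S O) ((P.toS O).comp (P.scal O))

lemma smul_S {O : U.Op} (a : Fn U O) (s : P.S O) : a • s = P.toS O (P.scal O a) * s := rfl

lemma sRes_smul {O O' : U.Op} (i : O' ≤ O) (a : Fn U O) (s : P.S O) :
    P.sRes i (a • s) = fnRes i a • P.sRes i s := by
  rw [smul_S, smul_S, map_mul, ← P.scal_res, P.toS_res]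

/-- The associated sheaf of rings, as a sheaf of modules over the smooth functions. -/
def sh : Sh U where
  val :=
    letI : ∀ O, Module ((fnSheaf U).obj.obj O) (P.abPresheaf.obj O) := fun O => P.moduleS O.unop
    PresheafOfModules.ofPresheaf P.abPresheaf (fun {O O'} i a s =>
      P.sRes_smul (leOfHom i.unop) (show Fn U O.unop from a) (show P.S O.unop from s))
  isSheaf := P.isSheaf_abPresheaf

/-- A section of the associated sheaf of rings, as a section of the sheaf of modules. -/
def toSec {O : U.Op} (s : P.S O) : Sec P.sh O := s

/-- A section of the sheaf of modules, as an element of the ring of sections. -/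
def ofSec {O : U.Op} (s : Sec P.sh O) : P.S O := s

/-- The canonical map to the associated sheaf. -/
def unit {O : U.Op} (p : P.carrier O) : Sec P.sh O := P.toSec (P.toS O p)

lemma unit_add {O : U.Op} (p q : P.carrier O) : P.unit (p + q) = P.unit p + P.unit q :=
  map_add (P.toS O) p q

lemma unit_smul {O : U.Op} (a : Fn U O) (p : P.carrier O) :
    P.unit (P.scal O a * p) = a • P.unit p := map_mul (P.toS O) _ p

lemma unit_res {O O' : U.Op} (i : O' ≤ O) (p : P.carrier O) :
    P.unit (P.restr i p) = res i (P.unit p) := P.toS_res i p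

/-- Local surjectivity of the canonical map. -/
lemma exists_unit_eq {O : U.Op} (s : Sec P.sh O) {x : U.space} (hx : x ∈ O) :
    ∃ (O' : U.Op) (i : O' ≤ O), x ∈ O' ∧ ∃ p, res i s = P.unit p := by
  obtain ⟨O', i, hx', p, hp⟩ := P.toS_locally_surjective s hx
  exact ⟨O', i, hx', p, hp.symm⟩

/-- To verify an equation of two local expressions in a section of the associated sheaf, it suffices
to verify it on sections of the presheaf. -/
lemma eq_of_unit {X : Sh U} (f g : ∀ O, Sec P.sh O → Sec X O)
    (hf : ∀ {O O' : U.Op} (i : O' ≤ O) s, f O' (res i s) = res i (f O s))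
    (hg : ∀ {O O' : U.Op} (i : O' ≤ O) s, g O' (res i s) = res i (g O s))
    (e : ∀ O p, f O (P.unit (O := O) p) = g O (P.unit p)) {O : U.Op} (s : Sec P.sh O) :
    f O s = g O s := by
  refine sec_ext _ _ fun x hx => ?_
  obtain ⟨O', i, hx', p, hp⟩ := P.exists_unit_eq s hx
  exact ⟨O', i, hx', by rw [← hf, ← hg, hp, e]⟩

/-- The version of `eq_of_unit` for expressions in two sections. -/
lemma eq_of_unit₂ {X : Sh U} (f g : ∀ O, Sec P.sh O → Sec P.sh O → Sec X O)
    (hf : ∀ {O O' : U.Op} (i : O' ≤ O) s t,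
      f O' (res i s) (res i t) = res i (f O s t))
    (hg : ∀ {O O' : U.Op} (i : O' ≤ O) s t,
      g O' (res i s) (res i t) = res i (g O s t))
    (e : ∀ O p q, f O (P.unit p) (P.unit q) = g O (P.unit p) (P.unit q)) {O : U.Op}
    (s t : Sec P.sh O) : f O s t = g O s t := by
  refine sec_ext _ _ fun x hx => ?_
  obtain ⟨O', i, hx', p, hp⟩ := P.exists_unit_eq s hx
  obtain ⟨O'', j, hx'', q, hq⟩ := P.exists_unit_eq (res i t) hx'
  refine ⟨O'', j.trans i, hx'', ?_⟩
  rw [← hf, ← hg, ← res_res i j s, ← res_res i j t, hp, hq, ← P.unit_res, e]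

/-- Morphisms out of the associated sheaf agree as soon as they agree on sections of the presheaf. -/
lemma hom_ext_unit {X : Sh U} {f g : P.sh ⟶ X}
    (e : ∀ O (p : P.carrier O), app f O (P.unit p) = app g O (P.unit p)) : f = g :=
  hom_ext fun O s => P.eq_of_unit (fun O => app f O) (fun O => app g O) (fun i s => app_res f i s)
    (fun i s => app_res g i s) e s

lemma exists_lift {X : Sh U} (f : ∀ O, P.carrier O → Sec X O)
    (hf : ∀ {O O' : U.Op} (i : O' ≤ O) (p : P.carrier O), f O' (P.restr i p) = res i (f O p)) :
    ∃ g : ∀ O, Sec P.sh O → Sec X O, (∀ {O O' : U.Op} (i : O' ≤ O) s,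
      g O' (res i s) = res i (g O s)) ∧ ∀ O p, g O (P.unit p) = f O p :=
  P.exists_lift_S f hf

/-- Natural families of linear maps from the presheaf to a sheaf extend to the associated sheaf. -/
lemma exists_hom {X : Sh U} (f : ∀ O, P.carrier O → Sec X O)
    (hf : ∀ {O O' : U.Op} (i : O' ≤ O) (p : P.carrier O), f O' (P.restr i p) = res i (f O p))
    (add : ∀ O p q, f O (p + q) = f O p + f O q)
    (smul : ∀ O (a : Fn U O) p, f O (P.scal O a * p) = a • f O p) :
    ∃ g : P.sh ⟶ X, ∀ O p, app g O (P.unit p) = f O p := by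
  obtain ⟨g, hg, hgf⟩ := P.exists_lift f hf
  refine ⟨homMk (fun O =>
    { toFun := g O
      map_add' := fun s t => ?_
      map_smul' := fun a s => ?_ }) hg, hgf⟩
  · refine P.eq_of_unit₂ (fun O s t => g O (s + t)) (fun O s t => g O s + g O t) ?_ ?_ ?_ s t
    · intro O O' i s t
      rw [← map_add, hg]
    · intro O O' i s t
      rw [hg, hg, map_add]
    · intro O p q
      rw [← P.unit_add, hgf, hgf, hgf, add]
  · refine sec_ext _ _ fun x hx => ?_
    obtain ⟨O', i, hx', p, hp⟩ := P.exists_unit_eq s hx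
    refine ⟨O', i, hx', ?_⟩
    rw [RingHom.id_apply, ← hg, res_smul, res_smul, ← hg, hp, ← P.unit_smul, hgf, hgf, smul]

/-- The multiplication of the associated sheaf. -/
def mulS : Bilin P.sh P.sh P.sh :=
  Bilin.mk' (fun _ s t => P.toSec (P.ofSec s * P.ofSec t))
    (fun _ s s' t => add_mul (P.ofSec s) (P.ofSec s') (P.ofSec t))
    (fun O a s t => mul_assoc (P.toS O (P.scal O a)) (P.ofSec s) (P.ofSec t))
    (fun _ s t t' => mul_add (P.ofSec s) (P.ofSec t) (P.ofSec t'))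
    (fun O a s t => by
      -- Scalars are central in the presheaf, hence locally, hence in the associated sheaf.
      have e : P.toSec (P.ofSec s * P.toS O (P.scal O a)) = a • s := by
        refine sec_ext _ _ fun x hx => ?_
        obtain ⟨O', i, hx', p, hp⟩ := P.exists_unit_eq s hx
        refine ⟨O', i, hx', ?_⟩
        refine (map_mul (P.sRes i) (P.ofSec s) _).trans (Eq.trans ?_ (res_smul i a s).symm)
        rw [hp, ← P.toS_res, P.scal_res, ← P.unit_smul, P.scal_comm]
        exact (congrArg (fun z => P.ofSec z * P.toS O' (P.scal O' (fnRes i a))) hp).trans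
          (map_mul (P.toS O') p _).symm
      have e' := congrArg (fun z => P.toSec (P.ofSec z * P.ofSec t)) e
      exact (mul_assoc (P.ofSec s) _ (P.ofSec t)).symm.trans (e'.trans
        (mul_assoc (P.toS O (P.scal O a)) (P.ofSec s) (P.ofSec t))))
    (fun i s t => (map_mul (P.sRes i) (P.ofSec s) (P.ofSec t)).symm)

lemma mulS_unit {O : U.Op} (p q : P.carrier O) :
    P.mulS.toFun O (P.unit p) (P.unit q) = P.unit (p * q) := (map_mul (P.toS O) p q).symm

lemma mulS_assoc {O : U.Op} (a b c : Sec P.sh O) :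
    P.mulS.toFun O (P.mulS.toFun O a b) c = P.mulS.toFun O a (P.mulS.toFun O b c) :=
  mul_assoc (P.ofSec a) (P.ofSec b) (P.ofSec c)

lemma mulS_one_left {O : U.Op} (a : Sec P.sh O) : P.mulS.toFun O (P.unit 1) a = a :=
  (congrArg (· * P.ofSec a) (map_one (P.toS O))).trans (one_mul (P.ofSec a))

lemma mulS_one_right {O : U.Op} (a : Sec P.sh O) : P.mulS.toFun O a (P.unit 1) = a :=
  (congrArg (P.ofSec a * ·) (map_one (P.toS O))).trans (mul_one (P.ofSec a))

lemma exists_star : ∃ g : P.sh ⟶ (conj U).obj P.sh,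
    ∀ O (p : P.carrier O), appConj g (P.unit p) = P.unit (P.st p) :=
  P.exists_hom (X := (conj U).obj P.sh) (fun _ p => P.unit (P.st p))
    (fun i p => (congrArg P.unit (P.st_res i p)).trans (P.unit_res i _))
    (fun _ p q => (congrArg P.unit (map_add P.st p q)).trans (P.unit_add _ _))
    (fun O a p => by
      rw [P.st_mul, P.st_scal, ← P.scal_comm]
      exact P.unit_smul (fnConj O a) (P.st p))

/-- The involution of the associated sheaf. -/
def starS : P.sh ⟶ (conj U).obj P.sh := P.exists_star.choose

lemma starS_unit {O : U.Op} (p : P.carrier O) :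
    appConj P.starS (P.unit p) = P.unit (P.st p) := P.exists_star.choose_spec O p

lemma st_one {O : U.Op} : P.st (1 : P.carrier O) = 1 := by
  rw [← map_one (P.scal O), P.st_scal, map_one]

lemma unit_one_res {O O' : U.Op} (i : O' ≤ O) :
    res i (P.unit (1 : P.carrier O)) = P.unit 1 := by
  rw [← P.unit_res, map_one]

/-- The unit section of the associated sheaf. -/
def oneS : unitSh U ⟶ P.sh := unitLift (fun _ => P.unit 1) P.unit_one_res

lemma app_oneS {O : U.Op} : app P.oneS O (fn 1) = P.unit 1 :=
  one_smul (Fn U O) (P.unit (1 : P.carrier O))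

/-- The sheaf of `*`-algebras associated to a presheaf of `*`-algebras. -/
abbrev sheafification : StarAlg U where
  A :=
    { obj := P.sh
      star := P.starS
      star_star := fun {O} s => by
        refine P.eq_of_unit (fun O s => appConj P.starS (appConj P.starS s)) (fun _ s => s) ?_ ?_ ?_ s
        · intro O O' i s
          rw [appConj_res, appConj_res]
        · intro O O' i s
          rfl
        · intro O p
          rw [starS_unit, starS_unit, P.st_st] }
  mul := tensorLift P.mulS
  one := P.oneS
  mul_assoc a b c := by
    simp only [app_tensorLift, mulS_assoc]
  one_mul a := by rw [app_oneS, app_tensorLift, mulS_one_left]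
  mul_one a := by rw [app_oneS, app_tensorLift, mulS_one_right]
  star_mul {O} a b := by
    change appConj P.starS (app (tensorLift P.mulS) O (tmul a b)) =
      app (tensorLift P.mulS) O (tmul (appConj P.starS b) (appConj P.starS a))
    rw [app_tensorLift, app_tensorLift]
    refine P.eq_of_unit₂ (fun O s t => appConj P.starS (P.mulS.toFun O s t))
      (fun O s t => P.mulS.toFun O (appConj P.starS t) (appConj P.starS s)) ?_ ?_ ?_ a b
    · intro O O' i s t
      rw [P.mulS.map_res, appConj_res]
    · intro O O' i s t
      rw [appConj_res, appConj_res, P.mulS.map_res]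
    · intro O p q
      rw [mulS_unit, starS_unit, starS_unit, starS_unit, mulS_unit, P.st_mul]
  star_one {O} := by
    rw [app_oneS]
    exact P.starS_unit 1 |>.trans (by rw [P.st_one])

lemma sheafification_mul {O : U.Op} (p q : P.carrier O) :
    app P.sheafification.mul O (tmul (P.unit p) (P.unit q)) = P.unit (p * q) :=
  (app_tensorLift _ _ _).trans (P.mulS_unit p q)

lemma sheafification_one {O : U.Op} : app P.sheafification.one O (fn 1) = P.unit 1 := P.app_oneS

lemma sheafification_st {O : U.Op} (p : P.carrier O) :
    P.sheafification.A.st (P.unit p) = P.unit (P.st p) := P.starS_unit p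

/-- Natural families of `*`-homomorphisms from the presheaf to a sheaf of `*`-algebras extend to the
associated sheaf. -/
lemma exists_algHom {B : StarAlg U} (f : ∀ O, P.carrier O → Sec B.A.obj O)
    (hf : ∀ {O O' : U.Op} (i : O' ≤ O) (p : P.carrier O), f O' (P.restr i p) = res i (f O p))
    (add : ∀ O p q, f O (p + q) = f O p + f O q)
    (scal : ∀ O (a : Fn U O), f O (P.scal O a) = a • app B.one O (fn 1))
    (mul : ∀ O p q, f O (p * q) = app B.mul O (tmul (f O p) (f O q)))
    (star : ∀ O p, f O (P.st p) = B.A.st (f O p)) :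
    ∃ g : P.sheafification ⟶ B, ∀ O p,
      app (StarObj.hom (StarAlg.Hom.hom g)) O (P.unit p) = f O p := by
  obtain ⟨g, hg⟩ := P.exists_hom f hf add (fun O a p => by
    rw [mul, scal, smul_tmul, map_smul, B.one_mul])
  refine ⟨StarAlg.mkHom (A := P.sheafification) (B := B)
    (StarObj.mkHom (V := P.sheafification.A) (W := B.A) g fun {O} s => ?_) ?_ ?_, hg⟩
  · refine P.eq_of_unit (fun O s => app g O (P.sheafification.A.st s))
      (fun O s => B.A.st (app g O s)) ?_ ?_ ?_ s
    · intro O O' i s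
      exact (congrArg (app g O') (StarObj.st_res P.sheafification.A i s)).trans (app_res g i _)
    · intro O O' i s
      rw [app_res, StarObj.st_res]
    · intro O p
      rw [sheafification_st, hg, hg, star]
  · refine tensor_ext fun O s t => ?_
    rw [app_comp, app_comp, app_tensorMap]
    refine P.eq_of_unit₂ (fun O s t => app g O (app P.sheafification.mul O (tmul s t)))
      (fun O s t => app B.mul O (tmul (app g O s) (app g O t))) ?_ ?_ ?_ s t
    · intro O O' i s t
      rw [tmul_res, app_res]
      exact app_res g i _
    · intro O O' i s t
      rw [app_res, app_res, tmul_res, app_res]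
    · intro O p q
      rw [sheafification_mul, hg, hg, hg, mul]
  · refine unit_ext fun O => ?_
    refine (congrArg (app g O) P.sheafification_one).trans ((hg O 1).trans ?_)
    rw [← map_one (P.scal O), scal, one_smul]

end PreStarAlg

namespace StarAlg

/-- The map on sections underlying a morphism of `*`-algebras. -/
abbrev ap {U : Man} {A B : StarAlg U} (f : A ⟶ B) {O : U.Op} (a : Sec A.A.obj O) : Sec B.A.obj O :=
  app (StarObj.hom (Hom.hom f)) O a

end StarAlg

/-! ### The free order-reversing `*`-monoid -/

section TensorAlgebraLift
variable {R M B : Type*} [CommRing R] [AddCommGroup M] [Module R M] [Ring B]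

/-- The ring homomorphism out of the tensor algebra that is given by a central ring homomorphism on
scalars and a semilinear map on generators. -/
def liftRing (j : R →+* B) (hj : ∀ r b, j r * b = b * j r) (f : M →+ B)
    (hf : ∀ r m, f (r • m) = j r * f m) : TensorAlgebra R M →+* B :=
  letI := j.toAlgebra' hj
  (TensorAlgebra.lift R { f with map_smul' := hf }).toRingHom

variable (j : R →+* B) (hj : ∀ r b, j r * b = b * j r) (f : M →+ B)
    (hf : ∀ r m, f (r • m) = j r * f m)

lemma liftRing_ι (m : M) : liftRing j hj f hf (TensorAlgebra.ι R m) = f m :=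
  letI := j.toAlgebra' hj
  TensorAlgebra.lift_ι_apply { f with map_smul' := hf } m

lemma liftRing_algebraMap (r : R) : liftRing j hj f hf (algebraMap R _ r) = j r :=
  letI := j.toAlgebra' hj
  (TensorAlgebra.lift R ({ f with map_smul' := hf } : M →ₗ[R] B)).commutes r

lemma tensorAlgebra_ringHom_ext {f g : TensorAlgebra R M →+* B}
    (hs : ∀ r, f (algebraMap R _ r) = g (algebraMap R _ r))
    (hι : ∀ m, f (TensorAlgebra.ι R m) = g (TensorAlgebra.ι R m)) : f = g := by
  ext t
  induction t using TensorAlgebra.induction with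
  | algebraMap r => exact hs r
  | ι m => exact hι m
  | mul a b ha hb => rw [map_mul, map_mul, ha, hb]
  | add a b ha hb => rw [map_add, map_add, ha, hb]

/-- Induction over the tensor algebra by multiplication with generators from the left. -/
lemma tensorAlgebra_left_induction {C : TensorAlgebra R M → Prop} (one : C 1)
    (smul : ∀ (r : R) t, C t → C (r • t)) (add : ∀ s t, C s → C t → C (s + t))
    (ι_mul : ∀ m t, C t → C (TensorAlgebra.ι R m * t)) (t : TensorAlgebra R M) : C t := by
  suffices ∀ s, C s → C (t * s) by simpa using this 1 one
  induction t using TensorAlgebra.induction with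
  | algebraMap r => intro s hs; rw [← Algebra.smul_def]; exact smul r s hs
  | ι m => exact ι_mul m
  | mul a b ha hb => intro s hs; rw [mul_assoc]; exact ha _ (hb _ hs)
  | add a b ha hb => intro s hs; rw [add_mul]; exact add _ _ (ha _ hs) (hb _ hs)

variable {R' M' : Type*} [CommRing R'] [AddCommGroup M'] [Module R' M']

/-- The ring homomorphism between tensor algebras that is induced by a semilinear map. -/
def tensorAlgebraMap (σ : R →+* R') (f : M →+ M') (hf : ∀ r m, f (r • m) = σ r • f m) :
    TensorAlgebra R M →+* TensorAlgebra R' M' :=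
  liftRing ((algebraMap R' (TensorAlgebra R' M')).comp σ) (fun r b => Algebra.commutes (σ r) b)
    ((TensorAlgebra.ι R').toAddMonoidHom.comp f)
    (fun r m => by
      change TensorAlgebra.ι R' (f (r • m)) =
        algebraMap R' (TensorAlgebra R' M') (σ r) * TensorAlgebra.ι R' (f m)
      rw [hf, map_smul, Algebra.smul_def])

/-- The reversed ring homomorphism between tensor algebras that is induced by a semilinear map. -/
def tensorAlgebraMapOp (σ : R →+* R') (f : M →+ M') (hf : ∀ r m, f (r • m) = σ r • f m) :
    TensorAlgebra R M →+* (TensorAlgebra R' M')ᵐᵒᵖ :=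
  liftRing ((algebraMap R' (TensorAlgebra R' M')ᵐᵒᵖ).comp σ) (fun r b => Algebra.commutes (σ r) b)
    (MulOpposite.opAddEquiv.toAddMonoidHom.comp ((TensorAlgebra.ι R').toAddMonoidHom.comp f))
    (fun r m => by
      change MulOpposite.op (TensorAlgebra.ι R' (f (r • m))) =
        algebraMap R' (TensorAlgebra R' M')ᵐᵒᵖ (σ r) * MulOpposite.op (TensorAlgebra.ι R' (f m))
      rw [hf, map_smul, MulOpposite.op_smul, Algebra.smul_def])

variable (σ : R →+* R') (k : M →+ M') (hk : ∀ r m, k (r • m) = σ r • k m)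

lemma tensorAlgebraMap_ι (m : M) :
    tensorAlgebraMap σ k hk (TensorAlgebra.ι R m) = TensorAlgebra.ι R' (k m) :=
  liftRing_ι _ _ _ _ m

lemma tensorAlgebraMap_algebraMap (r : R) :
    tensorAlgebraMap σ k hk (algebraMap R _ r) = algebraMap R' _ (σ r) :=
  liftRing_algebraMap _ _ _ _ r

lemma tensorAlgebraMapOp_ι (m : M) :
    tensorAlgebraMapOp σ k hk (TensorAlgebra.ι R m) = MulOpposite.op (TensorAlgebra.ι R' (k m)) :=
  liftRing_ι _ _ _ _ m

lemma tensorAlgebraMapOp_algebraMap (r : R) :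
    tensorAlgebraMapOp σ k hk (algebraMap R _ r) = MulOpposite.op (algebraMap R' _ (σ r)) :=
  liftRing_algebraMap _ _ _ _ r

end TensorAlgebraLift

variable {U : Man}

namespace StarAlg

/-- The ring of sections of a sheaf of `*`-algebras. -/
def SecRing (B : StarAlg U) (O : U.Op) : Type := Sec B.A.obj O

instance (B : StarAlg U) (O : U.Op) : AddCommGroup (B.SecRing O) :=
  inferInstanceAs (AddCommGroup (Sec B.A.obj O))

instance (B : StarAlg U) (O : U.Op) : Ring (B.SecRing O) :=
  { (inferInstance : AddCommGroup (B.SecRing O)) with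
    mul := fun a b => app B.mul O (tmul a b)
    one := app B.one O (fn 1)
    mul_assoc := B.mul_assoc
    one_mul := B.one_mul
    mul_one := B.mul_one
    left_distrib := fun a b c => (congrArg (app B.mul O) (tmul_add a b c)).trans (map_add _ _ _)
    right_distrib := fun a b c => (congrArg (app B.mul O) (add_tmul a b c)).trans (map_add _ _ _)
    zero_mul := fun a => (congrArg (app B.mul O) (zero_tmul a)).trans (map_zero _)
    mul_zero := fun a => (congrArg (app B.mul O) (tmul_zero a)).trans (map_zero _) }

/-- The structure homomorphism from the smooth functions to the ring of sections. -/
def secScal (B : StarAlg U) (O : U.Op) : Fn U O →+* B.SecRing O where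
  toFun a := (a • app B.one O (fn 1) : Sec B.A.obj O)
  map_one' := one_smul _ (app B.one O (fn 1))
  map_mul' a b := by
    change _ = app B.mul O (tmul (a • app B.one O (fn 1)) (b • app B.one O (fn 1)))
    rw [smul_tmul, map_smul, B.one_mul, mul_smul]
  map_zero' := zero_smul _ (app B.one O (fn 1))
  map_add' a b := add_smul a b (app B.one O (fn 1))

lemma secScal_mul (B : StarAlg U) {O : U.Op} (a : Fn U O) (b : Sec B.A.obj O) :
    app B.mul O (tmul (B.secScal O a : Sec B.A.obj O) b) = a • b := by
  change app B.mul O (tmul (a • app B.one O (fn 1)) b) = _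
  rw [smul_tmul, map_smul, B.one_mul]

lemma mul_secScal (B : StarAlg U) {O : U.Op} (a : Fn U O) (b : Sec B.A.obj O) :
    app B.mul O (tmul b (B.secScal O a : Sec B.A.obj O)) = a • b := by
  change app B.mul O (tmul b (a • app B.one O (fn 1))) = _
  rw [tmul_smul, map_smul, B.mul_one]

lemma one_res (B : StarAlg U) {O O' : U.Op} (i : O' ≤ O) :
    res i (app B.one O (fn 1)) = app B.one O' (fn 1) := by
  rw [← app_res, res_fn, map_one]

lemma mul_res (B : StarAlg U) {O O' : U.Op} (i : O' ≤ O) (a b : Sec B.A.obj O) :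
    res i (app B.mul O (tmul a b)) = app B.mul O' (tmul (res i a) (res i b)) := by
  rw [tmul_res, app_res]

/-- Restriction of sections, as a ring homomorphism. -/
def secRes (B : StarAlg U) {O O' : U.Op} (i : O' ≤ O) : B.SecRing O →+* B.SecRing O' where
  toFun a := res (V := B.A.obj) i a
  map_one' := B.one_res i
  map_mul' := B.mul_res i
  map_zero' := map_zero (res (V := B.A.obj) i)
  map_add' := map_add (res (V := B.A.obj) i)

/-- The involution on sections, as a ring homomorphism to the opposite ring. -/
def secStar (B : StarAlg U) (O : U.Op) : B.SecRing O →+* (B.SecRing O)ᵐᵒᵖ where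
  toFun a := MulOpposite.op (B.A.st (O := O) a)
  map_one' := congrArg MulOpposite.op B.star_one
  map_mul' a b := congrArg MulOpposite.op (B.star_mul (O := O) a b)
  map_zero' := congrArg MulOpposite.op (map_zero (B.A.st (O := O)))
  map_add' a b := congrArg MulOpposite.op (map_add (B.A.st (O := O)) a b)

lemma ap_mul {A B : StarAlg U} (f : A ⟶ B) {O : U.Op} (a b : Sec A.A.obj O) :
    ap f (app A.mul O (tmul a b)) = app B.mul O (tmul (ap f a) (ap f b)) := by
  have := congrArg (fun k => app k O (tmul a b)) (Hom.map_mul f)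
  refine Eq.trans this ?_
  rw [app_comp, app_tensorMap]

lemma ap_one {A B : StarAlg U} (f : A ⟶ B) (O : U.Op) :
    ap f (app A.one O (fn 1)) = app B.one O (fn 1) :=
  congrArg (fun k => app k O (fn 1)) (Hom.map_one f)

/-- A morphism of `*`-algebras on sections, as a ring homomorphism. -/
def secMap {A B : StarAlg U} (f : A ⟶ B) (O : U.Op) : A.SecRing O →+* B.SecRing O where
  toFun a := ap f (O := O) a
  map_one' := ap_one f O
  map_mul' := ap_mul f
  map_zero' := map_zero (app (StarObj.hom (Hom.hom f)) O)
  map_add' := map_add (app (StarObj.hom (Hom.hom f)) O)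

lemma secMap_secScal {A B : StarAlg U} (f : A ⟶ B) {O : U.Op} (a : Fn U O) :
    secMap f O (A.secScal O a) = B.secScal O a :=
  ((app (StarObj.hom (Hom.hom f)) O).map_smul a (app A.one O (fn 1))).trans
    (congrArg (a • ·) (ap_one f O))

end StarAlg

namespace PreStarAlg

/-- The canonical map to the associated sheaf, as a ring homomorphism. -/
def unitRing (P : PreStarAlg U) (O : U.Op) : P.carrier O →+* P.sheafification.SecRing O where
  toFun p := P.unit p
  map_one' := P.sheafification_one.symm
  map_mul' p q := (P.sheafification_mul p q).symm
  map_zero' := map_zero (P.toS O)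
  map_add' := P.unit_add

lemma unitRing_scal (P : PreStarAlg U) {O : U.Op} (a : Fn U O) :
    P.unitRing O (P.scal O a) = P.sheafification.secScal O a := by
  have h := P.unit_smul a 1
  rw [mul_one, ← P.sheafification_one] at h
  exact h

end PreStarAlg

section
variable (V : StarObj U)

/-- The tensor algebra of the module of sections over `O`. -/
abbrev TA (O : U.Op) : Type := TensorAlgebra (Fn U O) (Sec V.obj O)

/-- A section as a generator of the tensor algebra. -/
def taι {O : U.Op} : Sec V.obj O →ₗ[Fn U O] TA V O := TensorAlgebra.ι (Fn U O)

/-- Restriction of tensor algebras. -/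
def taRes {O O' : U.Op} (i : O' ≤ O) : TA V O →+* TA V O' :=
  tensorAlgebraMap (fnRes i) (res i) (res_smul i)

/-- The involution of the tensor algebra, as a ring homomorphism to the opposite ring. -/
def taStar (O : U.Op) : TA V O →+* (TA V O)ᵐᵒᵖ :=
  tensorAlgebraMapOp (fnConj O) V.st V.st_smul

variable {V} {O O' : U.Op}

lemma ta_ext {B : Type*} [Ring B] {f g : TA V O →+* B}
    (hs : ∀ r, f (algebraMap (Fn U O) _ r) = g (algebraMap (Fn U O) _ r))
    (hι : ∀ m, f (taι V m) = g (taι V m)) (p : TA V O) : f p = g p :=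
  RingHom.congr_fun (tensorAlgebra_ringHom_ext hs hι) p

lemma taRes_ι (i : O' ≤ O) (v : Sec V.obj O) : taRes V i (taι V v) = taι V (res i v) :=
  tensorAlgebraMap_ι (fnRes i) (res i) (res_smul i) v

lemma taRes_algebraMap (i : O' ≤ O) (a : Fn U O) :
    taRes V i (algebraMap _ _ a) = algebraMap _ _ (fnRes i a) :=
  tensorAlgebraMap_algebraMap (fnRes i) (res i) (res_smul i) a

lemma taStar_ι (v : Sec V.obj O) : taStar V O (taι V v) = MulOpposite.op (taι V (V.st v)) :=
  tensorAlgebraMapOp_ι (fnConj O) V.st V.st_smul v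

lemma taStar_algebraMap (a : Fn U O) :
    taStar V O (algebraMap _ _ a) = MulOpposite.op (algebraMap _ _ (fnConj O a)) :=
  tensorAlgebraMapOp_algebraMap (fnConj O) V.st V.st_smul a

lemma fnConj_fnConj (a : Fn U O) : fnConj O (fnConj O a) = a :=
  ContMDiffMap.ext fun x => star_star (a x)

variable (V)

/-- The presheaf `O ↦ T(V(O))` of tensor algebras, with `(v₁ ⋯ vₙ)^* = vₙ^* ⋯ v₁^*`. -/
abbrev tensorAlgebraPre : PreStarAlg U where
  carrier O := TA V O
  restr i := taRes V i
  restr_self p := ta_ext (g := RingHom.id _) (fun r => taRes_algebraMap _ r)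
    (fun v => (taRes_ι _ v).trans (congrArg (taι V) (res_self v))) p
  restr_restr i j p := ta_ext (f := (taRes V j).comp (taRes V i)) (g := taRes V (j.trans i))
    (fun r => by
      rw [RingHom.comp_apply, taRes_algebraMap, taRes_algebraMap, taRes_algebraMap, fnRes_fnRes])
    (fun v => by rw [RingHom.comp_apply, taRes_ι, taRes_ι, taRes_ι, res_res]) p
  scal O := algebraMap _ _
  scal_res i a := taRes_algebraMap i a
  scal_comm a p := Algebra.commutes a p
  st {O} := (MulOpposite.opAddEquiv.symm.toAddMonoidHom).comp (taStar V O).toAddMonoidHom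
  st_st {O} p := ta_ext (f := (RingEquiv.opOp (TA V O)).symm.toRingHom.comp
      ((RingHom.op (taStar V O)).comp (taStar V O))) (g := RingHom.id _)
    (fun r => by
      change ((taStar V O) ((taStar V O) (algebraMap _ _ r)).unop).unop = algebraMap _ _ r
      rw [taStar_algebraMap, MulOpposite.unop_op, taStar_algebraMap, MulOpposite.unop_op,
        fnConj_fnConj])
    (fun v => by
      change ((taStar V O) ((taStar V O) (taι V v)).unop).unop = taι V v
      rw [taStar_ι, MulOpposite.unop_op, taStar_ι, MulOpposite.unop_op, StarObj.st_st]) p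
  st_mul {O} p q := congrArg MulOpposite.unop (map_mul (taStar V O) p q)
  st_scal a := congrArg MulOpposite.unop (taStar_algebraMap a)
  st_res {O O'} i p := congrArg MulOpposite.unop (ta_ext (f := (taStar V O').comp (taRes V i))
    (g := (RingHom.op (taRes V i)).comp (taStar V O))
    (fun r => by
      rw [RingHom.comp_apply, RingHom.comp_apply, taRes_algebraMap, taStar_algebraMap,
        taStar_algebraMap]
      exact congrArg MulOpposite.op (taRes_algebraMap i (fnConj O r)).symm)
    (fun v => by
      rw [RingHom.comp_apply, RingHom.comp_apply, taRes_ι, taStar_ι, taStar_ι, StarObj.st_res]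
      exact congrArg MulOpposite.op (taRes_ι i _).symm) p)

lemma tensorAlgebraPre_st_ι (v : Sec V.obj O) :
    (tensorAlgebraPre V).st (taι V v) = taι V (V.st v) := congrArg MulOpposite.unop (taStar_ι v)

/-- The free order-reversing `*`-monoid. -/
abbrev free : StarAlg U := (tensorAlgebraPre V).sheafification

/-- The inclusion of the generators. -/
def freeι : V ⟶ (StarAlg.forget U).obj (free V) :=
  StarObj.mkHom (V := V) (W := (free V).A)
    (homMk (W := (tensorAlgebraPre V).sh) (fun O =>
      { toFun := fun v => (tensorAlgebraPre V).unit (taι V v)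
        map_add' := fun v w => by rw [map_add, PreStarAlg.unit_add]
        map_smul' := fun a v => by
          rw [map_smul, Algebra.smul_def]
          exact (tensorAlgebraPre V).unit_smul a _ })
      (fun i v => by
        refine Eq.trans ?_ ((tensorAlgebraPre V).unit_res i _)
        exact congrArg (tensorAlgebraPre V).unit (taRes_ι i v).symm))
    (fun {O} v => by
      refine Eq.trans ?_ ((tensorAlgebraPre V).sheafification_st _).symm
      exact congrArg (tensorAlgebraPre V).unit (tensorAlgebraPre_st_ι V v).symm)

variable {V} {B : StarAlg U}

/-- The extension of a linear map to the tensor algebra of the module of sections. -/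
def taLift (k : V ⟶ B.A) (O : U.Op) : TA V O →+* B.SecRing O :=
  liftRing (B.secScal O)
    (fun r (b : Sec B.A.obj O) => (B.secScal_mul r b).trans (B.mul_secScal r b).symm)
    (app (StarObj.hom k) O).toAddMonoidHom
    (fun r m => ((app (StarObj.hom k) O).map_smul r m).trans (B.secScal_mul r _).symm)

lemma taLift_ι (k : V ⟶ B.A) (v : Sec V.obj O) :
    taLift k O (taι V v) = app (StarObj.hom k) O v := liftRing_ι _ _ _ _ v

lemma taLift_algebraMap (k : V ⟶ B.A) (a : Fn U O) :
    taLift k O (algebraMap _ _ a) = B.secScal O a := liftRing_algebraMap _ _ _ _ a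

lemma taLift_res (k : V ⟶ B.A) (i : O' ≤ O) (p : TA V O) :
    taLift k O' (taRes V i p) = B.secRes i (taLift k O p) :=
  ta_ext (f := (taLift k O').comp (taRes V i)) (g := (B.secRes i).comp (taLift k O))
    (fun r => by
      rw [RingHom.comp_apply, RingHom.comp_apply, taRes_algebraMap, taLift_algebraMap,
        taLift_algebraMap]
      refine Eq.trans ?_ (res_smul i r (app B.one O (fn 1))).symm
      rw [B.one_res]
      rfl)
    (fun v => by
      rw [RingHom.comp_apply, RingHom.comp_apply, taRes_ι, taLift_ι, taLift_ι, app_res]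
      rfl) p

lemma taLift_star (k : V ⟶ B.A) (p : TA V O) :
    MulOpposite.op (taLift k O (taStar V O p).unop) = B.secStar O (taLift k O p) :=
  ta_ext (f := (RingHom.op (taLift k O)).comp (taStar V O)) (g := (B.secStar O).comp (taLift k O))
    (fun r => by
      rw [RingHom.comp_apply, RingHom.comp_apply, taStar_algebraMap, taLift_algebraMap]
      refine (congrArg MulOpposite.op (taLift_algebraMap k (fnConj O r))).trans ?_
      exact congrArg MulOpposite.op ((B.A.st_smul r (app B.one O (fn 1))).trans
        (congrArg (fnConj O r • ·) B.star_one)).symm)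
    (fun v => by
      rw [RingHom.comp_apply, RingHom.comp_apply, taStar_ι, taLift_ι]
      refine (congrArg MulOpposite.op (taLift_ι k (V.st v))).trans ?_
      exact congrArg MulOpposite.op (StarObj.map_st k v)) p

/-- The existence part of the universal property of the free order-reversing `*`-monoid. -/
lemma exists_freeLift (k : V ⟶ B.A) :
    ∃ f : free V ⟶ B, freeι V ≫ (StarAlg.forget U).map f = k := by
  obtain ⟨f, hf⟩ := (tensorAlgebraPre V).exists_algHom (B := B) (fun O p => taLift k O p)
    (fun i p => taLift_res k i p) (fun O p q => map_add (taLift k O) p q)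
    (fun O a => taLift_algebraMap k a) (fun O p q => map_mul (taLift k O) p q)
    (fun O p => MulOpposite.op_injective (taLift_star k p))
  refine ⟨f, StarObj.ext (hom_ext fun O v => ?_)⟩
  exact (hf O (taι V v)).trans (taLift_ι k v)

/-- The uniqueness part of the universal property of the free order-reversing `*`-monoid. -/
lemma freeLift_unique {f g : free V ⟶ B}
    (e : freeι V ≫ (StarAlg.forget U).map f = freeι V ≫ (StarAlg.forget U).map g) : f = g := by
  refine StarAlg.ext (StarObj.ext ((tensorAlgebraPre V).hom_ext_unit fun O p => ?_))
  refine ta_ext (f := (StarAlg.secMap f O).comp ((tensorAlgebraPre V).unitRing O))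
    (g := (StarAlg.secMap g O).comp ((tensorAlgebraPre V).unitRing O)) (fun r => ?_)
    (fun v => congrArg (fun q : V ⟶ B.A => app (StarObj.hom q) O v) e) p
  rw [RingHom.comp_apply, RingHom.comp_apply]
  have e₁ : (tensorAlgebraPre V).unitRing O (algebraMap (Fn U O) (TA V O) r) =
      (free V).secScal O r := (tensorAlgebraPre V).unitRing_scal r
  rw [e₁, StarAlg.secMap_secScal, StarAlg.secMap_secScal]

variable (V B) in
/-- The universal property of the free order-reversing `*`-monoid. -/
def freeEquiv : (free V ⟶ B) ≃ (V ⟶ (StarAlg.forget U).obj B) :=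
  Equiv.ofBijective (fun f => freeι V ≫ (StarAlg.forget U).map f)
    ⟨fun _ _ e => freeLift_unique e, exists_freeLift⟩

variable (U) in
/-- The free order-reversing `*`-monoid functor. -/
def freeFunctor : StarObj U ⥤ StarAlg U :=
  Adjunction.leftAdjointOfEquiv (G := StarAlg.forget U) freeEquiv (fun _ _ _ _ _ => rfl)

variable (U) in
/-- The free order-reversing `*`-monoid functor is left adjoint to the forgetful functor. -/
def freeAdj : freeFunctor U ⊣ StarAlg.forget U :=
  Adjunction.adjunctionOfEquivLeft freeEquiv (fun _ _ _ _ _ => rfl)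

lemma freeAdj_unit : (freeAdj U).unit.app V = freeι V :=
  (Adjunction.homEquiv_id (freeAdj U) V).symm.trans (Category.comp_id (freeι V))

end

/-! ### The free `*`-monoid as the direct sum of the tensor powers -/

section
variable {U : Man}

/-- The generator of `V^{⊗0}`. -/
def tpowOne (V : Sh U) (O : U.Op) : Sec (tpow V 0) O := fn 1

/-- The tensor `v ⊗ t` in `V^{⊗(n + 1)}`. -/
def tpowCons {V : Sh U} {O : U.Op} {n : ℕ} (v : Sec V O) (t : Sec (tpow V n) O) :
    Sec (tpow V (n + 1)) O := tmul v t

lemma tpowOne_res (V : Sh U) {O O' : U.Op} (i : O' ≤ O) :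
    res i (tpowOne V O) = tpowOne V O' := rfl

lemma tpowCons_res {V : Sh U} {O O' : U.Op} (i : O' ≤ O) {n : ℕ} (v : Sec V O)
    (t : Sec (tpow V n) O) : tpowCons (res i v) (res i t) = res i (tpowCons v t) := tmul_res i v t

/-- Pure tensors `v₁ ⊗ (⋯ ⊗ (vₙ ⊗ 1))`. -/
inductive IsPure (V : Sh U) (O : U.Op) : ∀ n, Sec (tpow V n) O → Prop
  | one : IsPure V O 0 (tpowOne V O)
  | cons (n : ℕ) (v : Sec V O) (t : Sec (tpow V n) O) (ht : IsPure V O n t) :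
      IsPure V O (n + 1) (tpowCons v t)

lemma IsPure.res {V : Sh U} {O O' : U.Op} (i : O' ≤ O) {n : ℕ} {t : Sec (tpow V n) O}
    (ht : IsPure V O n t) : IsPure V O' n (res i t) := by
  induction ht with
  | one => exact IsPure.one
  | cons n v t ht ih =>
    have := IsPure.cons n (SmoothCAR.res i v) _ ih
    rwa [tpowCons_res] at this

/-- The partial evaluation `w ↦ f (v ⊗ w)` of a morphism at a section over `P`. -/
def evalTensor {V W X : Sh U} (f : tensor V W ⟶ X) {P : U.Op} (v : Sec V P) : W ⟶ shift X P :=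
  shiftMk P (fun O w => app f (O ⊓ P) (tmul (res inf_le_right v) (res inf_le_left w)))
    (fun O w w' => by rw [map_add, tmul_add, map_add])
    (fun O a w => by rw [res_smul, tmul_smul, map_smul])
    (fun i w => by rw [← app_res, ← tmul_res, res_res, res_res, res_res])

lemma evalTensor_res {V W X : Sh U} (f : tensor V W ⟶ X) {O : U.Op} (v : Sec V O)
    (w : Sec W O) : res (V := X) (show O ≤ O ⊓ O from le_inf le_rfl le_rfl)
      (appShift (evalTensor f v) w) = app f O (tmul v w) := by
  refine (app_res f _ _).symm.trans ?_
  rw [← tmul_res, res_res, res_res, res_self, res_self]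

/-- Morphisms out of a tensor power agree as soon as they agree on pure tensors. -/
lemma tpow_ext {V : Sh U} {n : ℕ} {X : Sh U} {f g : tpow V n ⟶ X}
    (e : ∀ O t, IsPure V O n t → app f O t = app g O t) : f = g := by
  induction n generalizing X with
  | zero => exact unit_ext fun O => e O _ IsPure.one
  | succ n ih =>
    refine tensor_ext fun O v w => ?_
    have h : evalTensor f v = evalTensor g v := ih fun O t ht =>
      e _ _ (IsPure.cons n _ _ (ht.res inf_le_left))
    have h' : appShift (evalTensor f v) w = appShift (evalTensor g v) w := by rw [h]
    have h'' := congrArg (res (V := X) (show O ≤ O ⊓ O from le_inf le_rfl le_rfl)) h'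
    exact (evalTensor_res f v w).symm.trans (h''.trans (evalTensor_res g v w))

/-- The module `⨁ₙ V^{⊗n}(O)`. -/
abbrev TSum (V : Sh U) (O : U.Op) : Type := DirectSum ℕ fun n => Sec (tpow V n) O

section
variable {V : Sh U} {O : U.Op}

/-- The operator `t ↦ v ⊗ t` on `⨁ₙ V^{⊗n}(O)`. -/
def tsumMul (V : Sh U) (O : U.Op) : Sec V O →ₗ[Fn U O] Module.End (Fn U O) (TSum V O) where
  toFun v := DirectSum.toModule (Fn U O) ℕ (TSum V O) fun n =>
    (DirectSum.lof (Fn U O) ℕ (fun n => Sec (tpow V n) O) (n + 1)).comp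
      ((tmulBilin V (tpow V n)).toFun O v)
  map_add' v w := DirectSum.linearMap_ext _ fun n => LinearMap.ext fun t => by
    simp only [LinearMap.comp_apply, DirectSum.toModule_lof, LinearMap.add_apply, map_add]
    exact map_add (DirectSum.lof (Fn U O) ℕ (fun n => Sec (tpow V n) O) (n + 1)) (tpowCons v t)
      (tpowCons w t)
  map_smul' a v := DirectSum.linearMap_ext _ fun n => LinearMap.ext fun t => by
    simp only [LinearMap.comp_apply, DirectSum.toModule_lof, LinearMap.smul_apply, map_smul,
      RingHom.id_apply]
    exact map_smul (DirectSum.lof (Fn U O) ℕ (fun n => Sec (tpow V n) O) (n + 1)) a (tpowCons v t)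

lemma tsumMul_lof (v : Sec V O) (n : ℕ) (t : Sec (tpow V n) O) :
    tsumMul V O v (DirectSum.lof (Fn U O) ℕ (fun n => Sec (tpow V n) O) n t) =
      DirectSum.lof (Fn U O) ℕ (fun n => Sec (tpow V n) O) (n + 1) (tpowCons v t) := by
  exact DirectSum.toModule_lof _ _ _

/-- The map `v₁ ⋯ vₙ ↦ v₁ ⊗ ⋯ ⊗ vₙ`, obtained by letting the tensor algebra act on
`1` by the operators `t ↦ v ⊗ t`. -/
def toTSum (V : Sh U) (O : U.Op) : TensorAlgebra (Fn U O) (Sec V O) →ₗ[Fn U O] TSum V O :=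
  (LinearMap.applyₗ (DirectSum.lof (Fn U O) ℕ (fun n => Sec (tpow V n) O) 0 (tpowOne V O))).comp
    (TensorAlgebra.lift (Fn U O) (tsumMul V O)).toLinearMap

lemma toTSum_one : toTSum V O 1 =
    DirectSum.lof (Fn U O) ℕ (fun n => Sec (tpow V n) O) 0 (tpowOne V O) := by
  simp [toTSum]

lemma toTSum_ι_mul (v : Sec V O) (p : TensorAlgebra (Fn U O) (Sec V O)) :
    toTSum V O (TensorAlgebra.ι (Fn U O) v * p) = tsumMul V O v (toTSum V O p) := by
  simp [toTSum]

/-- The map out of `⨁ₙ V^{⊗n}(O)` given by a family of morphisms. -/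
def tsumDesc {X : Sh U} (f : ∀ n, tpow V n ⟶ X) (O : U.Op) : TSum V O →ₗ[Fn U O] Sec X O :=
  DirectSum.toModule (Fn U O) ℕ (Sec X O) fun n => app (f n) O

lemma tsumDesc_lof {X : Sh U} (f : ∀ n, tpow V n ⟶ X) (n : ℕ) (t : Sec (tpow V n) O) :
    tsumDesc f O (DirectSum.lof (Fn U O) ℕ (fun n => Sec (tpow V n) O) n t) = app (f n) O t :=
  DirectSum.toModule_lof _ _ _

lemma tsum_induction {C : TSum V O → Prop} (zero : C 0) (add : ∀ s t, C s → C t → C (s + t))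
    (lof : ∀ n t, C (DirectSum.lof (Fn U O) ℕ (fun n => Sec (tpow V n) O) n t)) (t : TSum V O) :
    C t :=
  DirectSum.induction_on t zero lof add

/-- Restriction of `⨁ₙ V^{⊗n}(O)`. -/
def tsumRes {O O' : U.Op} (i : O' ≤ O) : TSum V O →+ TSum V O' :=
  DirectSum.map fun _ => res i

lemma tsumRes_lof {O O' : U.Op} (i : O' ≤ O) (n : ℕ) (t : Sec (tpow V n) O) :
    tsumRes i (DirectSum.lof (Fn U O) ℕ (fun n => Sec (tpow V n) O) n t) =
      DirectSum.lof (Fn U O') ℕ (fun n => Sec (tpow V n) O') n (res i t) :=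
  DirectSum.map_of _ _ _

lemma tsumRes_smul {O O' : U.Op} (i : O' ≤ O) (a : Fn U O) (t : TSum V O) :
    tsumRes i (a • t) = fnRes i a • tsumRes i t := by
  induction t using tsum_induction with
  | zero => rw [smul_zero, map_zero, smul_zero]
  | add s t hs ht => rw [smul_add, map_add, hs, ht, map_add, smul_add]
  | lof n t => rw [← map_smul, tsumRes_lof, tsumRes_lof, res_smul, map_smul]

lemma tsumRes_mul {O O' : U.Op} (i : O' ≤ O) (v : Sec V O) (t : TSum V O) :
    tsumRes i (tsumMul V O v t) = tsumMul V O' (res i v) (tsumRes i t) := by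
  induction t using tsum_induction with
  | zero => rw [map_zero, map_zero, map_zero]
  | add s t hs ht => rw [map_add, map_add, hs, ht, map_add, map_add]
  | lof n t => rw [tsumMul_lof, tsumRes_lof, tsumRes_lof, tsumMul_lof, tpowCons_res]

lemma tsumDesc_res {X : Sh U} (f : ∀ n, tpow V n ⟶ X) {O O' : U.Op} (i : O' ≤ O) (t : TSum V O) :
    tsumDesc f O' (tsumRes i t) = res i (tsumDesc f O t) := by
  induction t using tsum_induction with
  | zero => rw [map_zero, map_zero, map_zero, map_zero]
  | add s t hs ht => rw [map_add, map_add, hs, ht, map_add, map_add]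
  | lof n t => rw [tsumRes_lof, tsumDesc_lof, tsumDesc_lof, app_res]

lemma tsumDesc_comp {X Y : Sh U} (f : ∀ n, tpow V n ⟶ X) (g : X ⟶ Y) (t : TSum V O) :
    tsumDesc (fun n => f n ≫ g) O t = app g O (tsumDesc f O t) := by
  induction t using tsum_induction with
  | zero => rw [map_zero, map_zero, map_zero]
  | add s t hs ht => rw [map_add, map_add, hs, ht, map_add]
  | lof n t => rw [tsumDesc_lof, tsumDesc_lof, app_comp]

end

variable {V : StarObj U}

lemma toTSum_res {O O' : U.Op} (i : O' ≤ O) (p : TA V O) :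
    toTSum V.obj O' (taRes V i p) = tsumRes i (toTSum V.obj O p) := by
  induction p using tensorAlgebra_left_induction with
  | one => rw [map_one, toTSum_one, toTSum_one, tsumRes_lof, tpowOne_res]
  | smul r t h =>
    rw [Algebra.smul_def, map_mul, taRes_algebraMap, ← Algebra.smul_def, map_smul, h,
      ← Algebra.smul_def, map_smul, tsumRes_smul]
  | add s t hs ht => rw [map_add, map_add, hs, ht, map_add, map_add]
  | ι_mul v t h =>
    rw [toTSum_ι_mul, map_mul, tsumRes_mul, ← h]
    exact (congrArg (fun z => toTSum V.obj O' (z * taRes V i t)) (taRes_ι i v)).trans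
      (toTSum_ι_mul _ _)

lemma tsumDesc_mul {V : Sh U} (A : StarAlg U) (f : V ⟶ A.A.obj) {O : U.Op} (v : Sec V O)
    (d : TSum V O) : tsumDesc (tpowMap A f) O (tsumMul V O v d) =
      app A.mul O (tmul (app f O v) (tsumDesc (tpowMap A f) O d)) := by
  induction d using tsum_induction with
  | zero => rw [map_zero, map_zero, StarAlg.tmul_zero, map_zero]
  | add s t hs ht => rw [map_add, map_add, hs, ht, map_add, tmul_add, map_add]
  | lof n t =>
    rw [tsumMul_lof, tsumDesc_lof, tsumDesc_lof]
    exact congrArg (app A.mul O) (app_tensorMap f (tpowMap A f n) v t)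

variable (V) in
/-- The inclusion of the generators, as a morphism of sheaves. -/
def freeHom : V.obj ⟶ (free V).A.obj := StarObj.hom (freeι V)

/-- The canonical map to the free `*`-monoid factors through `⨁ₙ V^{⊗n}(O)`. -/
lemma tsumDesc_tpowMap {O : U.Op} (p : TA V O) :
    tsumDesc (tpowMap (free V) (freeHom V)) O (toTSum V.obj O p) =
      (tensorAlgebraPre V).unit p := by
  induction p using tensorAlgebra_left_induction with
  | one =>
    rw [toTSum_one, tsumDesc_lof]
    exact (tensorAlgebraPre V).sheafification_one
  | smul r t h =>
    rw [map_smul, map_smul, h, Algebra.smul_def]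
    exact ((tensorAlgebraPre V).unit_smul r t).symm
  | add s t hs ht =>
    rw [map_add, map_add, hs, ht]
    exact ((tensorAlgebraPre V).unit_add s t).symm
  | ι_mul v t h =>
    rw [toTSum_ι_mul, tsumDesc_mul, h]
    exact (tensorAlgebraPre V).sheafification_mul _ _

/-- Pure tensors are in the image of the tensor algebra. -/
lemma tpowMap_pure {O : U.Op} {n : ℕ} {t : Sec (tpow V.obj n) O} (ht : IsPure V.obj O n t) :
    ∃ p : TA V O, toTSum V.obj O p =
      DirectSum.lof (Fn U O) ℕ (fun n => Sec (tpow V.obj n) O) n t := by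
  induction ht with
  | one => exact ⟨1, toTSum_one⟩
  | cons n v t ht ih =>
    obtain ⟨p, hp⟩ := ih
    exact ⟨TensorAlgebra.ι (Fn U O) v * p, by rw [toTSum_ι_mul, hp, tsumMul_lof]⟩

lemma exists_freeDesc {X : Sh U} (f : ∀ n, tpow V.obj n ⟶ X) : ∃ g : (free V).A.obj ⟶ X,
    ∀ O p, app g O ((tensorAlgebraPre V).unit p) = tsumDesc f O (toTSum V.obj O p) :=
  (tensorAlgebraPre V).exists_hom (fun O p => tsumDesc f O (toTSum V.obj O p))
    (fun i p => by rw [toTSum_res, tsumDesc_res])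
    (fun O p q => by rw [map_add, map_add])
    (fun O a p => by rw [← Algebra.smul_def, map_smul, map_smul])

variable (V) in
/-- The free order-reversing `*`-monoid is the direct sum of the tensor powers. -/
def freeIsColimit : IsColimit (Cofan.mk (free V).A.obj
    (tpowMap (free V) (StarObj.hom (freeι V)))) :=
  Cofan.IsColimit.mk _ (fun s => (exists_freeDesc s.inj).choose)
    (fun s n => tpow_ext fun O t ht => by
      obtain ⟨p, hp⟩ := tpowMap_pure ht
      have h := (exists_freeDesc s.inj).choose_spec O p
      rw [← tsumDesc_tpowMap, hp, tsumDesc_lof, tsumDesc_lof] at h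
      exact h)
    (fun s g hg => (tensorAlgebraPre V).hom_ext_unit fun O p => by
      rw [(exists_freeDesc s.inj).choose_spec O p, ← tsumDesc_tpowMap, ← tsumDesc_comp]
      exact congrArg (fun k => tsumDesc k O (toTSum V.obj O p)) (funext hg))

end

/-! ### The algebra of canonical anticommutation relations -/

section
variable {U : Man}

namespace IPVec

/-- The function `⟨v, w⟩`. -/
def pair (V : IPVec U) {O : U.Op} (v w : Sec V.V.obj O) : Fn U O :=
  (app (StarObj.hom V.pairing) O (tmul v w) : Sec (unitSh U) O)

lemma pair_res (V : IPVec U) {O O' : U.Op} (i : O' ≤ O) (v w : Sec V.V.obj O) :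
    V.pair (SmoothCAR.res i v) (SmoothCAR.res i w) = fnRes i (V.pair v w) := by
  have h := app_res (StarObj.hom V.pairing) i (tmul v w)
  rw [← tmul_res] at h
  exact h

lemma pair_st (V : IPVec U) {O : U.Op} (v w : Sec V.V.obj O) :
    V.pair (V.V.st v) (V.V.st w) = fnConj O (V.pair v w) := by
  have h := StarObj.map_st V.pairing (O := O) (tmul v w)
  rw [tensorStar_st] at h
  exact h

lemma pair_map {V W : IPVec U} (ψ : V ⟶ W) {O : U.Op} (v w : Sec V.V.obj O) :
    W.pair (app (StarObj.hom ((forget U).map ψ)) O v) (app (StarObj.hom ((forget U).map ψ)) O w) =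
      V.pair v w := by
  have h := congrArg (fun k : tensorStar V.V V.V ⟶ unitStar U => app (StarObj.hom k) O (tmul v w))
    (Hom.comm ψ)
  refine Eq.trans ?_ h
  exact (congrArg (app (StarObj.hom W.pairing) O) (app_tensorMap _ _ v w)).symm

end IPVec

/-- The morphisms `k : V ⟶ B` to a `*`-algebra with `k v k w + k w k v = ⟨v, w⟩ 1`. -/
def IsClifford {V : IPVec U} {B : StarAlg U} (k : V.V ⟶ B.A) : Prop :=
  ∀ (O : U.Op) (v w : Sec V.V.obj O),
    app B.mul O (tmul (app (StarObj.hom k) O v) (app (StarObj.hom k) O w)) +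
      app B.mul O (tmul (app (StarObj.hom k) O w) (app (StarObj.hom k) O v)) =
    V.pair v w • app B.one O (fn 1)

section
variable (V : IPVec U)

/-- The canonical anticommutation relations in the tensor algebra. -/
def carRel (O : U.Op) (x y : TA V.V O) : Prop :=
  ∃ v w : Sec V.V.obj O, x = taι V.V v * taι V.V w + taι V.V w * taι V.V v ∧
    y = algebraMap (Fn U O) (TA V.V O) (V.pair v w)

/-- The quotient of the tensor algebra by the canonical anticommutation relations. -/
def CarQ (O : U.Op) : Type := RingQuot (carRel V O)

instance (O : U.Op) : Ring (CarQ V O) := inferInstanceAs (Ring (RingQuot (carRel V O)))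

/-- The projection from the tensor algebra to its quotient. -/
def carMk (O : U.Op) : TA V.V O →+* CarQ V O := RingQuot.mkRingHom (carRel V O)

/-- A ring homomorphism on the tensor algebra that respects the canonical anticommutation relations
descends to the quotient. -/
def carQLift {O : U.Op} {T : Type} [Ring T] (f : TA V.V O →+* T)
    (hf : ∀ v w : Sec V.V.obj O, f (taι V.V v) * f (taι V.V w) + f (taι V.V w) * f (taι V.V v) =
      f (algebraMap (Fn U O) (TA V.V O) (V.pair v w))) : CarQ V O →+* T :=
  RingQuot.lift ⟨f, fun x y ⟨v, w, hx, hy⟩ => by rw [hx, hy, map_add, map_mul, map_mul, hf]⟩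

variable {V} {O O' : U.Op}

lemma carQLift_mk {T : Type} [Ring T] (f : TA V.V O →+* T) (hf) (x : TA V.V O) :
    carQLift V f hf (carMk V O x) = f x := RingQuot.lift_mkRingHom_apply f _ x

lemma carMk_surjective (p : CarQ V O) : ∃ x, carMk V O x = p :=
  RingQuot.mkRingHom_surjective (carRel V O) p

lemma carQ_ext {T : Type} [Ring T] {f g : CarQ V O →+* T}
    (e : ∀ x, f (carMk V O x) = g (carMk V O x)) (x : CarQ V O) : f x = g x := by
  obtain ⟨y, rfl⟩ := carMk_surjective x
  exact e y

lemma carMk_rel (v w : Sec V.V.obj O) :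
    carMk V O (taι V.V v) * carMk V O (taι V.V w) + carMk V O (taι V.V w) * carMk V O (taι V.V v) =
      carMk V O (algebraMap (Fn U O) (TA V.V O) (V.pair v w)) := by
  rw [← map_mul (carMk V O), ← map_mul (carMk V O), ← map_add (carMk V O)]
  exact RingQuot.mkRingHom_rel ⟨v, w, rfl, rfl⟩

variable (V)

/-- Restriction of the quotients of tensor algebras. -/
def carRes (i : O' ≤ O) : CarQ V O →+* CarQ V O' :=
  carQLift V ((carMk V O').comp (taRes V.V i)) fun v w => by
    rw [RingHom.comp_apply, RingHom.comp_apply, RingHom.comp_apply, taRes_ι, taRes_ι,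
      taRes_algebraMap, ← V.pair_res, carMk_rel]

lemma carRes_mk (i : O' ≤ O) (x : TA V.V O) :
    carRes V i (carMk V O x) = carMk V O' (taRes V.V i x) := carQLift_mk _ _ x

/-- The involution of the quotient of the tensor algebra, as a ring homomorphism to the opposite
ring. It is well defined because the anticommutator is symmetric and the pairing is real. -/
def carStar (O : U.Op) : CarQ V O →+* (CarQ V O)ᵐᵒᵖ :=
  carQLift V ((RingHom.op (carMk V O)).comp (taStar V.V O)) fun v w => by
    rw [RingHom.comp_apply, RingHom.comp_apply, RingHom.comp_apply, taStar_ι, taStar_ι,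
      taStar_algebraMap, ← V.pair_st, add_comm]
    exact congrArg MulOpposite.op (carMk_rel (V.V.st v) (V.V.st w))

lemma carStar_mk (x : TA V.V O) :
    carStar V O (carMk V O x) = MulOpposite.op (carMk V O (taStar V.V O x).unop) :=
  carQLift_mk _ _ x

/-- The presheaf of quotients of tensor algebras by the canonical anticommutation relations. -/
abbrev carPre : PreStarAlg U where
  carrier O := CarQ V O
  restr i := carRes V i
  restr_self {O} p := carQ_ext (f := carRes V le_rfl) (g := RingHom.id _) (fun x => by
    rw [carRes_mk]
    exact congrArg (carMk V O) ((tensorAlgebraPre V.V).restr_self x)) p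
  restr_restr {O O' O''} i j p := carQ_ext (f := (carRes V j).comp (carRes V i))
    (g := carRes V (j.trans i)) (fun x => by
      rw [RingHom.comp_apply, carRes_mk, carRes_mk, carRes_mk]
      exact congrArg (carMk V O'') ((tensorAlgebraPre V.V).restr_restr i j x)) p
  scal O := (carMk V O).comp (algebraMap (Fn U O) (TA V.V O))
  scal_res i a := by
    rw [RingHom.comp_apply, RingHom.comp_apply, carRes_mk, taRes_algebraMap]
  scal_comm {O} a p := by
    obtain ⟨x, rfl⟩ := carMk_surjective p
    change carMk V O _ * carMk V O x = carMk V O x * carMk V O _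
    rw [← map_mul, ← map_mul, Algebra.commutes]
  st {O} := (MulOpposite.opAddEquiv.symm.toAddMonoidHom).comp (carStar V O).toAddMonoidHom
  st_st {O} p := by
    obtain ⟨x, rfl⟩ := carMk_surjective p
    change (carStar V O (carStar V O (carMk V O x)).unop).unop = carMk V O x
    rw [carStar_mk, MulOpposite.unop_op, carStar_mk, MulOpposite.unop_op]
    exact congrArg (carMk V O) ((tensorAlgebraPre V.V).st_st x)
  st_mul {O} p q := by
    change (carStar V O (p * q)).unop = (carStar V O q).unop * (carStar V O p).unop
    rw [map_mul, MulOpposite.unop_mul]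
  st_scal {O} a := by
    change (carStar V O (carMk V O (algebraMap _ _ a))).unop = carMk V O (algebraMap _ _ _)
    rw [carStar_mk, taStar_algebraMap]
    rfl
  st_res {O O'} i p := by
    obtain ⟨x, rfl⟩ := carMk_surjective p
    change (carStar V O' (carRes V i (carMk V O x))).unop =
      carRes V i (carStar V O (carMk V O x)).unop
    rw [carRes_mk, carStar_mk, carStar_mk, MulOpposite.unop_op, MulOpposite.unop_op, carRes_mk]
    exact congrArg (carMk V O') ((tensorAlgebraPre V.V).st_res i x)

/-- The algebra of canonical anticommutation relations. -/
abbrev carAlg : StarAlg U := (carPre V).sheafification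

/-- The inclusion of the generators. -/
def carι : V.V ⟶ (carAlg V).A :=
  StarObj.mkHom (V := V.V) (W := (carAlg V).A)
    (homMk (W := (carPre V).sh) (fun O =>
      { toFun := fun v => (carPre V).unit (carMk V O (taι V.V v))
        map_add' := fun v w => by rw [map_add, map_add, PreStarAlg.unit_add]
        map_smul' := fun a v => by
          rw [map_smul, Algebra.smul_def, map_mul]
          exact (carPre V).unit_smul a _ })
      (fun i v => by
        refine Eq.trans ?_ ((carPre V).unit_res i _)
        exact congrArg (carPre V).unit ((carRes_mk V i _).trans
          (congrArg (carMk V _) (taRes_ι i v))).symm))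
    (fun {O} v => by
      refine Eq.trans ?_ ((carPre V).sheafification_st _).symm
      refine congrArg (carPre V).unit (Eq.trans ?_ (congrArg MulOpposite.unop (carStar_mk V _)).symm)
      exact congrArg (carMk V O) (tensorAlgebraPre_st_ι V.V v).symm)

lemma app_carι (v : Sec V.V.obj O) :
    app (StarObj.hom (carι V)) O v = (carPre V).unit (carMk V O (taι V.V v)) := rfl

lemma isClifford_carι : IsClifford (carι V) := fun O v w => by
  rw [app_carι, app_carι]
  refine (congrArg₂ (· + ·) ((carPre V).sheafification_mul _ _)
    ((carPre V).sheafification_mul _ _)).trans ?_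
  rw [(carPre V).sheafification_one]
  refine ((carPre V).unit_add _ _).symm.trans (Eq.trans ?_ ((carPre V).unit_smul _ _))
  rw [carMk_rel, mul_one]
  rfl

variable {V} {B : StarAlg U}

/-- The universal property of the algebra of canonical anticommutation relations. -/
lemma exists_carLift (k : V.V ⟶ B.A) (hk : IsClifford k) :
    ∃ f : carAlg V ⟶ B, carι V ≫ (StarAlg.forget U).map f = k := by
  let φ (O : U.Op) : CarQ V O →+* B.SecRing O := carQLift V (taLift k O) fun v w => by
    rw [taLift_ι, taLift_ι, taLift_algebraMap]
    exact hk O v w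
  have hφ (O : U.Op) (x : TA V.V O) : φ O (carMk V O x) = taLift k O x := carQLift_mk _ _ x
  obtain ⟨f, hf⟩ := (carPre V).exists_algHom (B := B) (fun O p => φ O p)
    (fun {O O'} i p => carQ_ext (f := (φ O').comp (carRes V i)) (g := (B.secRes i).comp (φ O))
      (fun x => by
        rw [RingHom.comp_apply, RingHom.comp_apply, carRes_mk, hφ, hφ, taLift_res]) p)
    (fun O p q => map_add (φ O) p q)
    (fun O a => (hφ O _).trans (taLift_algebraMap k a)) (fun O p q => map_mul (φ O) p q)
    (fun O p => MulOpposite.op_injective (carQ_ext (f := (RingHom.op (φ O)).comp (carStar V O))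
      (g := (B.secStar O).comp (φ O)) (fun x => by
        rw [RingHom.comp_apply, RingHom.comp_apply, carStar_mk, hφ, ← taLift_star]
        exact congrArg MulOpposite.op (hφ O _)) p))
  refine ⟨f, StarObj.ext (hom_ext fun O v => ?_)⟩
  exact (hf O _).trans ((hφ O _).trans (taLift_ι k v))

/-- Morphisms out of the algebra of canonical anticommutation relations are determined by their
values on generators. -/
lemma carLift_unique {f g : carAlg V ⟶ B}
    (e : carι V ≫ (StarAlg.forget U).map f = carι V ≫ (StarAlg.forget U).map g) : f = g := by
  refine StarAlg.ext (StarObj.ext ((carPre V).hom_ext_unit fun O p => ?_))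
  refine carQ_ext (f := (StarAlg.secMap f O).comp ((carPre V).unitRing O))
    (g := (StarAlg.secMap g O).comp ((carPre V).unitRing O)) (fun x => ?_) p
  refine ta_ext (f := ((StarAlg.secMap f O).comp ((carPre V).unitRing O)).comp (carMk V O))
    (g := ((StarAlg.secMap g O).comp ((carPre V).unitRing O)).comp (carMk V O)) (fun r => ?_)
    (fun v => congrArg (fun q : V.V ⟶ B.A => app (StarObj.hom q) O v) e) x
  rw [RingHom.comp_apply, RingHom.comp_apply, RingHom.comp_apply, RingHom.comp_apply]
  have e₁ : (carPre V).unitRing O (carMk V O (algebraMap (Fn U O) (TA V.V O) r)) =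
      (carAlg V).secScal O r := (carPre V).unitRing_scal r
  rw [e₁, StarAlg.secMap_secScal, StarAlg.secMap_secScal]

end

end

/-! ### Direct images of `*`-algebras -/

section
variable {U U' : Man} (h : U ⟶ U')

/-- A section of the direct image `h_* X`, as a section of `X` over the preimage. -/
def ofPush {X : Sh U} {O : U'.Op} (s : Sec ((push h).obj X) O) : Sec X (pre h O) := s

/-- A section of `X` over the preimage, as a section of the direct image `h_* X`. -/
def toPush {X : Sh U} {O : U'.Op} (s : Sec X (pre h O)) : Sec ((push h).obj X) O := s

namespace StarAlg

/-- The involution of the direct image `h_* B`. -/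
def pushStar (B : StarAlg U) : (push h).obj B.A.obj ⟶ (conj U').obj ((push h).obj B.A.obj) :=
  conjMk (X := (push h).obj B.A.obj) (fun O s => toPush h (B.A.st (ofPush h s)))
    (fun O s t => map_add B.A.st (ofPush h s) (ofPush h t))
    (fun O a s => B.A.st_smul (fnPull h O a) (ofPush h s))
    (fun i s => B.A.st_res (pre_mono h i) (ofPush h s))

/-- The product of sections of the direct image. -/
def pushProd (B : StarAlg U) {O : U'.Op} (s t : Sec ((push h).obj B.A.obj) O) :
    Sec ((push h).obj B.A.obj) O := toPush h (app B.mul (pre h O) (tmul (ofPush h s) (ofPush h t)))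

/-- The multiplication of the direct image. -/
def pushMul (B : StarAlg U) :
    tensor ((push h).obj B.A.obj) ((push h).obj B.A.obj) ⟶ (push h).obj B.A.obj :=
  tensorLift (Bilin.mk' (fun O s t => pushProd h B s t)
    (fun O s s' t => (congrArg (app B.mul (pre h O)) (add_tmul (ofPush h s) (ofPush h s')
      (ofPush h t))).trans (map_add _ _ _))
    (fun O a s t => (congrArg (app B.mul (pre h O)) (smul_tmul (fnPull h O a) (ofPush h s)
      (ofPush h t))).trans (map_smul _ _ _))
    (fun O s t t' => (congrArg (app B.mul (pre h O)) (tmul_add (ofPush h s) (ofPush h t)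
      (ofPush h t'))).trans (map_add _ _ _))
    (fun O a s t => (congrArg (app B.mul (pre h O)) (tmul_smul (fnPull h O a) (ofPush h s)
      (ofPush h t))).trans (map_smul _ _ _))
    (fun i s t => (B.mul_res (pre_mono h i) (ofPush h s) (ofPush h t)).symm))

lemma app_pushMul (B : StarAlg U) {O : U'.Op} (s t : Sec ((push h).obj B.A.obj) O) :
    app (pushMul h B) O (tmul s t) = pushProd h B s t := app_tensorLift _ s t

/-- The unit of the direct image over `O`. -/
def pushUnit (B : StarAlg U) (O : U'.Op) : Sec ((push h).obj B.A.obj) O :=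
  toPush h (app B.one (pre h O) (fn 1))

/-- The unit of the direct image. -/
def pushOne (B : StarAlg U) : unitSh U' ⟶ (push h).obj B.A.obj :=
  unitLift (pushUnit h B) (fun i => B.one_res (pre_mono h i))

lemma app_pushOne (B : StarAlg U) (O : U'.Op) :
    app (pushOne h B) O (fn 1) = pushUnit h B O := one_smul (Fn U' O) (pushUnit h B O)

/-- The direct image of a `*`-algebra. -/
abbrev pushAlg (B : StarAlg U) : StarAlg U' where
  A :=
    { obj := (push h).obj B.A.obj
      star := pushStar h B
      star_star := fun s => B.A.st_st (ofPush h s) }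
  mul := pushMul h B
  one := pushOne h B
  mul_assoc a b c := by
    rw [app_pushMul, app_pushMul, app_pushMul, app_pushMul]
    exact B.mul_assoc (ofPush h a) (ofPush h b) (ofPush h c)
  one_mul {O} a := by
    rw [app_pushMul, app_pushOne]
    exact B.one_mul (ofPush h a)
  mul_one {O} a := by
    rw [app_pushMul, app_pushOne]
    exact B.mul_one (ofPush h a)
  star_mul a b := by
    rw [app_pushMul, app_pushMul]
    exact B.star_mul (ofPush h a) (ofPush h b)
  star_one {O} := by
    rw [app_pushOne]
    exact B.star_one

lemma pushAlg_mul (B : StarAlg U) {O : U'.Op} (s t : Sec B.A.obj (pre h O)) :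
    app (pushAlg h B).mul O (tmul (toPush h s) (toPush h t)) =
      toPush h (app B.mul (pre h O) (tmul s t)) := app_pushMul h B _ _

lemma pushAlg_one (B : StarAlg U) (O : U'.Op) :
    app (pushAlg h B).one O (fn 1) = toPush h (app B.one (pre h O) (fn 1)) := app_pushOne h B O

variable {A : StarAlg U'} {B : StarAlg U}

/-- Morphisms out of the pullback of a `*`-algebra agree as soon as they agree on pulled back
sections. -/
lemma pull_ext {f g : (pull h).obj A ⟶ B}
    (e : ∀ O (a : Sec A.A.obj O), ap f (O := pre h O) (eta h a) = ap g (O := pre h O) (eta h a)) :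
    f = g :=
  ext (StarObj.ext (SmoothCAR.pull_ext h e))

end StarAlg

/-- The adjunct `V ⟶ h_* B` of a morphism `h^* V ⟶ B` of `*`-objects. -/
def StarObj.pushAdjunct {V : StarObj U'} {B : StarAlg U} (k : (StarObj.pull h).obj V ⟶ B.A) :
    V ⟶ (StarAlg.pushAlg h B).A :=
  StarObj.mkHom (V := V) (W := (StarAlg.pushAlg h B).A)
    (pushMk h (fun O v => app (StarObj.hom k) (pre h O) (eta h v))
      (fun O v w => by rw [map_add]; exact map_add _ _ _)
      (fun O a v => by rw [eta_smul]; exact map_smul _ _ _)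
      (fun i v => by rw [eta_res]; exact app_res _ _ _))
    (fun {O} v => by
      refine (congrArg (app (StarObj.hom k) (pre h O)) (pullStarHom_eta h V v).symm).trans ?_
      exact StarObj.map_st k (O := pre h O) (eta h v))

lemma StarObj.app_pushAdjunct {V : StarObj U'} {B : StarAlg U}
    (k : (StarObj.pull h).obj V ⟶ B.A) {O : U'.Op} (v : Sec V.obj O) :
    app (StarObj.hom (StarObj.pushAdjunct h k)) O v =
      toPush h (app (StarObj.hom k) (pre h O) (eta h v)) := rfl

namespace StarAlg
variable {A : StarAlg U'} {B : StarAlg U}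

/-- Morphisms `h^* A ⟶ B` of `*`-algebras have adjuncts `A ⟶ h_* B`. -/
lemma exists_pushAdjunct (g : (pull h).obj A ⟶ B) : ∃ f : A ⟶ pushAlg h B,
    ∀ O (a : Sec A.A.obj O), ap f a = toPush h (ap g (O := pre h O) (eta h a)) := by
  refine ⟨mkHom (A := A) (B := pushAlg h B)
    (StarObj.pushAdjunct h (V := A.A) (B := B) (Hom.hom g)) ?_ ?_, fun O a => rfl⟩
  · refine tensor_ext fun O a b => ?_
    rw [app_comp, app_comp, app_tensorMap, StarObj.app_pushAdjunct, StarObj.app_pushAdjunct,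
      StarObj.app_pushAdjunct, pushAlg_mul]
    refine congrArg (toPush h) (Eq.trans ?_ (ap_mul g (O := pre h O) (eta h a) (eta h b)))
    exact congrArg (ap g (O := pre h O)) (pullMul_eta h A a b).symm
  · refine unit_ext fun O => ?_
    rw [app_comp, StarObj.app_pushAdjunct, pushAlg_one]
    refine congrArg (toPush h) (Eq.trans ?_ (ap_one g (pre h O)))
    exact congrArg (ap g (O := pre h O)) (pullOne_eta h A O).symm

/-- Morphisms `A ⟶ h_* B` of `*`-algebras have adjuncts `h^* A ⟶ B`. -/
lemma exists_pullAdjunct (f : A ⟶ pushAlg h B) : ∃ g : (pull h).obj A ⟶ B,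
    ∀ O (a : Sec A.A.obj O), ap g (O := pre h O) (eta h a) = ofPush h (ap f a) := by
  let g : (SmoothCAR.pull h).obj A.A.obj ⟶ B.A.obj := pullLift h (StarObj.hom (Hom.hom f))
  have hg : ∀ O (a : Sec A.A.obj O), app g (pre h O) (eta h a) = ofPush h (ap f a) :=
    fun O a => app_pullLift h _ a
  refine ⟨mkHom (A := (pull h).obj A) (B := B) (StarObj.mkHom (V := (StarObj.pull h).obj A.A)
    (W := B.A) g fun {O} s => ?_) ?_ ?_, hg⟩
  · refine (appConj_comp_map (pullStarHom h A.A) g s).symm.trans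
      (Eq.trans (pull_conj_ext h (fun O a => ?_) s) (appConj_comp g B.A.star s))
    rw [appConj_comp_map, appConj_comp, pullStarHom_eta, hg, hg]
    exact congrArg (ofPush h) (StarObj.map_st (Hom.hom f) a)
  · refine tensor_pull_ext h fun O a b => ?_
    change app g (pre h O) (app (pullMul h A) (pre h O) (tmul (eta h a) (eta h b))) =
      app B.mul (pre h O) (app (tensorMap g g) (pre h O) (tmul (eta h a) (eta h b)))
    rw [pullMul_eta, app_tensorMap, hg, hg, hg, ap_mul]
    exact pushAlg_mul h B _ _
  · refine unit_ext fun O => ?_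
    change app g O (app (pullOne h A) O (fn 1)) = _
    rw [pullOne_res h A ⊤ (show O ≤ pre h ⊤ from fun _ _ => trivial), app_res, hg, ap_one,
      pushAlg_one]
    exact B.one_res _

end StarAlg

end

/-! ### Compatibility of free `*`-monoids with pullback, and the coequalizer property -/

section
variable {U U' : Man} (h : U ⟶ U')

/-- The value of a morphism of `*`-objects on a section. -/
abbrev StarObj.val {V W : StarObj U} (k : V ⟶ W) {O : U.Op} (v : Sec V.obj O) : Sec W.obj O :=
  app (StarObj.hom k) O v

/-- If `A` and `C` are universal `*`-algebras on generators `V` and `h^* V`, subject to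
corresponding relations, then `C` is the pullback of `A`: morphisms from either of `C` and `h^* A`
to `B` amount to morphisms `A ⟶ h_* B`. -/
lemma StarAlg.isIso_of_generators {V : StarObj U'} {A : StarAlg U'} {C : StarAlg U} (ι : V ⟶ A.A)
    (κ : (StarObj.pull h).obj V ⟶ C.A) (c : C ⟶ (StarAlg.pull h).obj A)
    (hc : ∀ (O : U'.Op) (v : Sec V.obj O),
      StarAlg.ap c (StarObj.val κ (O := pre h O) (eta h v)) = eta h (StarObj.val ι v))
    (hι : ∀ {B : StarAlg U'} (f g : A ⟶ B), (∀ (O : U'.Op) (v : Sec V.obj O),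
      StarAlg.ap f (StarObj.val ι v) = StarAlg.ap g (StarObj.val ι v)) → f = g)
    (hκ : ∀ {B : StarAlg U} (f g : C ⟶ B), (∀ (O : U'.Op) (v : Sec V.obj O),
      StarAlg.ap f (StarObj.val κ (O := pre h O) (eta h v)) =
        StarAlg.ap g (StarObj.val κ (O := pre h O) (eta h v))) → f = g)
    (lift : ∀ {B : StarAlg U} (m : C ⟶ B), ∃ f : A ⟶ StarAlg.pushAlg h B,
      ∀ (O : U'.Op) (v : Sec V.obj O), StarAlg.ap f (StarObj.val ι v) =
        toPush h (StarAlg.ap m (StarObj.val κ (O := pre h O) (eta h v)))) :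
    IsIso c := by
  refine isIso_of_coyoneda_map_bijective _ fun B => ⟨fun k k' e => ?_, fun m => ?_⟩
  · obtain ⟨f, hf⟩ := StarAlg.exists_pushAdjunct h k
    obtain ⟨f', hf'⟩ := StarAlg.exists_pushAdjunct h k'
    have e₁ : f = f' := hι f f' fun O v => by
      rw [hf, hf', ← hc]
      exact congrArg (fun z : C ⟶ B => toPush h (StarAlg.ap z _)) e
    refine StarAlg.pull_ext h fun O a => ?_
    exact (hf O a).symm.trans ((congrArg (fun z : A ⟶ StarAlg.pushAlg h B =>
      StarAlg.ap z a) e₁).trans (hf' O a))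
  · obtain ⟨f, hf⟩ := lift m
    obtain ⟨g, hg⟩ := StarAlg.exists_pullAdjunct h f
    refine ⟨g, hκ _ _ fun O v => ?_⟩
    exact (congrArg (StarAlg.ap g (O := pre h O)) (hc O v)).trans
      ((hg O _).trans (congrArg (ofPush h) (hf O v)))

end

section
variable {U : Man} {V W : StarObj U} {B : StarAlg U}

lemma free_hom_ext {f g : free V ⟶ B} (e : ∀ (O : U.Op) (v : Sec V.obj O),
    StarAlg.ap f (StarObj.val (freeι V) v) = StarAlg.ap g (StarObj.val (freeι V) v)) : f = g :=
  freeLift_unique (StarObj.ext (hom_ext e))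

/-- The adjunct `F(V) ⟶ B` of `k` extends `k` from the generators. -/
lemma ap_homEquiv_symm (k : V ⟶ B.A) {O : U.Op} (v : Sec V.obj O) :
    StarAlg.ap (((freeAdj U).homEquiv V B).symm k : free V ⟶ B) (StarObj.val (freeι V) v) =
      StarObj.val k v := by
  have e := ((freeAdj U).homEquiv V B).apply_symm_apply k
  rw [Adjunction.homEquiv_unit, freeAdj_unit] at e
  exact congrArg (fun z : V ⟶ B.A => StarObj.val z v) e

lemma ap_freeFunctor_map (ψ : V ⟶ W) {O : U.Op} (v : Sec V.obj O) :
    StarAlg.ap ((freeFunctor U).map ψ : free V ⟶ free W) (StarObj.val (freeι V) v) =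
      StarObj.val (freeι W) (StarObj.val ψ v) := by
  have e := (freeAdj U).unit.naturality ψ
  rw [freeAdj_unit, freeAdj_unit] at e
  exact (congrArg (fun z : V ⟶ (free W).A => StarObj.val z v) e).symm

variable {U' : Man} (h : U ⟶ U')

lemma free_pull_hom_ext {V : StarObj U'} {f g : free ((StarObj.pull h).obj V) ⟶ B}
    (e : ∀ (O : U'.Op) (v : Sec V.obj O),
      StarAlg.ap f (StarObj.val (freeι ((StarObj.pull h).obj V)) (O := pre h O) (eta h v)) =
      StarAlg.ap g (StarObj.val (freeι ((StarObj.pull h).obj V)) (O := pre h O) (eta h v))) :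
    f = g :=
  freeLift_unique (StarObj.ext (pull_ext h e))

lemma ap_freeComparison (V : StarObj U') {O : U'.Op} (v : Sec V.obj O) :
    StarAlg.ap (freeComparison (freeAdj U) (freeAdj U') h V : free ((StarObj.pull h).obj V) ⟶ _)
      (StarObj.val (freeι ((StarObj.pull h).obj V)) (O := pre h O) (eta h v)) =
      eta h (StarObj.val (freeι V) v) := by
  refine (ap_homEquiv_symm (B := (StarAlg.pull h).obj (free V))
    ((StarObj.pull h).map ((freeAdj U').unit.app V)) (eta h v)).trans ?_
  rw [freeAdj_unit]
  exact app_pull_map h _ v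

/-- Forming the free `*`-monoid commutes with pullback. -/
lemma isIso_freeComparison (V : StarObj U') :
    IsIso (freeComparison (freeAdj U) (freeAdj U') h V) :=
  StarAlg.isIso_of_generators h (A := free V) (C := free ((StarObj.pull h).obj V)) (freeι V)
    (freeι ((StarObj.pull h).obj V)) (freeComparison (freeAdj U) (freeAdj U') h V)
    (fun _ v => ap_freeComparison h V v) (fun _ _ e => free_hom_ext e)
    (fun _ _ e => free_pull_hom_ext h e)
    (fun {B} m => by
      obtain ⟨f, hf⟩ := exists_freeLift (B := StarAlg.pushAlg h B)
        (StarObj.pushAdjunct h (freeι ((StarObj.pull h).obj V) ≫ (StarAlg.forget U).map m))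
      exact ⟨f, fun O v => congrArg (fun z : V ⟶ (StarAlg.pushAlg h B).A => StarObj.val z v) hf⟩)

end

section
variable {U : Man} {V W : IPVec U} {B C : StarAlg U}

lemma car_hom_ext {f g : carAlg V ⟶ B} (e : ∀ (O : U.Op) (v : Sec V.V.obj O),
    StarAlg.ap f (StarObj.val (carι V) v) = StarAlg.ap g (StarObj.val (carι V) v)) : f = g :=
  carLift_unique (StarObj.ext (hom_ext e))

/-- Clifford maps may be precomposed with morphisms that preserve the pairing. -/
lemma isClifford_map (ψ : V ⟶ W) {k : W.V ⟶ B.A} (hk : IsClifford k) :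
    IsClifford (V := V) ((IPVec.forget U).map ψ ≫ k) := fun O v w => by
  rw [← IPVec.pair_map ψ]
  exact hk O _ _

lemma IsClifford.comp {k : V.V ⟶ B.A} (hk : IsClifford k)
    (f : B ⟶ C) : IsClifford (V := V) (B := C) (k ≫ (StarAlg.forget U).map f) := fun O v w => by
  have e := congrArg (StarAlg.ap f) (hk O v w)
  refine Eq.trans (Eq.symm ?_) (e.trans ?_)
  · refine (map_add (app (StarObj.hom (StarAlg.Hom.hom f)) O) _ _).trans ?_
    exact congrArg₂ (· + ·) (StarAlg.ap_mul f _ _) (StarAlg.ap_mul f _ _)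
  · refine (map_smul (app (StarObj.hom (StarAlg.Hom.hom f)) O) _ _).trans ?_
    exact congrArg (V.pair v w • ·) (StarAlg.ap_one f O)

/-- The morphism of `*`-algebras that is induced by a Clifford map. -/
def carLift (k : V.V ⟶ B.A) (hk : IsClifford k) : carAlg V ⟶ B :=
  (exists_carLift k hk).choose

lemma ap_carLift (k : V.V ⟶ B.A) (hk : IsClifford k) {O : U.Op} (v : Sec V.V.obj O) :
    StarAlg.ap (carLift k hk) (StarObj.val (carι V) v) = StarObj.val k v :=
  congrArg (fun z : V.V ⟶ B.A => StarObj.val z v) (exists_carLift k hk).choose_spec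

/-- The morphism of algebras of canonical anticommutation relations that extends a morphism of the
generators. -/
def carMap (ψ : V ⟶ W) : carAlg V ⟶ carAlg W :=
  carLift _ (isClifford_map ψ (isClifford_carι W))

lemma ap_carMap (ψ : V ⟶ W) {O : U.Op} (v : Sec V.V.obj O) :
    StarAlg.ap (carMap ψ) (StarObj.val (carι V) v) =
      StarObj.val (carι W) (StarObj.val ((IPVec.forget U).map ψ) v) := ap_carLift _ _ v

variable (U) in
/-- The functor of algebras of canonical anticommutation relations. -/
def carFunctor : IPVec U ⥤ StarAlg U where
  obj := carAlg
  map := carMap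
  map_id V := car_hom_ext fun O v => ap_carMap (𝟙 V) v
  map_comp {V W X} ψ φ := car_hom_ext fun O v => by
    refine (ap_carMap (ψ ≫ φ) v).trans (Eq.symm ?_)
    exact (congrArg (StarAlg.ap (carMap φ)) (ap_carMap ψ v)).trans (ap_carMap φ _)

/-- The projection from the free `*`-monoid. -/
def carπ (V : IPVec U) : free V.V ⟶ carAlg V :=
  ((freeAdj U).homEquiv V.V (carAlg V)).symm (carι V)

lemma ap_carπ {O : U.Op} (v : Sec V.V.obj O) :
    StarAlg.ap (carπ V) (StarObj.val (freeι V.V) v) = StarObj.val (carι V) v :=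
  ap_homEquiv_symm (carι V) v

lemma StarAlg.anticomm_tmul (A : StarAlg U) {O : U.Op} (a b : Sec A.A.obj O) :
    StarObj.val A.anticomm (tmul a b) = app A.mul O (tmul a b) + app A.mul O (tmul b a) := by
  change app (A.mul + swap _ _ ≫ A.mul) O (tmul a b) = _
  rw [app_add, app_comp, app_swap]

lemma ap_relAnticomm {O : U.Op} (v w : Sec V.V.obj O) :
    StarAlg.ap (relAnticomm (freeAdj U) V : free (tensorStar V.V V.V) ⟶ free V.V)
      (StarObj.val (freeι (tensorStar V.V V.V)) (tmul v w)) =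
    app (free V.V).mul O (tmul (StarObj.val (freeι V.V) v) (StarObj.val (freeι V.V) w)) +
      app (free V.V).mul O (tmul (StarObj.val (freeι V.V) w) (StarObj.val (freeι V.V) v)) := by
  refine (ap_homEquiv_symm (V := tensorStar V.V V.V) (B := free V.V) _ (tmul v w)).trans ?_
  rw [freeAdj_unit]
  refine Eq.trans ?_ ((free V.V).anticomm_tmul _ _)
  exact congrArg (StarObj.val (free V.V).anticomm) (app_tensorMap _ _ v w)

lemma ap_relPairing {O : U.Op} (v w : Sec V.V.obj O) :
    StarAlg.ap (relPairing (freeAdj U) V : free (tensorStar V.V V.V) ⟶ free V.V)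
      (StarObj.val (freeι (tensorStar V.V V.V)) (tmul v w)) =
    V.pair v w • app (free V.V).one O (fn 1) := by
  refine (ap_homEquiv_symm (V := tensorStar V.V V.V) (B := free V.V) _ (tmul v w)).trans ?_
  refine Eq.trans ?_ (map_smul (app (free V.V).one O) (V.pair v w) (fn 1))
  rw [← fn_eq_smul]
  rfl

/-- The two relations agree after a morphism of `*`-algebras exactly if its restriction to the
generators is a Clifford map. -/
lemma rel_comp_eq_iff (f : free V.V ⟶ B) :
    (relAnticomm (freeAdj U) V : free (tensorStar V.V V.V) ⟶ free V.V) ≫ f =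
      (relPairing (freeAdj U) V : free (tensorStar V.V V.V) ⟶ free V.V) ≫ f ↔
      IsClifford (freeι V.V ≫ (StarAlg.forget U).map f) := by
  have e₁ {O : U.Op} (v w : Sec V.V.obj O) := congrArg (StarAlg.ap f) (ap_relAnticomm v w)
  have e₂ {O : U.Op} (v w : Sec V.V.obj O) := congrArg (StarAlg.ap f) (ap_relPairing v w)
  have e₃ {O : U.Op} (v w : Sec V.V.obj O) :
      StarAlg.ap f (app (free V.V).mul O (tmul (StarObj.val (freeι V.V) v)
          (StarObj.val (freeι V.V) w)) +
        app (free V.V).mul O (tmul (StarObj.val (freeι V.V) w) (StarObj.val (freeι V.V) v))) =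
      app B.mul O (tmul (StarAlg.ap f (StarObj.val (freeι V.V) v))
          (StarAlg.ap f (StarObj.val (freeι V.V) w))) +
        app B.mul O (tmul (StarAlg.ap f (StarObj.val (freeι V.V) w))
          (StarAlg.ap f (StarObj.val (freeι V.V) v))) :=
    (map_add (app (StarObj.hom (StarAlg.Hom.hom f)) O) _ _).trans
      (congrArg₂ (· + ·) (StarAlg.ap_mul f _ _) (StarAlg.ap_mul f _ _))
  have e₄ {O : U.Op} (v w : Sec V.V.obj O) :
      StarAlg.ap f (V.pair v w • app (free V.V).one O (fn 1)) =
        V.pair v w • app B.one O (fn 1) :=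
    (map_smul (app (StarObj.hom (StarAlg.Hom.hom f)) O) _ _).trans
      (congrArg (V.pair v w • ·) (StarAlg.ap_one f O))
  constructor
  · intro e O v w
    refine (e₃ v w).symm.trans (((e₁ v w).symm.trans ?_).trans ((e₂ v w).trans (e₄ v w)))
    exact congrArg (fun z : free (tensorStar V.V V.V) ⟶ B =>
      StarAlg.ap z (StarObj.val (freeι (tensorStar V.V V.V)) (tmul v w))) e
  · intro hf
    refine freeLift_unique (StarObj.ext (tensor_ext fun O v w => ?_))
    exact (e₁ v w).trans (((e₃ v w).trans (hf O v w)).trans ((e₂ v w).trans (e₄ v w)).symm)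

/-- The adjunct of the projection is the inclusion of the generators. -/
lemma freeι_carπ (V : IPVec U) : freeι V.V ≫ (StarAlg.forget U).map (carπ V) = carι V :=
  StarObj.ext (hom_ext fun _ v => ap_carπ v)

lemma carπ_condition (V : IPVec U) :
    relAnticomm (freeAdj U) V ≫ carπ V = relPairing (freeAdj U) V ≫ carπ V :=
  (rel_comp_eq_iff (carπ V)).2 ((congrArg (IsClifford (V := V) (B := carAlg V))
    (freeι_carπ V)).mpr (isClifford_carι V))

/-- The algebra of canonical anticommutation relations is a coequalizer. -/
def carIsColimit (V : IPVec U) : IsColimit (Cofork.ofπ (carπ V) (carπ_condition V)) :=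
  Cofork.IsColimit.mk _
    (fun s => carLift (V := V) (B := s.pt) (freeι V.V ≫ (StarAlg.forget U).map s.π)
      ((rel_comp_eq_iff s.π).1 s.condition))
    (fun s => free_hom_ext (B := s.pt) fun O v =>
      (congrArg (StarAlg.ap _) (ap_carπ v)).trans (ap_carLift _ _ v))
    (fun s m hm => car_hom_ext (B := s.pt) fun O v => by
      rw [ap_carLift, ← ap_carπ]
      exact congrArg (fun z : free V.V ⟶ s.pt => StarAlg.ap z (StarObj.val (freeι V.V) v)) hm)

lemma carπ_naturality (ψ : V ⟶ W) :
    carπ V ≫ carMap ψ = (freeFunctor U).map ((IPVec.forget U).map ψ) ≫ carπ W :=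
  free_hom_ext fun O v => by
    refine (congrArg (StarAlg.ap (carMap ψ)) (ap_carπ v)).trans ((ap_carMap ψ v).trans ?_)
    refine (ap_carπ (V := W) _).symm.trans ?_
    exact congrArg (StarAlg.ap (carπ W)) (ap_freeFunctor_map _ v).symm

end

/-! ### Coherence isomorphisms -/

section
variable {U U' : Man} (h : U ⟶ U')

lemma IPVec.pair_pull (V : IPVec U') {O : U'.Op} (v w : Sec V.V.obj O) :
    ((IPVec.pull h).obj V).pair (O := pre h O) (eta h v) (eta h w) = fnPull h O (V.pair v w) :=
  IPVec.pullPairing_eta h V v w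

lemma car_pull_hom_ext {V : IPVec U'} {B : StarAlg U} {f g : carAlg ((IPVec.pull h).obj V) ⟶ B}
    (e : ∀ (O : U'.Op) (v : Sec V.V.obj O),
      StarAlg.ap f (StarObj.val (carι ((IPVec.pull h).obj V)) (O := pre h O) (eta h v)) =
      StarAlg.ap g (StarObj.val (carι ((IPVec.pull h).obj V)) (O := pre h O) (eta h v))) :
    f = g :=
  carLift_unique (StarObj.ext (pull_ext h e))

/-- Both sides of the Clifford relation are linear on `h^* V ⊗ h^* V`, so that it may be verified on
pulled back sections. -/
lemma IsClifford.pull {V : IPVec U'} {A : StarAlg U'} {k : V.V ⟶ A.A} (hk : IsClifford k) :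
    IsClifford (V := (IPVec.pull h).obj V) (B := (StarAlg.pull h).obj A)
      ((StarObj.pull h).map k) := by
  let A' := (StarAlg.pull h).obj A
  let k' : (SmoothCAR.pull h).obj V.V.obj ⟶ A'.A.obj := (SmoothCAR.pull h).map (StarObj.hom k)
  have hk' {O : U'.Op} (v : Sec V.V.obj O) : app k' (pre h O) (eta h v) =
    eta h (app (StarObj.hom k) O v) := app_pull_map h _ v
  have hm {O : U'.Op} (a b : Sec A.A.obj O) : app A'.mul (pre h O) (tmul (eta h a) (eta h b)) =
    eta h (app A.mul O (tmul a b)) := StarAlg.pullMul_eta h A a b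
  have ho (O : U'.Op) : app A'.one (pre h O) (fn 1) = eta h (app A.one O (fn 1)) :=
    StarAlg.pullOne_eta h A O
  have hl {O : U.Op} (s t : Sec ((SmoothCAR.pull h).obj V.V.obj) O) :
      app (tensorMap k' k' ≫ (A'.mul + swap _ _ ≫ A'.mul)) O (tmul s t) =
        app A'.mul O (tmul (app k' O s) (app k' O t)) +
          app A'.mul O (tmul (app k' O t) (app k' O s)) := by
    rw [app_comp, app_tensorMap, app_add, app_comp, app_swap]
  have hr {O : U.Op} (s t : Sec ((SmoothCAR.pull h).obj V.V.obj) O) :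
      app (StarObj.hom ((IPVec.pull h).obj V).pairing ≫ A'.one) O (tmul s t) =
        ((IPVec.pull h).obj V).pair s t • app A'.one O (fn 1) := by
    rw [app_comp, ← map_smul, ← fn_eq_smul]
    rfl
  have e : tensorMap k' k' ≫ (A'.mul + swap _ _ ≫ A'.mul) =
      StarObj.hom ((IPVec.pull h).obj V).pairing ≫ A'.one := by
    refine tensor_pull_ext h fun O v w => ?_
    rw [hl, hk', hk', hm, hm, ← map_add, hk O v w, eta_smul, ← ho]
    exact ((hr (eta h v) (eta h w)).trans (congrArg (· • _) (V.pair_pull h v w))).symm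
  intro O s t
  exact (hl s t).symm.trans ((congrArg (fun z => app z O (tmul s t)) e).trans (hr s t))

lemma IsClifford.pushAdjunct {V : IPVec U'} {B : StarAlg U} {k : (StarObj.pull h).obj V.V ⟶ B.A}
    (hk : IsClifford (V := (IPVec.pull h).obj V) k) :
    IsClifford (V := V) (B := StarAlg.pushAlg h B) (StarObj.pushAdjunct h k) := fun O v w => by
  have e := hk (pre h O) (eta h v) (eta h w)
  rw [V.pair_pull h] at e
  rw [StarObj.app_pushAdjunct, StarObj.app_pushAdjunct, StarAlg.pushAlg_mul, StarAlg.pushAlg_mul,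
    StarAlg.pushAlg_one]
  exact congrArg (toPush h) e

/-- The comparison `CAR(h^* V) ⟶ h^* CAR(V)`. -/
def carComparison (V : IPVec U') :
    carAlg ((IPVec.pull h).obj V) ⟶ (StarAlg.pull h).obj (carAlg V) :=
  carLift (V := (IPVec.pull h).obj V) _ ((isClifford_carι V).pull h)

lemma ap_carComparison {V : IPVec U'} {O : U'.Op} (v : Sec V.V.obj O) :
    StarAlg.ap (carComparison h V)
      (StarObj.val (carι ((IPVec.pull h).obj V)) (O := pre h O) (eta h v)) =
      eta h (StarObj.val (carι V) v) :=
  (ap_carLift (V := (IPVec.pull h).obj V) (B := (StarAlg.pull h).obj (carAlg V)) _ _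
    (eta h v)).trans (app_pull_map h _ v)

/-- Forming the algebra of canonical anticommutation relations commutes with pullback: Clifford maps
`h^* V ⟶ B` correspond to Clifford maps `V ⟶ h_* B`. -/
lemma isIso_carComparison (V : IPVec U') : IsIso (carComparison h V) :=
  StarAlg.isIso_of_generators h (A := carAlg V) (C := carAlg ((IPVec.pull h).obj V)) (carι V)
    (carι ((IPVec.pull h).obj V)) (carComparison h V) (fun _ v => ap_carComparison h v)
    (fun _ _ e => car_hom_ext e) (fun _ _ e => car_pull_hom_ext h e)
    (fun {B} m => ⟨carLift _ (IsClifford.pushAdjunct h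
      ((isClifford_carι ((IPVec.pull h).obj V)).comp m)), fun O v => ap_carLift _ _ v⟩)

lemma ap_pull_map {A B : StarAlg U'} (f : A ⟶ B) {O : U'.Op} (a : Sec A.A.obj O) :
    StarAlg.ap ((StarAlg.pull h).map f) (O := pre h O) (eta h a) = eta h (StarAlg.ap f a) :=
  app_pull_map h _ a

lemma carComparison_naturality {V W : IPVec U'} (ψ : V ⟶ W) :
    carMap ((IPVec.pull h).map ψ) ≫ carComparison h W =
      carComparison h V ≫ (StarAlg.pull h).map (carMap ψ) :=
  car_pull_hom_ext h fun O v => by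
    refine (congrArg (StarAlg.ap (carComparison h W)) ((ap_carMap ((IPVec.pull h).map ψ)
      (eta h v)).trans (congrArg (StarObj.val (carι ((IPVec.pull h).obj W)))
        (app_pull_map h _ v)))).trans ?_
    refine (ap_carComparison h _).trans (Eq.symm ?_)
    refine (congrArg (StarAlg.ap ((StarAlg.pull h).map (carMap ψ))) (ap_carComparison h v)).trans ?_
    exact (ap_pull_map h _ _).trans (congrArg (eta h) (ap_carMap ψ v))

lemma carπ_carComparison (V : IPVec U') :
    carπ ((IPVec.pull h).obj V) ≫ carComparison h V =
      (freeComparison (freeAdj U) (freeAdj U') h V.V : free ((StarObj.pull h).obj V.V) ⟶ _) ≫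
        (StarAlg.pull h).map (carπ V) :=
  free_pull_hom_ext h fun O v => by
    refine (congrArg (StarAlg.ap (carComparison h V)) (ap_carπ (V := (IPVec.pull h).obj V)
      (eta h v))).trans ((ap_carComparison h v).trans (Eq.symm ?_))
    refine (congrArg (StarAlg.ap ((StarAlg.pull h).map (carπ V)))
      (ap_freeComparison h V.V v)).trans ?_
    exact (ap_pull_map h _ _).trans (congrArg (eta h) (ap_carπ v))

/-- The coherence isomorphism along `h`. -/
def carCoherence : IPVec.pull h ⋙ carFunctor U ≅ carFunctor U' ⋙ StarAlg.pull h :=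
  NatIso.ofComponents (fun V => @asIso _ _ _ _ (carComparison h V) (isIso_carComparison h V))
    (carComparison_naturality h)

lemma carComparison_id (V : IPVec U) :
    carComparison (𝟙 U) V ≫ (StarAlg.prestack.pullId U).hom.app (carAlg V) =
      carMap ((IPVec.prestack.pullId U).hom.app V) :=
  car_pull_hom_ext (𝟙 U) fun O v => by
    refine (congrArg (app (pullIdHom (carAlg V).A.obj) O) (ap_carComparison (𝟙 U) v)).trans ?_
    refine (pullIdHom_eta _).trans (Eq.symm ?_)
    refine (ap_carMap (V := (IPVec.pull (𝟙 U)).obj V) (W := V) _ (eta (𝟙 U) v)).trans ?_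
    exact congrArg (StarObj.val (carι V)) (pullIdHom_eta v)

lemma carComparison_comp {U'' : Man} (g : U ⟶ U') (h : U' ⟶ U'') (V : IPVec U'') :
    carComparison (g ≫ h) V ≫ (StarAlg.prestack.pullComp g h).hom.app (carAlg V) =
      carMap ((IPVec.prestack.pullComp g h).hom.app V) ≫
        carComparison g ((IPVec.pull h).obj V) ≫ (StarAlg.pull g).map (carComparison h V) :=
  car_pull_hom_ext (g ≫ h) fun O v => by
    refine (congrArg (app (pullCompHom g h (carAlg V).A.obj) (pre (g ≫ h) O))
      (ap_carComparison (g ≫ h) v)).trans ((pullCompHom_eta g h _).trans (Eq.symm ?_))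
    have e₁ : StarAlg.ap (carMap ((IPVec.prestack.pullComp g h).hom.app V)) (O := pre (g ≫ h) O)
        (StarObj.val (carι ((IPVec.pull (g ≫ h)).obj V)) (O := pre (g ≫ h) O) (eta (g ≫ h) v)) =
        StarObj.val (carι ((IPVec.pull g).obj ((IPVec.pull h).obj V))) (O := pre (g ≫ h) O)
          (eta g (eta h v)) :=
      (ap_carMap (V := (IPVec.pull (g ≫ h)).obj V)
        (W := (IPVec.pull g).obj ((IPVec.pull h).obj V)) _ (eta (g ≫ h) v)).trans
        (congrArg (StarObj.val (carι _)) (pullCompHom_eta g h v))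
    refine (congrArg (fun z => StarAlg.ap ((StarAlg.pull g).map (carComparison h V))
      (StarAlg.ap (carComparison g ((IPVec.pull h).obj V)) z)) e₁).trans ?_
    refine (congrArg (StarAlg.ap ((StarAlg.pull g).map (carComparison h V)))
      (ap_carComparison g (V := (IPVec.pull h).obj V) (eta h v))).trans ?_
    exact (ap_pull_map g _ _).trans (congrArg (eta g) (ap_carComparison h v))

end

/-! ### The stack morphism -/

lemma map_id_comp_aux {C D : Type*} [Category* C] [Category* D] (F : C ⥤ D) {a : C} {b : D}
    (x : F.obj a ⟶ b) : F.map (𝟙 a) ≫ x = x ≫ 𝟙 b := by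
  rw [F.map_id, Category.id_comp, Category.comp_id]

/-- The form in which compatibility with identities occurs on components; the identities on the right
are components of unitors. -/
lemma comp_eq_aux {D : Type*} [Category* D] {a b : D} {x m : a ⟶ b} (e : x = m) :
    x = m ≫ 𝟙 b ≫ 𝟙 b := by
  rw [Category.id_comp, Category.comp_id, e]

/-- The form in which compatibility with compositions occurs on components; the identities on the
right are components of associators. -/
lemma comp_comp_eq_aux {D : Type*} [Category* D] {a b c d : D} {x : a ⟶ d} {p : a ⟶ b} {q : b ⟶ c}
    {r : c ⟶ d} (e : x = p ≫ q ≫ r) : x = p ≫ 𝟙 b ≫ q ≫ 𝟙 c ≫ r ≫ 𝟙 d := by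
  rw [Category.id_comp, Category.id_comp, Category.comp_id, e]

/-- A morphism of prestacks from functors on each manifold and coherence isomorphisms that are
compatible with identities and compositions. The unitors and associators of the bicategory of
categories have identity components, so they do not occur in the conditions. -/
def Prestack.homMk {S T : Prestack} (Φ : ∀ U, S.C U ⥤ T.C U)
    (coh : ∀ {U U' : Man} (h : U ⟶ U'), S.pull h ⋙ Φ U ≅ Φ U' ⋙ T.pull h)
    (coh_id : ∀ (U : Man) (V : S.C U), (coh (𝟙 U)).hom.app V ≫ (T.pullId U).hom.app ((Φ U).obj V) =
      (Φ U).map ((S.pullId U).hom.app V))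
    (coh_comp : ∀ {U U' U'' : Man} (g : U ⟶ U') (h : U' ⟶ U'') (V : S.C U''),
      (coh (g ≫ h)).hom.app V ≫ (T.pullComp g h).hom.app ((Φ U'').obj V) =
        (Φ U).map ((S.pullComp g h).hom.app V) ≫
          (coh g).hom.app ((S.pull h).obj V) ≫ (T.pull g).map ((coh h).hom.app V)) :
    S.Hom T where
  app U := (Φ U.as.unop).toCatHom
  naturality f := Cat.Hom.isoMk (coh f.as.unop)
  naturality_naturality {a b f g} η := by
    obtain rfl := LocallyDiscrete.eq_of_hom η
    rw [show η = 𝟙 f from Subsingleton.elim _ _, PrelaxFunctor.map₂_id, PrelaxFunctor.map₂_id]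
    exact Cat.Hom₂.ext (NatTrans.ext (funext fun V =>
      map_id_comp_aux (Φ b.as.unop) ((coh f.as.unop).hom.app V)))
  naturality_id U := Cat.Hom₂.ext (NatTrans.ext (funext fun V =>
    comp_eq_aux (D := T.C U.as.unop) (coh_id U.as.unop V)))
  naturality_comp f g := Cat.Hom₂.ext (NatTrans.ext (funext fun V =>
    comp_comp_eq_aux (D := T.C _) (coh_comp g.as.unop f.as.unop V)))

/-- The stack morphism of algebras of canonical anticommutation relations. -/
def carHom : IPVec.prestack.Hom StarAlg.prestack :=
  Prestack.homMk (S := IPVec.prestack) (T := StarAlg.prestack) carFunctor carCoherence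
    (fun _ V => carComparison_id V) carComparison_comp

end SmoothCAR

end

theorem mainTheorem3 :
    ∃ (F : ∀ U : Man, StarObj U ⥤ StarAlg U) (adj : ∀ U : Man, F U ⊣ StarAlg.forget U),
      (∀ (U : Man) (V : StarObj U), Nonempty (IsColimit (Cofan.mk ((F U).obj V).A.obj
        (tpowMap ((F U).obj V) (StarObj.hom ((adj U).unit.app V)))))) ∧
      (∀ {U U' : Man} (h : U ⟶ U') (V : StarObj U'),
        IsIso (freeComparison (adj U) (adj U') h V)) ∧
      ∃ (CAR : IPVec.prestack.Hom StarAlg.prestack)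
        (π : ∀ (U : Man) (V : IPVec U), (F U).obj V.V ⟶ (CAR.functor U).obj V),
        (∀ (U : Man) (V : IPVec U),
          ∃ w : relAnticomm (adj U) V ≫ π U V = relPairing (adj U) V ≫ π U V,
            Nonempty (IsColimit (Cofork.ofπ (π U V) w))) ∧
        (∀ {U : Man} {V W : IPVec U} (ψ : V ⟶ W),
          π U V ≫ (CAR.functor U).map ψ = (F U).map ((IPVec.forget U).map ψ) ≫ π U W) ∧
        (∀ {U U' : Man} (h : U ⟶ U') (V : IPVec U'),
          π U ((IPVec.pull h).obj V) ≫ (CAR.coherence h).hom.app V =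
            freeComparison (adj U) (adj U') h V.V ≫ (StarAlg.pull h).map (π U' V)) := by
  refine ⟨freeFunctor, freeAdj, fun U V => ?_, isIso_freeComparison, carHom, fun U V => carπ V,
    fun U V => ⟨carπ_condition V, ⟨carIsColimit V⟩⟩, fun ψ => carπ_naturality ψ,
    fun h V => carπ_carComparison h V⟩
  rw [freeAdj_unit]
  exact ⟨freeIsColimit V⟩
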